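/- Let $k\ge-\tfrac12$ and let $M=\begin{pmatrix}a&b\\c&d\end{pmatrix}\in SL(2,\mathbb R)$ with $b\neq0$. Put $$d\mu_k(x)=\frac{|x|^{2k+1}\,dx}{2^{k+1}\Gamma(k+1)},\qquad d\nu_k(\alpha,\beta)=d\mu_k(\beta)\,\frac{d\alpha}{\alpha^{2k+3}}\quad(\alpha>0,\ \beta\in\mathbb R),\qquad L^p_k=L^p(\mathbb R,\mu_k),$$ and let complex powers be principal. Let $E_k(z,x)=j_k(izx)+\frac{zx}{2(k+1)}\,j_{k+1}(izx)$ be the Dunkl kernel on $\mathbb R$, where $j_k(z)=\Gamma(k+1)\sum_{n\ge0}\frac{(-1)^n(z/2)^{2n}}{n!\,\Gamma(n+k+1)}$. The linear canonical Dunkl transform is $$D^M_kf(\lambda)=\frac1{(ib)^{k+1}}\int_{\mathbb R}f(x)\,e^{\frac i2\left(\frac db\lambda^2+\frac ab x^2\right)}E_k(-i\lambda/b,x)\,d\mu_k(x)$$ for $f\in L^1_k\cap L^2_k$, extended to $L^2_k$ by continuity. Let $T_x$ be the Dunkl translation: $T_xf(y)=\int_{\mathbb R}f(z)\,W_k(x,y,z)\,d\mu_k(z)$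 for $k>-\frac12$ and $xy\ne0$, where $$W_k(x,y,z)=\frac{\Gamma(k+1)^2}{2^{k-1}\sqrt\pi\,\Gamma(k+\frac12)}\,\bigl(1-\sigma_{x,y,z}+\sigma_{z,x,y}+\sigma_{z,y,x}\bigr)\,\frac{\bigl[\bigl((|x|+|y|)^2-z^2\bigr)\bigl(z^2-(|x|-|y|)^2\bigr)\bigr]^{k-\frac12}}{|xyz|^{2k}}$$ if $\bigl||x|-|y|\bigr|\le|z|\le|x|+|y|$ and $W_k(x,y,z)=0$ otherwise, with $\sigma_{x,y,z}=\frac{x^2+y^2-z^2}{2xy}$; and $T_xf(y)=f(x+y)$ if $k=-\frac12$ or $xy=0$. For $\alpha>0$ and $\beta\in\mathbb R$ put $$T^M_\beta g(y)=e^{-\frac i2\frac ab(\beta^2+y^2)}\,T_\beta\bigl(e^{\frac i2\frac ab(\cdot)^2}g\bigr)(y),\qquad \psi^M_\alpha(x)=\alpha^{-(2k+2)}e^{-\frac i2\frac ab\left(1-\frac1{\alpha^2}\right)x^2}\psi(x/\alpha),$$ $$\psi^M_{\alpha,\beta}=\alpha^{k+1}\,T^M_\beta(\psi^M_\alpha),\qquad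 \Phi^M_\psi f(\alpha,\beta)=\frac1{(ib)^{k+1}}\int_{\mathbb R}f(y)\,\overline{\psi^M_{\alpha,\beta}(y)}\,d\mu_k(y).$$ Let $\psi,\varphi\in L^2_k$ be a two-wavelet pair, i.e. there is a constant $C^M_{\psi,\varphi}\in\mathbb C$ such that, for almost all $\lambda\in\mathbb R$, $$\int_0^\infty D^M_k\psi(\lambda\alpha)\,\overline{D^M_k\varphi(\lambda\alpha)}\,\frac{d\alpha}\alpha=C^M_{\psi,\varphi}$$ with absolute convergence. Suppose that $C^M_{\psi,\varphi}\neq0$ and that $D^M_k\psi,\ D^M_k\varphi\in L^\infty_k$, and let $f\in L^2_k$. Then for all $0<\epsilon<\delta<\infty$ the integral $$f^{\epsilon,\delta}(y)=\frac1{(-ib)^{k+1}\,\overline{C^M_{\psi,\varphi}}}\int_\epsilon^\delta\int_{\mathbb R}\Phi^M_\psi f(\alpha,\beta)\,\varphi^M_{\alpha,\beta}(y)\,d\nu_k(\alpha,\beta)$$ converges absolutely for every $y\in\mathbb R$, the function $f^{\epsilon,\delta}$ belongs to $L^2_k$, and $$\lim_{\epsilon\to0^+,\ \delta\to\infty}\|f^{\epsilon,\delta}-f\|_{L^2_k}=0.$$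 -/

import Mathlib

noncomputable section

namespace LCDunkl

open MeasureTheory Set Filter Topology ComplexConjugate

/-- The measure `dμ_k(x) = |x|^(2k+1) dx / (2^(k+1) Γ(k+1))` on the real line. -/
def muK (k : ℝ) : Measure ℝ :=
  volume.withDensity fun x =>
    ENNReal.ofReal (|x| ^ (2 * k + 1) / ((2 : ℝ) ^ (k + 1) * Real.Gamma (k + 1)))

/-- The measure `dν_k(α, β) = dμ_k(β) dα / α^(2k+3)` on the half plane `α > 0`
(as a measure on `ℝ × ℝ` that gives no mass to `α ≤ 0`). -/
def nuK (k : ℝ) : Measure (ℝ × ℝ) :=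
  ((volume.restrict (Ioi (0 : ℝ))).withDensity fun α =>
    ENNReal.ofReal (1 / α ^ (2 * k + 3))).prod (muK k)

/-- The normalized Bessel function
`j_k(z) = Γ(k+1) ∑ₙ (-1)ⁿ (z/2)^(2n) / (n! Γ(n+k+1))`. -/
def besselJ (k : ℝ) (z : ℂ) : ℂ :=
  (Real.Gamma (k + 1) : ℂ) *
    ∑' n : ℕ, (-1) ^ n * (z / 2) ^ (2 * n) /
      ((n.factorial : ℂ) * (Real.Gamma (n + k + 1) : ℂ))

/-- The one-dimensional Dunkl kernel
`E_k(z, x) = j_k(i z x) + (z x / (2(k+1))) j_{k+1}(i z x)`. -/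
def dunklKernel (k : ℝ) (z x : ℂ) : ℂ :=
  besselJ k (Complex.I * (z * x)) +
    z * x / (2 * ((k : ℂ) + 1)) * besselJ (k + 1) (Complex.I * (z * x))

/-- The power `(i b)^(k+1)`, principal branch. -/
def ibPow (k b : ℝ) : ℂ := (Complex.I * (b : ℂ)) ^ ((k : ℂ) + 1)

/-- The chirp `e^{i s x² / 2}`. -/
def chirp (s x : ℝ) : ℂ := Complex.exp (Complex.I / 2 * ((s * x ^ 2 : ℝ) : ℂ))

/-- The kernel `E_k^M(l, x) = e^{(i/2)((d/b) l² + (a/b) x²)} E_k(-i l / b, x)` for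
`M = (a, b; c, d)`. -/
def lcKernel (k : ℝ) (M : Matrix.SpecialLinearGroup (Fin 2) ℝ) (l x : ℝ) : ℂ :=
  chirp (M 1 1 / M 0 1) l * chirp (M 0 0 / M 0 1) x *
    dunklKernel k (-Complex.I * (l : ℂ) / ((M 0 1 : ℝ) : ℂ)) (x : ℂ)

/-- The linear canonical Dunkl transform given by its integral, for `f` in `L¹_k`. -/
def lcdtIntegral (k : ℝ) (M : Matrix.SpecialLinearGroup (Fin 2) ℝ) (f : ℝ → ℂ) (l : ℝ) : ℂ :=
  1 / ibPow k (M 0 1) * ∫ x, f x * lcKernel k M l x ∂muK k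

/-- `g` is (a representative of) the linear canonical Dunkl transform of `f` in `L²_k`: it is
the limit in `L²_k` of the transforms of the truncations of `f` to `[-n, n]`. -/
def IsLCDT (k : ℝ) (M : Matrix.SpecialLinearGroup (Fin 2) ℝ) (f g : ℝ → ℂ) : Prop :=
  MemLp g 2 (muK k) ∧
    Tendsto (fun n : ℕ =>
      eLpNorm (fun l => lcdtIntegral k M ((Icc (-(n : ℝ)) (n : ℝ)).indicator f) l - g l)
        2 (muK k)) atTop (𝓝 0)

open Classical in
/-- The linear canonical Dunkl transform `D_k^M f` on `L²_k`. -/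
def lcdt (k : ℝ) (M : Matrix.SpecialLinearGroup (Fin 2) ℝ) (f : ℝ → ℂ) : ℝ → ℂ :=
  if h : ∃ g : ℝ → ℂ, IsLCDT k M f g then Classical.choose h else 0

/-- The quotient `(x² + y² - z²) / (2 x y)`, equal to `0` if `x y = 0`. -/
def sigmaQ (x y z : ℝ) : ℝ := (x ^ 2 + y ^ 2 - z ^ 2) / (2 * x * y)

/-- The kernel `W_k(x, y, z)` of the product formula
`E_k(λ, x) E_k(λ, y) = ∫ E_k(λ, z) W_k(x, y, z) dμ_k(z)`, for `k > -1/2` and `x, y ≠ 0`. -/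
def dunklW (k x y z : ℝ) : ℝ :=
  if |(|x| - |y|)| ≤ |z| ∧ |z| ≤ |x| + |y| then
    Real.Gamma (k + 1) ^ 2 / ((2 : ℝ) ^ (k - 1) * √Real.pi * Real.Gamma (k + 1 / 2)) *
      (1 - sigmaQ x y z + sigmaQ z x y + sigmaQ z y x) *
      ((((|x| + |y|) ^ 2 - z ^ 2) * (z ^ 2 - (|x| - |y|) ^ 2)) ^ (k - 1 / 2) /
        |x * y * z| ^ (2 * k))
  else 0

open Classical in
/-- The Dunkl translation `(T_x f)(y)`. It is the integral of `f` against `W_k(x, y, ·) dμ_k`,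
which degenerates to a point mass at `x + y` if `k = -1/2` (the classical Fourier case) or if
`x = 0` or `y = 0`. -/
def dunklTranslation (k x : ℝ) (f : ℝ → ℂ) (y : ℝ) : ℂ :=
  if k = -1 / 2 ∨ x = 0 ∨ y = 0 then f (x + y)
  else ∫ z, f z * (dunklW k x y z : ℂ) ∂muK k

/-- The generalized translation
`(T_x^M f)(y) = e^{-(i/2)(a/b)(x²+y²)} T_x(e^{(i/2)(a/b)(·)²} f)(y)`. -/
def lcTranslation (k : ℝ) (M : Matrix.SpecialLinearGroup (Fin 2) ℝ) (x : ℝ) (f : ℝ → ℂ)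
    (y : ℝ) : ℂ :=
  chirp (-(M 0 0 / M 0 1)) x * chirp (-(M 0 0 / M 0 1)) y *
    dunklTranslation k x (fun z => chirp (M 0 0 / M 0 1) z * f z) y

/-- The chirped dilation
`ψ_α^M(x) = α^{-(2k+2)} e^{-(i/2)(a/b)(1 - 1/α²) x²} ψ(x/α)`. -/
def lcDilation (k : ℝ) (M : Matrix.SpecialLinearGroup (Fin 2) ℝ) (α : ℝ) (ψ : ℝ → ℂ)
    (x : ℝ) : ℂ :=
  ((1 / α ^ (2 * k + 2) : ℝ) : ℂ) * chirp (-(M 0 0 / M 0 1 * (1 - 1 / α ^ 2))) x * ψ (x / α)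

/-- The wavelet family `ψ_{α,β}^M = α^{k+1} T_β^M(ψ_α^M)`. -/
def lcWavelet (k : ℝ) (M : Matrix.SpecialLinearGroup (Fin 2) ℝ) (ψ : ℝ → ℂ) (α β x : ℝ) : ℂ :=
  ((α ^ (k + 1) : ℝ) : ℂ) * lcTranslation k M β (lcDilation k M α ψ) x

/-- The linear canonical Dunkl continuous wavelet transform
`Φ_ψ^M f(α, β) = (ib)^{-(k+1)} ∫ f(y) conj(ψ_{α,β}^M(y)) dμ_k(y)`. -/
def lcWaveletTransform (k : ℝ) (M : Matrix.SpecialLinearGroup (Fin 2) ℝ) (ψ f : ℝ → ℂ)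
    (α β : ℝ) : ℂ :=
  1 / ibPow k (M 0 1) * ∫ y, f y * conj (lcWavelet k M ψ α β y) ∂muK k

/-- `(ψ, φ)` is a linear canonical two-wavelet pair with constant `C = C_{ψ,φ}^M`: both are in
`L²_k` and, for almost all `l`, the integral
`∫_0^∞ D_k^M ψ(l α) conj(D_k^M φ(l α)) dα/α` converges absolutely and equals `C`. -/
def IsTwoWavelet (k : ℝ) (M : Matrix.SpecialLinearGroup (Fin 2) ℝ) (ψ φ : ℝ → ℂ) (C : ℂ) :
    Prop :=
  MemLp ψ 2 (muK k) ∧ MemLp φ 2 (muK k) ∧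
    ∀ᵐ l : ℝ,
      IntegrableOn (fun α : ℝ => lcdt k M ψ (l * α) * conj (lcdt k M φ (l * α)) / (α : ℂ))
        (Ioi 0) ∧
      ∫ α in Ioi (0 : ℝ), lcdt k M ψ (l * α) * conj (lcdt k M φ (l * α)) / (α : ℂ) = C

/-- The integrand `Φ_ψ^M f(α, β) φ_{α,β}^M(y)` of the reconstruction formula. -/
def calderonIntegrand (k : ℝ) (M : Matrix.SpecialLinearGroup (Fin 2) ℝ) (ψ φ f : ℝ → ℂ)
    (y : ℝ) (p : ℝ × ℝ) : ℂ :=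
  lcWaveletTransform k M ψ f p.1 p.2 * lcWavelet k M φ p.1 p.2 y

/-- The truncated reconstruction `f^{ε,δ}(y)`, the integral over `ε < α < δ`, `β ∈ ℝ`,
normalized by `(-ib)^{k+1} conj(C)`; here `(-ib)^{k+1}` is `ibPow k (-b)`. -/
def calderonTruncation (k : ℝ) (M : Matrix.SpecialLinearGroup (Fin 2) ℝ) (ψ φ : ℝ → ℂ) (C : ℂ)
    (f : ℝ → ℂ) (ε δ : ℝ) (y : ℝ) : ℂ :=
  1 / (ibPow k (-(M 0 1)) * conj C) *
    ∫ p in Ioo ε δ ×ˢ (univ : Set ℝ), calderonIntegrand k M ψ φ f y p ∂nuK k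

end LCDunkl

end

noncomputable section

namespace LCDunkl

open MeasureTheory Set Filter Topology ComplexConjugate

/-! ### The Dunkl kernel as an entire function of one variable -/

/-! Put s = a/b, let U be the unitary Dunkl transform on L²_k, and let g, P, Q be the images under U
of f, ψ, φ multiplied by the chirp exp(isx²/2). Chirps are unimodular and drop out of every norm.
The canonical transform of ψ at λ is P(λ/b) up to a chirp and the constant (ib)^(-(k+1))
(`lcdt_ae_eq`), and the canonical wavelets are, up to chirps in β and y, ordinary Dunkl translates
of dilates of the chirped wavelet (`lcWavelet_eq`).

U turns dilation by α into l ↦ αl (`dunklU_dilation`) and translation by β into multiplication by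
E_k(iβ, l) (`dunklTranslation_ae_eq`). Hence the wavelet transform at scale α is, up to explicit
factors, the Dunkl transform in β of g · conj P(α·). A bilinear Plancherel formula evaluates the
integral over β as an inverse Dunkl transform of g · conj P(α·) · Q(α·) (`slice_translation`). The
powers of α combine to dα/α, and Fubini shows that the truncation, freed of its chirp, is the
inverse transform of cKg, where K(l) is the integral of conj P(αl) · Q(αl) dα/α over (ε, δ)
(`integrableOn_calderonIntegrand`). Absolute convergence is Cauchy–Schwarz in β, uniformly in α > ε;
boundedness of P keeps g · conj P(α·) in L².

By Plancherel the error is the norm of (cK - 1)g (`calderonTruncation_sub`). The two-wavelet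
condition says that K tends to 1/c almost everywhere. Since dα/α is dilation invariant, the integral
of |P(αl) Q(αl)| dα/α over (0, ∞) depends only on the sign of l, so K is bounded uniformly in ε and
δ. Dominated convergence concludes.

The Dunkl theory itself rests on the Gaussians exp(-tx²) and x exp(-tx²). The transform permutes
them up to scalars and preserves their inner products, and they are total, so U extends from their
span to a unitary operator. The properties of U are then checked by pairing with Gaussians
(`ae_eq_of_integral_gaussGen`). For translations, W_k is a bounded signed factor times a symmetric
probability density. The substitution z² = x² + y² + 2xys carries this density to the Gegenbauer
weight, and the Poisson integral for E_k yields the translates of Gaussians in closed form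
(`integral_gaussGen_mul_dunklW`). -/

/-- The quotient `Γ(k+1) / Γ(n+k+1)`. -/
def gammaRatio (k : ℝ) (n : ℕ) : ℝ := Real.Gamma (k + 1) / Real.Gamma (n + k + 1)

lemma gammaRatio_zero {k : ℝ} (hk : -1 / 2 ≤ k) : gammaRatio k 0 = 1 := by
  have : Real.Gamma (k + 1) ≠ 0 := (Real.Gamma_pos_of_pos (by linarith)).ne'
  simp [gammaRatio, this]

lemma gammaRatio_succ {k : ℝ} (hk : -1 / 2 ≤ k) (n : ℕ) :
    gammaRatio k (n + 1) = gammaRatio k n / (n + k + 1) := by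
  have hn : (0 : ℝ) ≤ n := n.cast_nonneg
  have h : Real.Gamma ((n + 1 : ℕ) + k + 1) = (n + k + 1) * Real.Gamma (n + k + 1) := by
    rw [← Real.Gamma_add_one (by linarith)]; push_cast; ring_nf
  rw [gammaRatio, gammaRatio, h, div_div, mul_comm]

lemma gammaRatio_pos {k : ℝ} (hk : -1 / 2 ≤ k) (n : ℕ) : 0 < gammaRatio k n := by
  have hn : (0 : ℝ) ≤ n := n.cast_nonneg
  exact div_pos (Real.Gamma_pos_of_pos (by linarith)) (Real.Gamma_pos_of_pos (by linarith))

/-- Only the first divisor k + 1 of the recursion can be below 1, and it is at least 1/2; every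
later divisor exceeds 1. -/
lemma gammaRatio_le_two {k : ℝ} (hk : -1 / 2 ≤ k) (n : ℕ) : gammaRatio k n ≤ 2 := by
  have h1 : ∀ n : ℕ, gammaRatio k (n + 1) ≤ 2 := by
    intro n
    induction n with
    | zero =>
      rw [gammaRatio_succ hk, gammaRatio_zero hk, div_le_iff₀ (by push_cast; linarith)]
      push_cast; linarith
    | succ n ih =>
      have hn : (0 : ℝ) ≤ n := n.cast_nonneg
      rw [gammaRatio_succ hk, div_le_iff₀ (by push_cast; linarith)]
      push_cast
      nlinarith
  cases n with
  | zero => rw [gammaRatio_zero hk]; norm_num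
  | succ n => exact h1 n

/-- The coefficients of `besselJ k (i w)` as a power series in `w ^ 2`. -/
def besselCoeff (k : ℝ) (n : ℕ) : ℝ := gammaRatio k n / (4 ^ n * n.factorial)

lemma besselCoeff_pos {k : ℝ} (hk : -1 / 2 ≤ k) (n : ℕ) : 0 < besselCoeff k n :=
  div_pos (gammaRatio_pos hk n) (by positivity)

lemma norm_besselCoeff_term_le {k : ℝ} (hk : -1 / 2 ≤ k) (w : ℂ) (n : ℕ) :
    ‖(besselCoeff k n : ℂ) * w ^ (2 * n)‖ ≤ 2 * ((‖w‖ ^ 2 / 4) ^ n / n.factorial) := by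
  rw [norm_mul, Complex.norm_real, Real.norm_of_nonneg (besselCoeff_pos hk n).le, norm_pow,
    besselCoeff, pow_mul, div_pow]
  have := gammaRatio_le_two hk n
  calc gammaRatio k n / (4 ^ n * n.factorial) * (‖w‖ ^ 2) ^ n
      = gammaRatio k n * ((‖w‖ ^ 2) ^ n / (4 ^ n * n.factorial)) := by ring
    _ ≤ 2 * ((‖w‖ ^ 2) ^ n / (4 ^ n * n.factorial)) := by gcongr
    _ = _ := by rw [div_div]

/-- The signs (-1)^n cancel against i^(2n), leaving positive coefficients. Positivity later makes
the integrals of the norms of the terms explicit. -/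
lemma hasSum_besselJ {k : ℝ} (hk : -1 / 2 ≤ k) (w : ℂ) :
    HasSum (fun n : ℕ => (besselCoeff k n : ℂ) * w ^ (2 * n)) (besselJ k (Complex.I * w)) := by
  have hs : Summable (fun n : ℕ => (besselCoeff k n : ℂ) * w ^ (2 * n)) :=
    .of_norm_bounded ((Real.summable_pow_div_factorial _).mul_left 2)
      (norm_besselCoeff_term_le hk w)
  have he : besselJ k (Complex.I * w) = ∑' n : ℕ, (besselCoeff k n : ℂ) * w ^ (2 * n) := by
    rw [besselJ, ← tsum_mul_left]
    congr 1; ext n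
    have h1 : (Complex.I * w / 2) ^ (2 * n) = (-1) ^ n * w ^ (2 * n) / 4 ^ n := by
      rw [pow_mul, pow_mul, div_pow, mul_pow, Complex.I_sq, ← mul_pow, ← div_pow]; norm_num
    have h2 : ((-1 : ℂ) ^ n) * (-1) ^ n = 1 := by rw [← mul_pow]; simp
    rw [h1, besselCoeff, gammaRatio]
    push_cast
    calc _ = ((-1 : ℂ) ^ n * (-1) ^ n) * ((Real.Gamma (k + 1) : ℂ) /
          (Real.Gamma (n + k + 1) : ℂ) / (4 ^ n * n.factorial) * w ^ (2 * n)) := by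
          simp only [div_eq_mul_inv, mul_inv]; ring
      _ = _ := by rw [h2, one_mul]
  rw [he]; exact hs.hasSum

lemma measurable_besselJ {k : ℝ} (hk : -1 / 2 ≤ k) :
    Measurable fun w : ℂ => besselJ k (Complex.I * w) := by
  refine measurable_of_tendsto_metrizable
    (f := fun N w => ∑ n ∈ Finset.range N, (besselCoeff k n : ℂ) * w ^ (2 * n)) ?_ ?_
  · intro N; fun_prop
  · exact tendsto_pi_nhds.2 fun w => (hasSum_besselJ hk w).tendsto_sum_nat

/-- The Dunkl kernel `E_k(w, 1)`. -/
def dunklExp (k : ℝ) (w : ℂ) : ℂ :=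
  besselJ k (Complex.I * w) + w / (2 * ((k : ℂ) + 1)) * besselJ (k + 1) (Complex.I * w)

lemma dunklKernel_eq (k : ℝ) (z x : ℂ) : dunklKernel k z x = dunklExp k (z * x) := rfl

lemma measurable_dunklExp {k : ℝ} (hk : -1 / 2 ≤ k) : Measurable (dunklExp k) := by
  have h1 := measurable_besselJ hk
  have h2 := measurable_besselJ (k := k + 1) (by linarith)
  unfold dunklExp
  fun_prop

lemma besselJ_neg {k : ℝ} (hk : -1 / 2 ≤ k) (w : ℂ) :
    besselJ k (Complex.I * -w) = besselJ k (Complex.I * w) := by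
  refine (hasSum_besselJ hk (-w)).unique ?_
  simpa [pow_mul] using hasSum_besselJ hk w

lemma conj_besselJ {k : ℝ} (hk : -1 / 2 ≤ k) (w : ℂ) :
    conj (besselJ k (Complex.I * w)) = besselJ k (Complex.I * conj w) := by
  have h := (hasSum_besselJ hk w).map (starRingEnd ℂ) Complex.continuous_conj
  refine h.unique ?_
  simpa [Function.comp_def] using hasSum_besselJ hk (conj w)

lemma conj_dunklExp {k : ℝ} (hk : -1 / 2 ≤ k) (w : ℂ) :
    conj (dunklExp k w) = dunklExp k (conj w) := by
  simp only [dunklExp, map_add, map_mul, map_div₀, conj_besselJ hk,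
    conj_besselJ (show -1 / 2 ≤ k + 1 by linarith), Complex.conj_ofReal, map_one, map_ofNat]

lemma besselJ_zero {k : ℝ} (hk : -1 / 2 ≤ k) : besselJ k 0 = 1 := by
  have h := hasSum_besselJ hk 0
  rw [mul_zero] at h
  refine h.unique ?_
  convert hasSum_single (f := fun n : ℕ => (besselCoeff k n : ℂ) * 0 ^ (2 * n)) 0 ?_ using 1
  · simp [besselCoeff, gammaRatio_zero hk]
  · intro n hn; simp [hn]

lemma dunklExp_zero {k : ℝ} (hk : -1 / 2 ≤ k) : dunklExp k 0 = 1 := by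
  simp [dunklExp, besselJ_zero hk]

/-! ### The Poisson integral representation -/

/-- Duplication formula at integers: it matches the moments of the Gegenbauer weight with the Bessel
coefficients. -/
lemma factorial_two_mul (n : ℕ) :
    ((2 * n).factorial : ℝ) * √Real.pi = 4 ^ n * n.factorial * Real.Gamma (n + 1 / 2) := by
  induction n with
  | zero => simp only [mul_zero, Nat.factorial_zero, Nat.cast_one, one_mul, pow_zero,
      Nat.cast_zero, zero_add]; rw [Real.Gamma_one_half_eq]
  | succ n ih =>
    have hn : (0 : ℝ) ≤ n := n.cast_nonneg
    have h : Real.Gamma ((n + 1 : ℕ) + 1 / 2) = (n + 1 / 2) * Real.Gamma (n + 1 / 2) := by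
      rw [← Real.Gamma_add_one (by positivity)]; push_cast; ring_nf
    rw [h, show 2 * (n + 1) = 2 * n + 1 + 1 by ring, Nat.factorial_succ, Nat.factorial_succ,
      Nat.factorial_succ]
    push_cast
    linear_combination (2 * (n : ℝ) + 1 + 1) * (2 * n + 1) * ih

lemma integral_betaPDFReal {α β : ℝ} (hα : 0 < α) (hβ : 0 < β) :
    ∫ x, ProbabilityTheory.betaPDFReal α β x = 1 := by
  rw [integral_eq_lintegral_of_nonneg_ae]
  · have := ProbabilityTheory.lintegral_betaPDF_eq_one hα hβ
    unfold ProbabilityTheory.betaPDF at this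
    rw [this]; simp
  · refine ae_of_all _ fun x => ?_
    simp only [ProbabilityTheory.betaPDFReal, Pi.zero_apply]
    split_ifs with h
    · have := ProbabilityTheory.beta_pos hα hβ
      have h1 := h.1
      have h2 : 0 < 1 - x := by linarith [h.2]
      positivity
    · exact le_rfl
  · exact (ProbabilityTheory.measurable_betaPDFReal α β).aestronglyMeasurable

lemma integral_abs_mul_betaPDFReal_sq {α β : ℝ} (hα : 0 < α) (hβ : 0 < β) :
    ∫ s : ℝ, |s| * ProbabilityTheory.betaPDFReal α β (s ^ 2) = 1 := by
  have h := integral_comp_abs (f := fun s => s * ProbabilityTheory.betaPDFReal α β (s ^ 2))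
  simp only [sq_abs] at h
  rw [h]
  have h2 := integral_comp_rpow_Ioi_of_pos (g := ProbabilityTheory.betaPDFReal α β)
    (p := 2) (by norm_num)
  rw [← integral_const_mul]
  have h3 : ∫ x in Ioi (0 : ℝ), ProbabilityTheory.betaPDFReal α β x = 1 := by
    rw [← integral_betaPDFReal hα hβ]
    refine setIntegral_eq_integral_of_forall_compl_eq_zero fun x hx => ?_
    rw [ProbabilityTheory.betaPDFReal, if_neg]
    exact fun h => hx h.1
  rw [← h3, ← h2]
  refine setIntegral_congr_fun measurableSet_Ioi fun x hx => ?_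
  norm_num
  ring

/-- The density of the Gegenbauer probability measure `c (1 - s²)^(k - 1/2) ds` on `(-1, 1)`. -/
def gegenbauerDensity (k s : ℝ) : ℝ :=
  if s ^ 2 < 1 then Real.Gamma (k + 1) / (√Real.pi * Real.Gamma (k + 1 / 2)) *
    (1 - s ^ 2) ^ (k - 1 / 2) else 0

lemma gegenbauerDensity_neg (k s : ℝ) : gegenbauerDensity k (-s) = gegenbauerDensity k s := by
  simp [gegenbauerDensity]

lemma gegenbauerDensity_nonneg {k : ℝ} (hk : -1 / 2 < k) (s : ℝ) : 0 ≤ gegenbauerDensity k s := by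
  unfold gegenbauerDensity
  split_ifs with h
  · have h1 : 0 < Real.Gamma (k + 1) := Real.Gamma_pos_of_pos (by linarith)
    have h2 : 0 < Real.Gamma (k + 1 / 2) := Real.Gamma_pos_of_pos (by linarith)
    have h3 : 0 < 1 - s ^ 2 := by linarith
    positivity
  · exact le_rfl

lemma gegenbauerDensity_eq_zero {k s : ℝ} (hs : 1 ≤ s ^ 2) : gegenbauerDensity k s = 0 :=
  if_neg hs.not_gt

lemma measurable_gegenbauerDensity (k : ℝ) : Measurable (gegenbauerDensity k) := by
  unfold gegenbauerDensity
  refine Measurable.ite (measurableSet_lt (by fun_prop) (by fun_prop)) (by fun_prop) (by fun_prop)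

/-- The even moments of the Gegenbauer weight are beta integrals in the variable s². The point s = 0
is excluded because the exponent of s² on the right is negative when n = 0. -/
lemma pow_mul_gegenbauerDensity {k : ℝ} (hk : -1 / 2 < k) (n : ℕ) {s : ℝ} (hs : s ≠ 0) :
    s ^ (2 * n) * gegenbauerDensity k s =
      gammaRatio k n * Real.Gamma (n + 1 / 2) / √Real.pi *
        (|s| * ProbabilityTheory.betaPDFReal (n + 1 / 2) (k + 1 / 2) (s ^ 2)) := by
  have hs2 : 0 < s ^ 2 := by positivity
  rw [gegenbauerDensity, ProbabilityTheory.betaPDFReal, ProbabilityTheory.beta, gammaRatio]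
  by_cases h : s ^ 2 < 1
  · rw [if_pos h, if_pos ⟨hs2, h⟩]
    have h1 : 0 < Real.Gamma (k + 1) := Real.Gamma_pos_of_pos (by linarith)
    have h2 : 0 < Real.Gamma (k + 1 / 2) := Real.Gamma_pos_of_pos (by linarith)
    have h3 : 0 < Real.Gamma (n + 1 / 2) := Real.Gamma_pos_of_pos (by positivity)
    have hn : (0 : ℝ) ≤ n := n.cast_nonneg
    have h4 : 0 < Real.Gamma (n + k + 1) := Real.Gamma_pos_of_pos (by linarith)
    have h5 : s ^ (2 * n) = |s| * (s ^ 2) ^ ((n : ℝ) + 1 / 2 - 1) := by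
      rw [pow_mul, ← Real.rpow_natCast, show (n : ℝ) + 1 / 2 - 1 = n - 1 / 2 by ring,
        Real.rpow_sub hs2, ← Real.sqrt_eq_rpow, Real.sqrt_sq_eq_abs]
      field_simp
    have h6 : (n : ℝ) + 1 / 2 + (k + 1 / 2) = n + k + 1 := by ring
    have h7 : k + 1 / 2 - 1 = k - 1 / 2 := by ring
    rw [h5, h6, h7]
    field_simp
  · rw [if_neg h, if_neg (fun h' => h h'.2)]; simp

lemma integral_pow_mul_gegenbauerDensity {k : ℝ} (hk : -1 / 2 < k) (n : ℕ) :
    ∫ s, s ^ (2 * n) * gegenbauerDensity k s =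
      gammaRatio k n * Real.Gamma (n + 1 / 2) / √Real.pi := by
  have h : (fun s => s ^ (2 * n) * gegenbauerDensity k s) =ᵐ[volume] fun s =>
      gammaRatio k n * Real.Gamma (n + 1 / 2) / √Real.pi *
        (|s| * ProbabilityTheory.betaPDFReal (n + 1 / 2) (k + 1 / 2) (s ^ 2)) := by
    filter_upwards [compl_mem_ae_iff.2 (measure_singleton (0 : ℝ))] with s hs
    exact pow_mul_gegenbauerDensity hk n hs
  rw [integral_congr_ae h, integral_const_mul,
    integral_abs_mul_betaPDFReal_sq (by positivity) (by linarith), mul_one]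

lemma integral_gegenbauerDensity {k : ℝ} (hk : -1 / 2 < k) : ∫ s, gegenbauerDensity k s = 1 := by
  have h := integral_pow_mul_gegenbauerDensity hk 0
  simp only [mul_zero, pow_zero, one_mul, Nat.cast_zero, zero_add] at h
  rw [h, gammaRatio_zero hk.le, Real.Gamma_one_half_eq]
  field_simp

lemma integrable_gegenbauerDensity {k : ℝ} (hk : -1 / 2 < k) :
    Integrable (gegenbauerDensity k) := by
  -- The Bochner integral of a non-integrable function is 0 by convention, so the value 1 forces
  -- integrability. The same device recurs for the Gaussian moments and for the translation kernel.
  by_contra h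
  have := integral_gegenbauerDensity hk
  rw [integral_undef h] at this
  norm_num at this

lemma integrable_mul_gegenbauerDensity {k : ℝ} (hk : -1 / 2 < k) {g : ℝ → ℂ} (hg : Measurable g)
    {B : ℝ} (hB : ∀ s, |s| ≤ 1 → ‖g s‖ ≤ B) :
    Integrable fun s => g s * (gegenbauerDensity k s : ℂ) := by
  have hm := measurable_gegenbauerDensity k
  refine Integrable.mono' ((integrable_gegenbauerDensity hk).const_mul B) (by fun_prop) ?_
  refine ae_of_all _ fun s => ?_
  rw [norm_mul, Complex.norm_real, Real.norm_of_nonneg (gegenbauerDensity_nonneg hk s)]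
  by_cases hs : s ^ 2 < 1
  · exact mul_le_mul_of_nonneg_right (hB s ((sq_lt_one_iff_abs_lt_one s).1 hs).le)
      (gegenbauerDensity_nonneg hk s)
  · rw [gegenbauerDensity_eq_zero (not_lt.1 hs)]; simp

lemma integral_eq_zero_of_odd {f : ℝ → ℂ}
    (hf : ∀ x, f (-x) = -f x) : ∫ x, f x = 0 := by
  have h := integral_neg_eq_self f volume
  simp only [hf, integral_neg] at h
  exact self_eq_neg.1 h.symm

/-- Since |s| ≤ 1 on the support of a probability weight, the sum of ‖a n‖ dominates and the series
may be integrated term by term. The shift p is 0 for cosh(ws) and 1 for s sinh(ws). -/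
lemma integral_hasSum_gegenbauer {k : ℝ} (hk : -1 / 2 < k) (p : ℕ) (a : ℕ → ℂ) (g : ℝ → ℂ)
    (hs : Summable fun n => ‖a n‖) (hg : ∀ s : ℝ, HasSum (fun n => a n * (s : ℂ) ^ (2 * (n + p))) (g s)) :
    HasSum (fun n => a n * (gammaRatio k (n + p) * Real.Gamma ((n + p : ℕ) + 1 / 2) / √Real.pi : ℝ))
      (∫ s, g s * (gegenbauerDensity k s : ℂ)) := by
  have hm := measurable_gegenbauerDensity k
  have hint : ∀ n, Integrable fun s : ℝ =>
      a n * (s : ℂ) ^ (2 * (n + p)) * (gegenbauerDensity k s : ℂ) := by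
    intro n
    refine integrable_mul_gegenbauerDensity hk (by fun_prop) (B := ‖a n‖) fun s hs => ?_
    rw [norm_mul, norm_pow, Complex.norm_real]
    exact mul_le_of_le_one_right (norm_nonneg _) (pow_le_one₀ (norm_nonneg _) hs)
  have hnorm : ∀ n, ∫ s : ℝ, ‖a n * (s : ℂ) ^ (2 * (n + p)) * (gegenbauerDensity k s : ℂ)‖
      ≤ ‖a n‖ := by
    intro n
    rw [← mul_one ‖a n‖, ← integral_gegenbauerDensity hk, ← integral_const_mul]
    refine integral_mono (hint n).norm ((integrable_gegenbauerDensity hk).const_mul _) fun s => ?_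
    rw [norm_mul, Complex.norm_real, Real.norm_of_nonneg (gegenbauerDensity_nonneg hk s)]
    by_cases hs : s ^ 2 < 1
    · refine mul_le_mul_of_nonneg_right ?_ (gegenbauerDensity_nonneg hk s)
      rw [norm_mul, norm_pow, Complex.norm_real]
      exact mul_le_of_le_one_right (norm_nonneg _)
        (pow_le_one₀ (norm_nonneg _) ((sq_lt_one_iff_abs_lt_one s).1 hs).le)
    · rw [gegenbauerDensity_eq_zero (not_lt.1 hs)]; simp
  have h := hasSum_integral_of_summable_integral_norm hint
    (Summable.of_nonneg_of_le (fun n => by positivity) hnorm hs)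
  have e1 : ∀ n, ∫ s : ℝ, a n * (s : ℂ) ^ (2 * (n + p)) * (gegenbauerDensity k s : ℂ) =
      a n * (gammaRatio k (n + p) * Real.Gamma ((n + p : ℕ) + 1 / 2) / √Real.pi : ℝ) := by
    intro n
    rw [← integral_pow_mul_gegenbauerDensity hk, ← integral_complex_ofReal, ← integral_const_mul]
    congr 1; ext s; push_cast; ring
  have e2 : ∫ s : ℝ, ∑' n, a n * (s : ℂ) ^ (2 * (n + p)) * (gegenbauerDensity k s : ℂ) =
      ∫ s, g s * (gegenbauerDensity k s : ℂ) := by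
    congr 1; ext s
    exact ((hg s).mul_right _).tsum_eq
  simp only [e1, e2] at h
  exact h

lemma hasSum_of_terms_eq {f g : ℕ → ℂ} {a : ℂ} (h : HasSum f a) (e : ∀ n, g n = f n) :
    HasSum g a := by
  rwa [funext e]

lemma gammaRatio_add_one {k : ℝ} (hk : -1 / 2 ≤ k) (n : ℕ) :
    gammaRatio (k + 1) n = (k + 1) * gammaRatio k (n + 1) := by
  rw [gammaRatio, gammaRatio, Real.Gamma_add_one (by linarith)]
  push_cast
  rw [show (n : ℝ) + (k + 1) + 1 = n + 1 + k + 1 by ring, mul_div_assoc]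

/-- Split exp(ws)(1 + s) into cosh + s sinh, even in s, and sinh + s cosh, odd in s. The odd part
integrates to zero. Comparing power series, cosh produces j_k and s sinh produces the j_{k+1} term.
-/
lemma dunklExp_eq_integral {k : ℝ} (hk : -1 / 2 < k) (w : ℂ) :
    dunklExp k w =
      ∫ s : ℝ, Complex.exp (w * s) * (1 + s) * (gegenbauerDensity k s : ℂ) := by
  have hpi : √Real.pi ≠ 0 := by positivity
  have hsplit : ∀ s : ℝ, Complex.exp (w * s) * (1 + s) * (gegenbauerDensity k s : ℂ) =
      Complex.cosh (w * s) * (gegenbauerDensity k s : ℂ) +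
      s * Complex.sinh (w * s) * (gegenbauerDensity k s : ℂ) +
      (Complex.sinh (w * s) + s * Complex.cosh (w * s)) * (gegenbauerDensity k s : ℂ) := by
    intro s; rw [← Complex.cosh_add_sinh]; ring
  have hexp : ∀ z : ℂ, ∀ s : ℝ, |s| ≤ 1 → ‖Complex.exp (z * s)‖ ≤ Real.exp ‖z‖ := by
    intro z s hs
    refine (Complex.norm_exp_le_exp_norm _).trans (Real.exp_le_exp.2 ?_)
    rw [norm_mul, Complex.norm_real]
    exact mul_le_of_le_one_right (norm_nonneg _) hs
  have hcosh : ∀ s : ℝ, |s| ≤ 1 → ‖Complex.cosh (w * s)‖ ≤ Real.exp ‖w‖ := by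
    intro s hs
    rw [Complex.cosh, norm_div, ← neg_mul, Complex.norm_ofNat, div_le_iff₀ (by norm_num)]
    have h1 := hexp w s hs
    have h2 := hexp (-w) s hs
    rw [norm_neg] at h2
    linarith [norm_add_le (Complex.exp (w * s)) (Complex.exp (-w * s))]
  have hsinh : ∀ s : ℝ, |s| ≤ 1 → ‖Complex.sinh (w * s)‖ ≤ Real.exp ‖w‖ := by
    intro s hs
    rw [Complex.sinh, norm_div, ← neg_mul, Complex.norm_ofNat, div_le_iff₀ (by norm_num)]
    have h1 := hexp w s hs
    have h2 := hexp (-w) s hs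
    rw [norm_neg] at h2
    linarith [norm_sub_le (Complex.exp (w * s)) (Complex.exp (-w * s))]
  have hmul : ∀ (s : ℝ) (z : ℂ), |s| ≤ 1 → ‖z‖ ≤ Real.exp ‖w‖ → ‖(s : ℂ) * z‖ ≤ Real.exp ‖w‖ := by
    intro s z hs hz
    rw [norm_mul, Complex.norm_real]
    exact (mul_le_of_le_one_left (norm_nonneg _) hs).trans hz
  have i1 : Integrable fun s : ℝ => Complex.cosh (w * s) * (gegenbauerDensity k s : ℂ) :=
    integrable_mul_gegenbauerDensity hk (by fun_prop) hcosh
  have i2 : Integrable fun s : ℝ => s * Complex.sinh (w * s) * (gegenbauerDensity k s : ℂ) :=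
    integrable_mul_gegenbauerDensity hk (by fun_prop) fun s hs => hmul s _ hs (hsinh s hs)
  have i3 : Integrable fun s : ℝ => (Complex.sinh (w * s) + s * Complex.cosh (w * s)) *
      (gegenbauerDensity k s : ℂ) :=
    integrable_mul_gegenbauerDensity hk (by fun_prop) fun s hs =>
      (norm_add_le _ _).trans (add_le_add (hsinh s hs) (hmul s _ hs (hcosh s hs)))
  have i3z : ∫ s : ℝ, (Complex.sinh (w * s) + s * Complex.cosh (w * s)) *
      (gegenbauerDensity k s : ℂ) = 0 := by
    refine integral_eq_zero_of_odd fun s => ?_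
    rw [gegenbauerDensity_neg, Complex.ofReal_neg, mul_neg, Complex.sinh_neg, Complex.cosh_neg]
    ring
  rw [integral_congr_ae (ae_of_all _ hsplit), integral_add (by exact i1.add i2) i3, i3z, add_zero,
    integral_add i1 i2, dunklExp]
  have hsum : Summable fun n : ℕ => ‖w‖ ^ n / n.factorial := Real.summable_pow_div_factorial _
  congr 1
  · refine (hasSum_besselJ hk.le w).unique ?_
    have h := integral_hasSum_gegenbauer hk 0 (fun n => w ^ (2 * n) / (2 * n).factorial)
      (fun s => Complex.cosh (w * s)) ?_ ?_
    · convert h using 2 with n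
      have hf := factorial_two_mul n
      have h0 : ((2 * n).factorial : ℝ) ≠ 0 := by positivity
      have h1 : gammaRatio k n * Real.Gamma (n + 1 / 2) / √Real.pi =
          besselCoeff k n * (2 * n).factorial := by
        rw [besselCoeff]
        generalize Real.Gamma (n + 1 / 2) = G at hf ⊢
        field_simp
        linear_combination -gammaRatio k n * hf
      rw [add_zero, h1]
      have h0' : ((2 * n).factorial : ℂ) ≠ 0 := by exact_mod_cast h0
      push_cast
      field_simp
    · have := hsum.comp_injective (i := fun n : ℕ => 2 * n) fun a b h => by simpa using h
      simpa [Function.comp_def] using this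
    · intro s
      convert Complex.hasSum_cosh (w * s) using 2 with n
      rw [add_zero, mul_pow]; ring
  · refine HasSum.unique ((hasSum_besselJ (k := k + 1) (by linarith) w).mul_left
      (w / (2 * ((k : ℂ) + 1)))) ?_
    have h := integral_hasSum_gegenbauer hk 1 (fun n => w ^ (2 * n + 1) / (2 * n + 1).factorial)
      (fun s => s * Complex.sinh (w * s)) ?_ ?_
    · refine hasSum_of_terms_eq h fun n => ?_
      have hf := factorial_two_mul (n + 1)
      have h0 : ((2 * n + 1).factorial : ℝ) ≠ 0 := by positivity
      have hk1 : k + 1 ≠ 0 := by linarith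
      have h1 : gammaRatio k (n + 1) * Real.Gamma ((n + 1 : ℕ) + 1 / 2) / √Real.pi =
          besselCoeff (k + 1) n / (2 * (k + 1)) * (2 * n + 1).factorial := by
        rw [besselCoeff, gammaRatio_add_one hk.le]
        rw [show 2 * (n + 1) = 2 * n + 1 + 1 by ring, Nat.factorial_succ, Nat.factorial_succ n,
          pow_succ] at hf
        have hn : (n : ℝ) + 1 ≠ 0 := by positivity
        have hf' : ((2 * n + 1).factorial : ℝ) * √Real.pi =
            2 * 4 ^ n * n.factorial * Real.Gamma ((n + 1 : ℕ) + 1 / 2) := by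
          apply mul_left_cancel₀ hn
          push_cast at hf ⊢
          linear_combination hf / 2
        generalize Real.Gamma ((n + 1 : ℕ) + 1 / 2) = G at hf' ⊢
        field_simp
        linear_combination -gammaRatio k (n + 1) * hf'
      rw [h1]
      have h0' : ((2 * n + 1).factorial : ℂ) ≠ 0 := by exact_mod_cast h0
      have hk1' : (k : ℂ) + 1 ≠ 0 := by exact_mod_cast hk1
      push_cast
      field_simp
      ring
    · have := hsum.comp_injective (i := fun n : ℕ => 2 * n + 1) fun a b h => by simpa using h
      simpa [Function.comp_def] using this
    · intro s
      refine hasSum_of_terms_eq ((Complex.hasSum_sinh (w * s)).mul_left (s : ℂ)) fun n => ?_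
      rw [mul_pow]; ring

/-- The Poisson integral is unavailable at this endpoint, so the two Bessel series are matched
directly with those of cosh and sinh. -/
lemma dunklExp_neg_half (w : ℂ) : dunklExp (-1 / 2) w = Complex.exp w := by
  have hk : (-1 / 2 : ℝ) ≤ -1 / 2 := le_rfl
  have hr : ∀ n : ℕ, gammaRatio (-1 / 2) n * Real.Gamma (n + 1 / 2) = √Real.pi := by
    intro n
    have : Real.Gamma ((n : ℝ) + 1 / 2) ≠ 0 := (Real.Gamma_pos_of_pos (by positivity)).ne'
    rw [gammaRatio, show (n : ℝ) + -1 / 2 + 1 = n + 1 / 2 by ring, div_mul_cancel₀ _ this,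
      ← Real.Gamma_one_half_eq]
    norm_num
  have hpi : √Real.pi ≠ 0 := by positivity
  rw [← Complex.cosh_add_sinh, dunklExp]
  congr 1
  · refine (hasSum_besselJ hk w).unique ?_
    convert Complex.hasSum_cosh w using 2 with n
    have h1 : besselCoeff (-1 / 2) n = 1 / (2 * n).factorial := by
      rw [besselCoeff, div_eq_div_iff (by positivity) (by positivity)]
      apply mul_right_cancel₀ hpi
      linear_combination gammaRatio (-1 / 2) n * factorial_two_mul n +
        4 ^ n * n.factorial * hr n
    rw [h1]; push_cast; ring
  · refine HasSum.unique ((hasSum_besselJ (k := -1 / 2 + 1) (by norm_num) w).mul_left _) ?_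
    refine hasSum_of_terms_eq (Complex.hasSum_sinh w) fun n => ?_
    have h1 : besselCoeff (-1 / 2 + 1) n = 1 / (2 * n + 1).factorial := by
      rw [besselCoeff, gammaRatio_add_one hk, div_eq_div_iff (by positivity) (by positivity)]
      have hf := factorial_two_mul (n + 1)
      rw [show 2 * (n + 1) = 2 * n + 1 + 1 by ring, Nat.factorial_succ, Nat.factorial_succ n,
        pow_succ] at hf
      have hn : (n : ℝ) + 1 ≠ 0 := by positivity
      have hf' : ((2 * n + 1).factorial : ℝ) * √Real.pi =
          2 * 4 ^ n * n.factorial * Real.Gamma ((n + 1 : ℕ) + 1 / 2) := by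
        apply mul_left_cancel₀ hn
        push_cast at hf ⊢
        linear_combination hf / 2
      apply mul_right_cancel₀ hpi
      linear_combination (1 / 2 : ℝ) * gammaRatio (-1 / 2) (n + 1) * hf' +
        4 ^ n * n.factorial * hr (n + 1)
    rw [h1]; push_cast; ring

/-- The kernel grows at most like the exponential of the real part. -/
lemma norm_dunklExp_le {k : ℝ} (hk : -1 / 2 ≤ k) (w : ℂ) :
    ‖dunklExp k w‖ ≤ Real.exp |w.re| := by
  rcases hk.eq_or_lt with rfl | hk
  · rw [dunklExp_neg_half, Complex.norm_exp]
    exact Real.exp_le_exp.2 (le_abs_self _)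
  · have hodd : ∫ s : ℝ, (s : ℂ) * (gegenbauerDensity k s : ℂ) = 0 :=
      integral_eq_zero_of_odd fun s => by rw [gegenbauerDensity_neg]; push_cast; ring
    have hodd' : ∫ s : ℝ, s * gegenbauerDensity k s = 0 := by
      have : ((∫ s : ℝ, s * gegenbauerDensity k s : ℝ) : ℂ) = 0 := by
        rw [← integral_complex_ofReal, ← hodd]; push_cast; rfl
      exact_mod_cast this
    have hi : Integrable fun s : ℝ => s * gegenbauerDensity k s := by
      have := integrable_mul_gegenbauerDensity hk (g := fun s => (s : ℂ)) (by fun_prop) (B := 1)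
        fun s hs => by rw [Complex.norm_real]; exact hs
      have h2 := this.re
      refine h2.congr (ae_of_all _ fun s => ?_)
      simp
    rw [dunklExp_eq_integral hk]
    -- On the support 1 + s is nonnegative and s times the weight is odd, so (1 + s) times the
    -- weight is again a probability density. This is what gives the constant 1 in the bound.
    have hle : ∀ s : ℝ, ‖Complex.exp (w * s) * (1 + s) * (gegenbauerDensity k s : ℂ)‖ ≤
        Real.exp |w.re| * (gegenbauerDensity k s + s * gegenbauerDensity k s) := by
      intro s
      rw [norm_mul, Complex.norm_real, Real.norm_of_nonneg (gegenbauerDensity_nonneg hk s)]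
      by_cases hs : s ^ 2 < 1
      · have hs' := (sq_lt_one_iff_abs_lt_one s).1 hs
        have h1 : 0 ≤ 1 + s := by linarith [(abs_lt.1 hs').1]
        have h2 : ‖(1 : ℂ) + s‖ = 1 + s := by
          rw [← Complex.ofReal_one, ← Complex.ofReal_add, Complex.norm_real,
            Real.norm_of_nonneg h1]
        have h3 : ‖Complex.exp (w * s)‖ ≤ Real.exp |w.re| := by
          rw [Complex.norm_exp]
          refine Real.exp_le_exp.2 ((le_abs_self _).trans ?_)
          rw [Complex.re_mul_ofReal, abs_mul]
          exact mul_le_of_le_one_right (abs_nonneg _) hs'.le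
        rw [norm_mul, h2]
        calc ‖Complex.exp (w * s)‖ * (1 + s) * gegenbauerDensity k s
            ≤ Real.exp |w.re| * (1 + s) * gegenbauerDensity k s := by
              gcongr
              exact gegenbauerDensity_nonneg hk s
          _ = _ := by ring
      · rw [gegenbauerDensity_eq_zero (not_lt.1 hs)]; simp
    refine (norm_integral_le_of_norm_le (((integrable_gegenbauerDensity hk).add hi).const_mul _)
      (ae_of_all _ hle)).trans_eq ?_
    simp only [Pi.add_apply]
    rw [integral_const_mul, integral_add (integrable_gegenbauerDensity hk) hi,
      integral_gegenbauerDensity hk, hodd', add_zero, mul_one]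

/-! ### The measure `muK` -/

/-- The density of `muK k`. -/
def muDensity (k x : ℝ) : ℝ := |x| ^ (2 * k + 1) / ((2 : ℝ) ^ (k + 1) * Real.Gamma (k + 1))

lemma muK_eq (k : ℝ) : muK k = volume.withDensity fun x => ENNReal.ofReal (muDensity k x) := rfl

lemma measurable_muDensity (k : ℝ) : Measurable (muDensity k) := by
  unfold muDensity; fun_prop

lemma muDensity_nonneg {k : ℝ} (hk : -1 / 2 ≤ k) (x : ℝ) : 0 ≤ muDensity k x := by
  have : 0 < Real.Gamma (k + 1) := Real.Gamma_pos_of_pos (by linarith)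
  unfold muDensity; positivity

lemma muDensity_pos {k : ℝ} (hk : -1 / 2 ≤ k) {x : ℝ} (hx : x ≠ 0) : 0 < muDensity k x := by
  have : 0 < Real.Gamma (k + 1) := Real.Gamma_pos_of_pos (by linarith)
  have h2 : 0 < |x| := abs_pos.2 hx
  unfold muDensity; positivity

lemma muDensity_neg (k x : ℝ) : muDensity k (-x) = muDensity k x := by simp [muDensity]

instance (k : ℝ) : SigmaFinite (muK k) := by
  exact SigmaFinite.withDensity_ofReal _

lemma muK_absolutelyContinuous (k : ℝ) : muK k ≪ volume := withDensity_absolutelyContinuous _ _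

lemma absolutelyContinuous_muK {k : ℝ} (hk : -1 / 2 ≤ k) : volume ≪ muK k := by
  rw [muK_eq]
  refine withDensity_absolutelyContinuous' (measurable_muDensity k).ennreal_ofReal.aemeasurable ?_
  filter_upwards [compl_mem_ae_iff.2 (measure_singleton (0 : ℝ))] with x hx
  simpa using muDensity_pos hk hx

lemma ae_muK_iff {k : ℝ} (hk : -1 / 2 ≤ k) {p : ℝ → Prop} :
    (∀ᵐ x ∂muK k, p x) ↔ ∀ᵐ x, p x :=
  ⟨fun h => (absolutelyContinuous_muK hk).ae_le h, fun h => (muK_absolutelyContinuous k).ae_le h⟩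

lemma integral_muK {k : ℝ} (hk : -1 / 2 ≤ k) (f : ℝ → ℂ) :
    ∫ x, f x ∂muK k = ∫ x, (muDensity k x : ℂ) * f x := by
  rw [muK_eq, integral_withDensity_eq_integral_toReal_smul
    (measurable_muDensity k).ennreal_ofReal (by simp)]
  congr 1; ext x
  rw [ENNReal.toReal_ofReal (muDensity_nonneg hk x), Complex.real_smul]

lemma integrable_muK_iff {k : ℝ} (hk : -1 / 2 ≤ k) (f : ℝ → ℂ) :
    Integrable f (muK k) ↔ Integrable fun x => (muDensity k x : ℂ) * f x := by
  rw [muK_eq, integrable_withDensity_iff_integrable_smul'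
    (measurable_muDensity k).ennreal_ofReal (by simp)]
  refine integrable_congr (ae_of_all _ fun x => ?_)
  simp only []
  rw [ENNReal.toReal_ofReal (muDensity_nonneg hk x), Complex.real_smul]

/-- Dilations scale the measure `muK`. -/
lemma map_mul_muK {k : ℝ} {a : ℝ} (ha : a ≠ 0) :
    (muK k).map (fun x => a * x) = ENNReal.ofReal (|a| ^ (-(2 * k + 2))) • muK k := by
  have ha' : 0 < |a| := abs_pos.2 ha
  have hemb : MeasurableEmbedding fun x : ℝ => a * x := measurableEmbedding_mulLeft₀ ha
  have h1 : ∀ x, ENNReal.ofReal (muDensity k x) = ENNReal.ofReal (|a| ^ (-(2 * k + 1))) *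
      ENNReal.ofReal (muDensity k (a * x)) := by
    intro x
    rw [← ENNReal.ofReal_mul (by positivity), muDensity, muDensity, abs_mul,
      Real.mul_rpow (abs_nonneg _) (abs_nonneg _), Real.rpow_neg (abs_nonneg _)]
    have := (Real.rpow_pos_of_pos ha' (2 * k + 1)).ne'
    congr 1
    field_simp
  ext s hs
  rw [Measure.map_apply (by fun_prop) hs, Measure.smul_apply, smul_eq_mul, muK_eq,
    withDensity_apply _ hs, withDensity_apply _ (measurableSet_preimage (by fun_prop) hs)]
  rw [lintegral_congr h1]
  rw [lintegral_const_mul' _ _ (by simp), ← hemb.lintegral_map (μ := volume.restrict _)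
      (fun y => ENNReal.ofReal (muDensity k y)),
    ← Measure.restrict_map (by fun_prop) hs, Real.map_volume_mul_left ha, Measure.restrict_smul,
    lintegral_smul_measure, smul_eq_mul, ← mul_assoc, ← ENNReal.ofReal_mul (by positivity)]
  congr 2
  rw [abs_inv, ← Real.rpow_neg_one, ← Real.rpow_add ha']
  congr 1; ring

lemma quasiMeasurePreserving_mul {k : ℝ} {a : ℝ} (ha : a ≠ 0) :
    Measure.QuasiMeasurePreserving (fun x => a * x) (muK k) (muK k) :=
  ⟨by fun_prop, by rw [map_mul_muK ha]; exact Measure.smul_absolutelyContinuous⟩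

lemma integral_comp_mul_muK {k : ℝ} {a : ℝ} (ha : a ≠ 0) (f : ℝ → ℂ) :
    ∫ x, f (a * x) ∂muK k = ((|a| ^ (-(2 * k + 2)) : ℝ) : ℂ) * ∫ x, f x ∂muK k := by
  rw [← (measurableEmbedding_mulLeft₀ ha).integral_map, map_mul_muK ha,
    integral_smul_measure, ENNReal.toReal_ofReal (by positivity), Complex.real_smul]

lemma eLpNorm_comp_mul_muK {k : ℝ} {a : ℝ} (ha : a ≠ 0) (f : ℝ → ℂ) :
    eLpNorm (fun x => f (a * x)) 2 (muK k) =
      ENNReal.ofReal (|a| ^ (-(2 * k + 2))) ^ (1 / 2 : ℝ) * eLpNorm f 2 (muK k) := by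
  have ha' : 0 < |a| := abs_pos.2 ha
  have h := (measurableEmbedding_mulLeft₀ ha).eLpNorm_map_measure (g := f) (p := 2) (μ := muK k)
  rw [map_mul_muK ha, eLpNorm_smul_measure_of_ne_zero] at h
  · rw [show (fun x => f (a * x)) = f ∘ (fun x => a * x) from rfl, ← h]
    simp
  · simpa using Real.rpow_pos_of_pos ha' _

lemma memLp_comp_mul_muK {k : ℝ} {a : ℝ} (ha : a ≠ 0) {f : ℝ → ℂ}
    (hf : MemLp f 2 (muK k)) : MemLp (fun x => f (a * x)) 2 (muK k) := by
  refine ⟨hf.1.comp_quasiMeasurePreserving (quasiMeasurePreserving_mul ha), ?_⟩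
  rw [eLpNorm_comp_mul_muK ha]
  exact ENNReal.mul_lt_top (ENNReal.rpow_lt_top_of_nonneg (by norm_num) ENNReal.ofReal_ne_top) hf.2

lemma integral_comp_neg_muK {k : ℝ} (f : ℝ → ℂ) :
    ∫ x, f (-x) ∂muK k = ∫ x, f x ∂muK k := by
  have := integral_comp_mul_muK (k := k) (a := -1) (by norm_num) f
  simpa using this

lemma integrable_comp_neg_muK {k : ℝ} (hk : -1 / 2 ≤ k) {f : ℝ → ℂ} (hf : Integrable f (muK k)) :
    Integrable (fun x => f (-x)) (muK k) := by
  rw [integrable_muK_iff hk] at hf ⊢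
  simpa [muDensity_neg] using hf.comp_neg

/-! ### Gaussian integrals -/

/-- The moments `∫ y^(2n) e^{-u y²} dμ_k(y)`. -/
def gaussMoment (k u : ℝ) (n : ℕ) : ℝ := (2 * u) ^ (-(k + 1)) / (gammaRatio k n * u ^ n)

lemma gaussMoment_pos {k u : ℝ} (hk : -1 / 2 ≤ k) (hu : 0 < u) (n : ℕ) :
    0 < gaussMoment k u n := by
  have := gammaRatio_pos hk n
  unfold gaussMoment; positivity

lemma integral_pow_mul_gauss {k u : ℝ} (hk : -1 / 2 ≤ k) (hu : 0 < u) (n : ℕ) :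
    ∫ y, ((y ^ (2 * n) * Real.exp (-u * y ^ 2) : ℝ) : ℂ) ∂muK k = gaussMoment k u n := by
  rw [integral_muK hk]
  have hG : 0 < Real.Gamma (k + 1) := Real.Gamma_pos_of_pos (by linarith)
  have hn : (0 : ℝ) ≤ n := n.cast_nonneg
  have h1 : ∫ y, muDensity k y * (y ^ (2 * n) * Real.exp (-u * y ^ 2)) = gaussMoment k u n := by
    have h := integral_comp_abs
      (f := fun y => muDensity k y * (y ^ (2 * n) * Real.exp (-u * y ^ 2)))
    have h2 : ∀ y : ℝ, |y| ^ (2 * n) = y ^ (2 * n) := fun y => by rw [pow_mul, sq_abs, pow_mul]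
    simp only [muDensity, sq_abs, h2, abs_abs] at h ⊢
    rw [h]
    have h3 : ∀ y ∈ Ioi (0 : ℝ), |y| ^ (2 * k + 1) / ((2 : ℝ) ^ (k + 1) * Real.Gamma (k + 1)) *
        (y ^ (2 * n) * Real.exp (-u * y ^ 2)) = 1 / ((2 : ℝ) ^ (k + 1) * Real.Gamma (k + 1)) *
        (y ^ (2 * n + 2 * k + 1) * Real.exp (-u * y ^ (2 : ℝ))) := by
      intro y hy
      rw [abs_of_pos hy, show (2 * n + 2 * k + 1 : ℝ) = ((2 * n : ℕ) : ℝ) + (2 * k + 1) by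
        push_cast; ring, Real.rpow_add hy (2 * n : ℕ), Real.rpow_natCast, Real.rpow_two]
      ring
    rw [setIntegral_congr_fun measurableSet_Ioi h3, integral_const_mul,
      integral_rpow_mul_exp_neg_mul_rpow (by norm_num) (by linarith) hu,
      show (2 * n + 2 * k + 1 + 1 : ℝ) / 2 = n + k + 1 by ring, gaussMoment, gammaRatio]
    have h4 : 0 < Real.Gamma (n + k + 1) := Real.Gamma_pos_of_pos (by linarith)
    rw [Real.mul_rpow (by norm_num) hu.le,
      show -(2 * n + 2 * k + 1 + 1 : ℝ) / 2 = -(k + 1) + -(n : ℝ) by ring]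
    rw [Real.rpow_add hu, Real.rpow_neg hu.le (n : ℝ), Real.rpow_natCast,
      Real.rpow_neg (by norm_num : (0 : ℝ) ≤ 2)]
    field_simp
  rw [← h1, ← integral_complex_ofReal]
  congr 1; ext y; push_cast; ring

lemma integrable_pow_mul_gauss {k u : ℝ} (hk : -1 / 2 ≤ k) (hu : 0 < u) (n : ℕ) :
    Integrable (fun y => ((y ^ (2 * n) * Real.exp (-u * y ^ 2) : ℝ) : ℂ)) (muK k) := by
  by_contra h
  have h1 := integral_pow_mul_gauss hk hu n
  rw [integral_undef h] at h1
  exact (gaussMoment_pos hk hu n).ne (by exact_mod_cast h1)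

lemma integrable_abs_pow_mul_gauss {k u : ℝ} (hk : -1 / 2 ≤ k) (hu : 0 < u) (n : ℕ) :
    Integrable (fun y => |y| ^ n * Real.exp (-u * y ^ 2)) (muK k) := by
  have h0 := (integrable_pow_mul_gauss hk hu 0).norm
  have h1 := (integrable_pow_mul_gauss hk hu n).norm
  refine (h0.add h1).mono' (by fun_prop) (ae_of_all _ fun y => ?_)
  simp only [Pi.add_apply, Complex.norm_real, norm_mul, Real.norm_eq_abs, abs_pow, abs_abs,
    Real.abs_exp, mul_zero, pow_zero, abs_one]
  rw [← add_mul]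
  refine mul_le_mul_of_nonneg_right ?_ (Real.exp_pos _).le
  rcases le_total |y| 1 with h | h
  · linarith [pow_le_one₀ (n := n) (abs_nonneg y) h, pow_nonneg (abs_nonneg y) (2 * n)]
  · linarith [pow_le_pow_right₀ h (show n ≤ 2 * n by omega)]

/-- Integrability of functions of at most exponential growth against Gaussians. -/
lemma integrable_mul_gauss_of_le {k u c : ℝ} (hk : -1 / 2 ≤ k) (hu : 0 < u) (n : ℕ) {g : ℝ → ℂ}
    (hm : Measurable g) (hg : ∀ y, ‖g y‖ ≤ Real.exp (c * |y|)) :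
    Integrable (fun y => g y * ((y : ℂ) ^ n * Complex.exp (-u * y ^ 2))) (muK k) := by
  have h := (integrable_abs_pow_mul_gauss hk (half_pos hu) n).const_mul
    (Real.exp (c ^ 2 / (2 * u)))
  refine h.mono' (by fun_prop) (ae_of_all _ fun y => ?_)
  have h1 : ‖Complex.exp (-u * y ^ 2)‖ = Real.exp (-u * y ^ 2) := by
    rw [Complex.norm_exp]; norm_cast
  rw [norm_mul, norm_mul, norm_pow, Complex.norm_real, h1, Real.norm_eq_abs]
  -- Completing the square: half of the Gaussian decay absorbs the exponential growth.
  have h2 : c * |y| + -u * y ^ 2 ≤ c ^ 2 / (2 * u) + -(u / 2) * y ^ 2 := by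
    have : c ^ 2 / (2 * u) + -(u / 2) * y ^ 2 - (c * |y| + -u * y ^ 2) =
        (u * |y| - c) ^ 2 / (2 * u) := by
      rw [← sq_abs y]; field_simp; ring
    have h3 : 0 ≤ (u * |y| - c) ^ 2 / (2 * u) := by positivity
    linarith
  calc ‖g y‖ * (|y| ^ n * Real.exp (-u * y ^ 2))
      ≤ Real.exp (c * |y|) * (|y| ^ n * Real.exp (-u * y ^ 2)) := by gcongr; exact hg y
    _ = |y| ^ n * Real.exp (c * |y| + -u * y ^ 2) := by rw [Real.exp_add]; ring
    _ ≤ |y| ^ n * Real.exp (c ^ 2 / (2 * u) + -(u / 2) * y ^ 2) := by gcongr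
    _ = _ := by rw [Real.exp_add]; ring

lemma norm_dunklExp_mul_le {k : ℝ} (hk : -1 / 2 ≤ k) (z : ℂ) (y : ℝ) :
    ‖dunklExp k (z * y)‖ ≤ Real.exp (‖z‖ * |y|) := by
  refine (norm_dunklExp_le hk _).trans (Real.exp_le_exp.2 ?_)
  rw [Complex.re_mul_ofReal, abs_mul]
  gcongr
  exact Complex.abs_re_le_norm z

lemma integrable_dunklExp_mul_gauss {k u : ℝ} (hk : -1 / 2 ≤ k) (hu : 0 < u) (n : ℕ) (z : ℂ) :
    Integrable (fun y : ℝ => dunklExp k (z * y) * ((y : ℂ) ^ n * Complex.exp (-u * y ^ 2)))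
      (muK k) := by
  have := measurable_dunklExp hk
  exact integrable_mul_gauss_of_le hk hu n (by fun_prop) (norm_dunklExp_mul_le hk z)

/-- Because a is nonnegative, the integrals of the norms of the terms form the same series evaluated
at ‖z‖. The summability hypothesis is therefore exactly what term-by-term integration needs. -/
lemma hasSum_integral_gauss {k u : ℝ} (hk : -1 / 2 ≤ k) (hu : 0 < u) (p : ℕ) (z : ℂ)
    (a : ℕ → ℝ) (ha : ∀ n, 0 ≤ a n) (g : ℝ → ℂ)
    (hg : ∀ y : ℝ, HasSum (fun n => (a n : ℂ) * (z * y) ^ (2 * n)) (g y))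
    (hs : Summable fun n => a n * ‖z‖ ^ (2 * n) * gaussMoment k u (n + p)) :
    HasSum (fun n => a n * z ^ (2 * n) * gaussMoment k u (n + p))
      (∫ y : ℝ, g y * ((y : ℂ) ^ (2 * p) * Complex.exp (-u * y ^ 2)) ∂muK k) := by
  have e0 : ∀ n (y : ℝ), (a n : ℂ) * (z * y) ^ (2 * n) *
      ((y : ℂ) ^ (2 * p) * Complex.exp (-u * y ^ 2)) = a n * z ^ (2 * n) *
        ((y ^ (2 * (n + p)) * Real.exp (-u * y ^ 2) : ℝ) : ℂ) := by
    intro n y; push_cast; ring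
  have hint : ∀ n, Integrable (fun y : ℝ => (a n : ℂ) * (z * y) ^ (2 * n) *
      ((y : ℂ) ^ (2 * p) * Complex.exp (-u * y ^ 2))) (muK k) := by
    intro n
    simp only [e0]
    exact (integrable_pow_mul_gauss hk hu _).const_mul _
  have hnorm : ∀ n, ∫ y : ℝ, ‖(a n : ℂ) * (z * y) ^ (2 * n) *
      ((y : ℂ) ^ (2 * p) * Complex.exp (-u * y ^ 2))‖ ∂muK k =
        a n * ‖z‖ ^ (2 * n) * gaussMoment k u (n + p) := by
    intro n
    have h1 : ∀ y : ℝ, ‖(a n : ℂ) * (z * y) ^ (2 * n) *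
      ((y : ℂ) ^ (2 * p) * Complex.exp (-u * y ^ 2))‖ = a n * ‖z‖ ^ (2 * n) *
        (y ^ (2 * (n + p)) * Real.exp (-u * y ^ 2)) := by
      intro y
      have h2 : 0 ≤ y ^ (2 * (n + p)) := by rw [pow_mul]; positivity
      rw [e0, norm_mul, norm_mul, norm_pow, Complex.norm_real, Complex.norm_real,
        Real.norm_of_nonneg (ha n), Real.norm_of_nonneg (by positivity)]
    simp only [h1]
    rw [integral_const_mul]
    congr 1
    have := integral_pow_mul_gauss hk hu (n + p)
    rw [integral_complex_ofReal] at this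
    exact_mod_cast this
  have h := hasSum_integral_of_summable_integral_norm hint (by simpa only [hnorm] using hs)
  have e2 : ∫ y : ℝ, ∑' n, (a n : ℂ) * (z * y) ^ (2 * n) *
      ((y : ℂ) ^ (2 * p) * Complex.exp (-u * y ^ 2)) ∂muK k =
      ∫ y : ℝ, g y * ((y : ℂ) ^ (2 * p) * Complex.exp (-u * y ^ 2)) ∂muK k := by
    congr 1; ext y
    exact ((hg y).mul_right _).tsum_eq
  rw [e2] at h
  refine hasSum_of_terms_eq h fun n => ?_
  simp only [e0]
  rw [integral_const_mul, integral_pow_mul_gauss hk hu]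

lemma hasSum_cexp (x : ℂ) : HasSum (fun n : ℕ => x ^ n / n.factorial) (Complex.exp x) := by
  rw [Complex.exp_eq_exp_ℂ]; exact NormedSpace.expSeries_div_hasSum_exp x

lemma hasSum_natCast_mul_cexp (x : ℂ) :
    HasSum (fun n : ℕ => n * (x ^ n / n.factorial)) (x * Complex.exp x) := by
  rw [← hasSum_nat_add_iff' 1]
  simp only [Finset.range_one, Finset.sum_singleton, Nat.cast_zero, zero_mul, sub_zero]
  refine hasSum_of_terms_eq ((hasSum_cexp x).mul_left x) fun n => ?_
  have h1 : (n.factorial : ℂ) ≠ 0 := by exact_mod_cast n.factorial_ne_zero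
  have h2 : (n : ℂ) + 1 ≠ 0 := by exact_mod_cast n.succ_ne_zero
  rw [Nat.factorial_succ, pow_succ]
  push_cast
  field_simp

/-- The moment carries the inverse of the Gamma quotient in the Bessel coefficient, so the product
is a term of an exponential series. The two shifted versions below gain a factor n + k + 1 or k + 1.
-/
lemma besselCoeff_mul_gaussMoment {k u : ℝ} (hk : -1 / 2 ≤ k) (hu : 0 < u) (n : ℕ) :
    besselCoeff k n * gaussMoment k u n =
      (2 * u) ^ (-(k + 1)) * ((1 / (4 * u)) ^ n / n.factorial) := by
  have := (gammaRatio_pos hk n).ne'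
  rw [besselCoeff, gaussMoment, div_pow, mul_pow, one_pow]
  field_simp

lemma besselCoeff_mul_gaussMoment_succ {k u : ℝ} (hk : -1 / 2 ≤ k) (hu : 0 < u) (n : ℕ) :
    besselCoeff k n * gaussMoment k u (n + 1) =
      (2 * u) ^ (-(k + 1)) / u * ((n + k + 1) * ((1 / (4 * u)) ^ n / n.factorial)) := by
  have := (gammaRatio_pos hk n).ne'
  have hn : (0 : ℝ) ≤ n := n.cast_nonneg
  have hn' : (n : ℝ) + k + 1 ≠ 0 := by linarith
  rw [besselCoeff, gaussMoment, gammaRatio_succ hk, div_pow, mul_pow, one_pow, pow_succ]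
  field_simp

lemma besselCoeff_add_one_mul_gaussMoment_succ {k u : ℝ} (hk : -1 / 2 ≤ k) (hu : 0 < u) (n : ℕ) :
    besselCoeff (k + 1) n * gaussMoment k u (n + 1) =
      (k + 1) * (2 * u) ^ (-(k + 1)) / u * ((1 / (4 * u)) ^ n / n.factorial) := by
  have := (gammaRatio_pos hk (n + 1)).ne'
  rw [besselCoeff, gaussMoment, gammaRatio_add_one hk, div_pow, mul_pow, one_pow, pow_succ]
  field_simp

/-- The value `(2u)^(-(k+1)) e^{z²/(4u)}` of `∫ e^{-u y²} E_k(z, y) dμ_k(y)`. -/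
def gaussValue (k u : ℝ) (z : ℂ) : ℂ :=
  (((2 * u) ^ (-(k + 1)) : ℝ) : ℂ) * Complex.exp (z ^ 2 / (4 * u))

lemma integral_besselJ_mul_gauss {k u : ℝ} (hk : -1 / 2 ≤ k) (hu : 0 < u) (z : ℂ) :
    ∫ y : ℝ, besselJ k (Complex.I * (z * y)) * Complex.exp (-u * y ^ 2) ∂muK k =
      gaussValue k u z := by
  have h := hasSum_integral_gauss hk hu 0 z (besselCoeff k) (fun n => (besselCoeff_pos hk n).le)
    (fun y => besselJ k (Complex.I * (z * y))) (fun y => hasSum_besselJ hk _) ?_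
  · simp only [mul_zero, pow_zero, one_mul, add_zero] at h
    refine h.unique (hasSum_of_terms_eq ((hasSum_cexp (z ^ 2 / (4 * u))).mul_left _) fun n => ?_)
    have e := congrArg (fun r : ℝ => (r : ℂ)) (besselCoeff_mul_gaussMoment hk hu n)
    push_cast at e ⊢
    rw [mul_right_comm, e, pow_mul]
    simp only [div_pow, one_pow]
    ring
  · refine Summable.congr ((Real.summable_pow_div_factorial (‖z‖ ^ 2 / (4 * u))).mul_left
      ((2 * u) ^ (-(k + 1)))) fun n => ?_
    have e := besselCoeff_mul_gaussMoment hk hu n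
    rw [add_zero, mul_right_comm, e, pow_mul]
    simp only [div_pow, one_pow]
    ring

lemma integral_sq_mul_besselJ_mul_gauss {k u : ℝ} (hk : -1 / 2 ≤ k) (hu : 0 < u) (z : ℂ) :
    ∫ y : ℝ, besselJ k (Complex.I * (z * y)) * ((y : ℂ) ^ 2 * Complex.exp (-u * y ^ 2)) ∂muK k =
      ((k + 1) / u + z ^ 2 / (4 * u ^ 2)) * gaussValue k u z := by
  have hu' : (u : ℂ) ≠ 0 := by exact_mod_cast hu.ne'
  have hterm : ∀ x : ℂ, HasSum (fun n : ℕ => (n + k + 1) * (x ^ n / n.factorial))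
      ((x + k + 1) * Complex.exp x) := by
    intro x
    have := (hasSum_natCast_mul_cexp x).add ((hasSum_cexp x).mul_left ((k : ℂ) + 1))
    rw [← add_mul, ← add_assoc] at this
    exact hasSum_of_terms_eq this fun n => by ring
  have h := hasSum_integral_gauss hk hu 1 z (besselCoeff k) (fun n => (besselCoeff_pos hk n).le)
    (fun y => besselJ k (Complex.I * (z * y))) (fun y => hasSum_besselJ hk _) ?_
  · simp only [mul_one] at h
    have h2 := (hterm (z ^ 2 / (4 * u))).mul_left ((((2 * u) ^ (-(k + 1)) / u : ℝ) : ℂ))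
    have e3 : ((((2 * u) ^ (-(k + 1)) / u : ℝ) : ℂ)) * ((z ^ 2 / (4 * u) + k + 1) *
        Complex.exp (z ^ 2 / (4 * u))) =
        ((k + 1) / u + z ^ 2 / (4 * u ^ 2)) * gaussValue k u z := by
      rw [gaussValue]; push_cast; field_simp; ring
    rw [← e3]
    refine h.unique (hasSum_of_terms_eq h2 fun n => ?_)
    have e := congrArg (fun r : ℝ => (r : ℂ)) (besselCoeff_mul_gaussMoment_succ hk hu n)
    push_cast at e ⊢
    rw [mul_right_comm, e, pow_mul]
    simp only [div_pow, one_pow]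
    ring
  · have hs := (hterm ((‖z‖ ^ 2 / (4 * u) : ℝ) : ℂ)).summable.norm.mul_left
      ((2 * u) ^ (-(k + 1)) / u)
    refine Summable.congr hs fun n => ?_
    have hn : (0 : ℝ) ≤ n := n.cast_nonneg
    have e := besselCoeff_mul_gaussMoment_succ hk hu n
    have e4 : ‖((n : ℂ) + k + 1) * (((‖z‖ ^ 2 / (4 * u) : ℝ) : ℂ) ^ n / n.factorial)‖ =
        (n + k + 1) * ((‖z‖ ^ 2 / (4 * u)) ^ n / n.factorial) := by
      rw [show ((n : ℂ) + k + 1) * (((‖z‖ ^ 2 / (4 * u) : ℝ) : ℂ) ^ n / n.factorial) =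
        (((n + k + 1) * ((‖z‖ ^ 2 / (4 * u)) ^ n / n.factorial) : ℝ) : ℂ) by push_cast; rfl,
        Complex.norm_real, Real.norm_of_nonneg]
      exact mul_nonneg (by linarith) (by positivity)
    rw [e4, mul_right_comm, e, pow_mul]
    simp only [div_pow, one_pow]
    ring

lemma integral_mul_besselJ_mul_gauss {k u : ℝ} (hk : -1 / 2 ≤ k) (hu : 0 < u) (z : ℂ) :
    ∫ y : ℝ, besselJ (k + 1) (Complex.I * (z * y)) * ((y : ℂ) ^ 2 * Complex.exp (-u * y ^ 2))
      ∂muK k = (k + 1) / u * gaussValue k u z := by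
  have h := hasSum_integral_gauss hk hu 1 z (besselCoeff (k + 1))
    (fun n => (besselCoeff_pos (by linarith) n).le)
    (fun y => besselJ (k + 1) (Complex.I * (z * y)))
    (fun y => hasSum_besselJ (by linarith) _) ?_
  · simp only [mul_one] at h
    rw [gaussValue, ← mul_assoc]
    refine h.unique (hasSum_of_terms_eq ((hasSum_cexp (z ^ 2 / (4 * u))).mul_left _) fun n => ?_)
    have e := congrArg (fun r : ℝ => (r : ℂ)) (besselCoeff_add_one_mul_gaussMoment_succ hk hu n)
    push_cast at e ⊢
    rw [mul_right_comm, e, pow_mul]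
    simp only [div_pow, one_pow]
    ring
  · refine Summable.congr ((Real.summable_pow_div_factorial (‖z‖ ^ 2 / (4 * u))).mul_left
      ((k + 1) * (2 * u) ^ (-(k + 1)) / u)) fun n => ?_
    have e := besselCoeff_add_one_mul_gaussMoment_succ hk hu n
    rw [mul_right_comm, e, pow_mul]
    simp only [div_pow, one_pow]
    ring

lemma dunklExp_add_neg {k : ℝ} (hk : -1 / 2 ≤ k) (w : ℂ) :
    dunklExp k w + dunklExp k (-w) = 2 * besselJ k (Complex.I * w) := by
  rw [dunklExp, dunklExp, besselJ_neg hk, besselJ_neg (by linarith)]; ring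

lemma dunklExp_sub_neg {k : ℝ} (hk : -1 / 2 ≤ k) (w : ℂ) :
    dunklExp k w - dunklExp k (-w) =
      2 * (w / (2 * ((k : ℂ) + 1)) * besselJ (k + 1) (Complex.I * w)) := by
  rw [dunklExp, dunklExp, besselJ_neg hk, besselJ_neg (by linarith)]; ring

/-- Averaging over y and -y keeps the part of the kernel with the parity of the weight: j_k for even
powers and, in the companion lemma, the j_{k+1} term for odd ones. -/
lemma integral_dunklExp_even {k u : ℝ} (hk : -1 / 2 ≤ k) (hu : 0 < u) (z : ℂ) {n : ℕ}
    (hn : Even n) :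
    ∫ y : ℝ, dunklExp k (z * y) * ((y : ℂ) ^ n * Complex.exp (-u * y ^ 2)) ∂muK k =
      ∫ y : ℝ, besselJ k (Complex.I * (z * y)) * ((y : ℂ) ^ n * Complex.exp (-u * y ^ 2))
        ∂muK k := by
  have i1 := integrable_dunklExp_mul_gauss hk hu n z
  have i2 := integrable_comp_neg_muK hk i1
  have e := integral_comp_neg_muK (k := k)
    (fun y : ℝ => dunklExp k (z * y) * ((y : ℂ) ^ n * Complex.exp (-u * y ^ 2)))
  have e2 := integral_add i1 i2
  rw [e, ← two_mul] at e2
  apply mul_left_cancel₀ (two_ne_zero (α := ℂ))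
  rw [← e2, ← integral_const_mul]
  congr 1; ext y
  have := dunklExp_add_neg hk (z * y)
  push_cast
  rw [hn.neg_pow, neg_sq, mul_neg, ← add_mul, this]
  ring

lemma integral_dunklExp_odd {k u : ℝ} (hk : -1 / 2 ≤ k) (hu : 0 < u) (z : ℂ) {n : ℕ}
    (hn : Odd n) :
    ∫ y : ℝ, dunklExp k (z * y) * ((y : ℂ) ^ n * Complex.exp (-u * y ^ 2)) ∂muK k =
      z / (2 * (k + 1)) * ∫ y : ℝ, besselJ (k + 1) (Complex.I * (z * y)) *
        ((y : ℂ) ^ (n + 1) * Complex.exp (-u * y ^ 2)) ∂muK k := by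
  have i1 := integrable_dunklExp_mul_gauss hk hu n z
  have i2 := integrable_comp_neg_muK hk i1
  have e := integral_comp_neg_muK (k := k)
    (fun y : ℝ => dunklExp k (z * y) * ((y : ℂ) ^ n * Complex.exp (-u * y ^ 2)))
  have e2 := integral_add i1 i2
  rw [e, ← two_mul] at e2
  apply mul_left_cancel₀ (two_ne_zero (α := ℂ))
  rw [← e2, ← integral_const_mul, ← integral_const_mul]
  congr 1; ext y
  have := dunklExp_sub_neg hk (z * y)
  push_cast
  rw [hn.neg_pow, neg_sq, mul_neg, pow_succ _ n]
  linear_combination (y : ℂ) ^ n * Complex.exp (-u * y ^ 2) * this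

lemma integral_dunklExp_gauss {k u : ℝ} (hk : -1 / 2 ≤ k) (hu : 0 < u) (z : ℂ) :
    ∫ y : ℝ, dunklExp k (z * y) * ((y : ℂ) ^ 0 * Complex.exp (-u * y ^ 2)) ∂muK k =
      gaussValue k u z := by
  rw [integral_dunklExp_even hk hu z Even.zero, ← integral_besselJ_mul_gauss hk hu]
  simp

lemma integral_dunklExp_id_gauss {k u : ℝ} (hk : -1 / 2 ≤ k) (hu : 0 < u) (z : ℂ) :
    ∫ y : ℝ, dunklExp k (z * y) * ((y : ℂ) ^ 1 * Complex.exp (-u * y ^ 2)) ∂muK k =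
      z / (2 * u) * gaussValue k u z := by
  have hk1 : (k : ℂ) + 1 ≠ 0 := by exact_mod_cast (show k + 1 ≠ 0 by linarith)
  have hu' : (u : ℂ) ≠ 0 := by exact_mod_cast hu.ne'
  rw [integral_dunklExp_odd hk hu z odd_one, integral_mul_besselJ_mul_gauss hk hu]
  field_simp

lemma integral_dunklExp_sq_gauss {k u : ℝ} (hk : -1 / 2 ≤ k) (hu : 0 < u) (z : ℂ) :
    ∫ y : ℝ, dunklExp k (z * y) * ((y : ℂ) ^ 2 * Complex.exp (-u * y ^ 2)) ∂muK k =
      ((k + 1) / u + z ^ 2 / (4 * u ^ 2)) * gaussValue k u z := by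
  rw [integral_dunklExp_even hk hu z even_two, integral_sq_mul_besselJ_mul_gauss hk hu]

/-! ### Uniqueness: Gaussians separate functions -/

/-- The function `e^{-y²}` on `[0, ∞)`. -/
def gaussNNReal : BoundedContinuousFunction NNReal ℝ :=
  BoundedContinuousFunction.ofNormedAddCommGroup (fun y : NNReal => Real.exp (-(y : ℝ) ^ 2))
    (by fun_prop) 1 fun y => by
      rw [Real.norm_eq_abs, Real.abs_exp, Real.exp_le_one_iff]
      nlinarith [sq_nonneg (y : ℝ)]

lemma gaussNNReal_apply (y : NNReal) : gaussNNReal y = Real.exp (-(y : ℝ) ^ 2) := rfl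

/-- On [0, ∞) the function exp(-y²) is injective, so the algebra it generates separates points and
determines finite measures. Its elements are polynomials in this function, whose integrals the
hypothesis fixes. -/
lemma finiteMeasure_ext_of_gauss {P P' : Measure NNReal} [IsFiniteMeasure P] [IsFiniteMeasure P']
    (h : ∀ n : ℕ, ∫ y, (gaussNNReal y) ^ n ∂P = ∫ y, (gaussNNReal y) ^ n ∂P') : P = P' := by
  refine ext_of_forall_mem_subalgebra_integral_eq_of_pseudoEMetric_complete_countable
    (𝕜 := ℝ) (A := StarAlgebra.adjoin ℝ {gaussNNReal}) ?_ ?_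
  · intro x y hxy
    refine ⟨gaussNNReal, ⟨gaussNNReal.toContinuousMap, ?_, rfl⟩, ?_⟩
    · exact ⟨gaussNNReal, StarAlgebra.subset_adjoin ℝ _ (mem_singleton _), rfl⟩
    · simp only [gaussNNReal_apply]
      intro he
      have h1 := Real.exp_injective he
      have h2 : (x : ℝ) ^ 2 = (y : ℝ) ^ 2 := by linarith
      have h3 := (pow_left_inj₀ x.2 y.2 two_ne_zero).1 h2
      exact hxy (NNReal.coe_injective h3)
  · intro g hg
    have hs : star gaussNNReal = gaussNNReal := by ext; simp
    have hg' : g ∈ Algebra.adjoin ℝ {gaussNNReal} := by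
      have := (StarAlgebra.adjoin_toSubalgebra ℝ {gaussNNReal})
      have h2 : g ∈ (StarAlgebra.adjoin ℝ {gaussNNReal}).toSubalgebra := hg
      rw [this, star_singleton, hs, union_self] at h2
      exact h2
    rw [Algebra.adjoin_singleton_eq_range_aeval] at hg'
    obtain ⟨p, rfl⟩ := hg'
    have hp : ∀ y, (Polynomial.aeval gaussNNReal p) y =
        ∑ i ∈ Finset.range (p.natDegree + 1), p.coeff i * (gaussNNReal y) ^ i := by
      intro y
      rw [Polynomial.aeval_eq_sum_range]
      simp
    have hi : ∀ (Q : Measure NNReal) [IsFiniteMeasure Q] (i : ℕ),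
        Integrable (fun y => p.coeff i * (gaussNNReal y) ^ i) Q := by
      intro Q _ i
      have := (gaussNNReal ^ i).integrable Q
      exact this.const_mul _
    have hc : ∀ Q : Measure NNReal, ∫ y, ((Polynomial.aeval gaussNNReal).toRingHom p) y ∂Q =
        ∫ y, ∑ i ∈ Finset.range (p.natDegree + 1), p.coeff i * (gaussNNReal y) ^ i ∂Q :=
      fun Q => integral_congr_ae (ae_of_all _ hp)
    rw [hc, hc]
    rw [integral_finsetSum _ fun i _ => hi P i, integral_finsetSum _ fun i _ => hi P' i]
    simp only [integral_const_mul, h]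

/-- Push the positive and negative parts of w dμ forward under |x|. The two finite measures have the
same Gaussian integrals, hence agree. Preimages under the norm are precisely the symmetric sets. -/
lemma setIntegral_symm_eq_zero_real {μ : Measure ℝ} {w : ℝ → ℝ} (hw : Integrable w μ)
    (h : ∀ n : ℕ, ∫ x, w x * Real.exp (-(n * x ^ 2)) ∂μ = 0) {A : Set NNReal}
    (hA : MeasurableSet A) : ∫ x in (fun x : ℝ => ‖x‖₊) ⁻¹' A, w x ∂μ = 0 := by
  have hmeas : Measurable fun x : ℝ => ‖x‖₊ := measurable_nnnorm
  set P : Measure ℝ := μ.withDensity fun x => ENNReal.ofReal (w x) with hP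
  set P' : Measure ℝ := μ.withDensity fun x => ENNReal.ofReal (-w x) with hP'
  have : IsFiniteMeasure P := isFiniteMeasure_withDensity_ofReal hw.2
  have : IsFiniteMeasure P' := isFiniteMeasure_withDensity_ofReal hw.neg.2
  have hm1 : AEMeasurable (fun x => ENNReal.ofReal (w x)) μ := hw.1.aemeasurable.ennreal_ofReal
  have hm2 : AEMeasurable (fun x => ENNReal.ofReal (-w x)) μ := hw.1.aemeasurable.neg.ennreal_ofReal
  have hb : ∀ (n : ℕ) (Q : Measure ℝ) [IsFiniteMeasure Q],
      Integrable (fun x : ℝ => gaussNNReal ‖x‖₊ ^ n) Q := by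
    intro n Q _
    refine Integrable.of_bound (C := 1) (by fun_prop) (ae_of_all _ fun x => ?_)
    rw [norm_pow]
    refine pow_le_one₀ (norm_nonneg _) ?_
    rw [gaussNNReal_apply, Real.norm_eq_abs, Real.abs_exp, Real.exp_le_one_iff]
    nlinarith [sq_nonneg ((‖x‖₊ : NNReal) : ℝ)]
  have hm : (P.map fun x : ℝ => ‖x‖₊) = P'.map fun x : ℝ => ‖x‖₊ := by
    refine finiteMeasure_ext_of_gauss fun n => ?_
    rw [integral_map hmeas.aemeasurable (by fun_prop), integral_map hmeas.aemeasurable (by fun_prop),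
      hP, hP', integral_withDensity_eq_integral_toReal_smul₀ hm1 (by simp),
      integral_withDensity_eq_integral_toReal_smul₀ hm2 (by simp),
      ← sub_eq_zero, ← integral_sub, ← h n]
    · congr 1; ext x
      rw [gaussNNReal_apply, ← Real.exp_nat_mul, ENNReal.toReal_ofReal', ENNReal.toReal_ofReal',
        smul_eq_mul, smul_eq_mul, ← sub_mul]
      have : max (w x) 0 - max (-w x) 0 = w x := by
        rcases le_total 0 (w x) with h | h <;> simp [h]
      rw [this]
      simp
    · exact (integrable_withDensity_iff_integrable_smul₀' hm1 (by simp)).1 (hb n P)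
    · exact (integrable_withDensity_iff_integrable_smul₀' hm2 (by simp)).1 (hb n P')
  have hset := congrArg (fun Q : Measure NNReal => Q A) hm
  simp only [Measure.map_apply hmeas hA, hP, hP', withDensity_apply _ (hmeas hA)] at hset
  rw [integral_eq_lintegral_pos_part_sub_lintegral_neg_part hw.integrableOn, hset, sub_self]

lemma setIntegral_symm_eq_zero {μ : Measure ℝ} {w : ℝ → ℂ} (hw : Integrable w μ)
    (h : ∀ n : ℕ, ∫ x, w x * Complex.exp (-(n * x ^ 2)) ∂μ = 0) {A : Set NNReal}
    (hA : MeasurableSet A) : ∫ x in (fun x : ℝ => ‖x‖₊) ⁻¹' A, w x ∂μ = 0 := by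
  have he : ∀ (n : ℕ) (x : ℝ), Complex.exp (-(n * x ^ 2)) = (Real.exp (-(n * x ^ 2)) : ℂ) := by
    intro n x; push_cast; rfl
  have hi : ∀ n : ℕ, Integrable (fun x : ℝ => w x * Complex.exp (-(n * x ^ 2))) μ := by
    intro n
    refine hw.mul_bdd (c := 1) (by fun_prop) (ae_of_all _ fun x => ?_)
    rw [he, Complex.norm_real, Real.norm_eq_abs, Real.abs_exp, Real.exp_le_one_iff]
    have : (0 : ℝ) ≤ n * x ^ 2 := by positivity
    linarith
  have hre := setIntegral_symm_eq_zero_real (w := fun x => (w x).re) hw.re (fun n => by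
    have := integral_re (hi n)
    rw [h n] at this
    simpa only [RCLike.re_eq_complex_re, he, Complex.re_mul_ofReal, Complex.zero_re] using this) hA
  have him := setIntegral_symm_eq_zero_real (w := fun x => (w x).im) hw.im (fun n => by
    have := integral_im (hi n)
    rw [h n] at this
    simpa only [RCLike.im_eq_complex_im, he, Complex.im_mul_ofReal, Complex.zero_im] using this) hA
  rw [← integral_re_add_im (𝕜 := ℂ) hw.integrableOn]
  simp [hre, him]

/-- Over a set s, the integral of w(x) + w(-x) is the integral of w over s plus that over -s, which
is the sum over the union and the intersection of s and -s. Both of these are symmetric, so both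
integrals vanish. -/
lemma ae_add_neg_eq_zero {k : ℝ} (hk : -1 / 2 ≤ k) {w : ℝ → ℂ} (hw : Integrable w (muK k))
    (h : ∀ n : ℕ, ∫ x, w x * Complex.exp (-(n * x ^ 2)) ∂muK k = 0) :
    ∀ᵐ x ∂muK k, w x + w (-x) = 0 := by
  have hw' := integrable_comp_neg_muK hk hw
  refine (hw.add hw').ae_eq_zero_of_forall_setIntegral_eq_zero fun s hs _ => ?_
  simp only [Pi.add_apply]
  rw [integral_add hw.integrableOn hw'.integrableOn]
  have hns : MeasurableSet (-s) := hs.neg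
  have e1 : ∫ x in s, w (-x) ∂muK k = ∫ x in -s, w x ∂muK k := by
    rw [← integral_indicator hs, ← integral_indicator hns,
      ← integral_comp_neg_muK ((-s).indicator w)]
    congr 1; ext x
    by_cases hx : x ∈ s
    · rw [indicator_of_mem hx, indicator_of_mem (by simpa using hx)]
    · rw [indicator_of_notMem hx, indicator_of_notMem (by simpa using hx)]
  have hsymm : ∀ S : Set ℝ, MeasurableSet S → (∀ x, x ∈ S ↔ -x ∈ S) →
      ∫ x in S, w x ∂muK k = 0 := by
    intro S hS hsym
    have : S = (fun x : ℝ => ‖x‖₊) ⁻¹' ((fun y : NNReal => (y : ℝ)) ⁻¹' S) := by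
      ext x
      simp only [mem_preimage, coe_nnnorm, Real.norm_eq_abs]
      rcases abs_choice x with h | h
      · rw [h]
      · rw [h]; exact hsym x
    rw [this]
    exact setIntegral_symm_eq_zero hw h (NNReal.continuous_coe.measurable hS)
  rw [e1]
  have h2 := hsymm (s ∪ -s) (hs.union hns) fun x => by
    simp only [mem_union, Set.mem_neg, neg_neg]; tauto
  have h3 := hsymm (s ∩ -s) (hs.inter hns) fun x => by
    simp only [mem_inter_iff, Set.mem_neg, neg_neg]; tauto
  have h4 : ∫ x in s ∪ -s, w x ∂muK k + ∫ x in s ∩ -s, w x ∂muK k =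
      ∫ x in s, w x ∂muK k + ∫ x in -s, w x ∂muK k := by
    rw [← integral_indicator (hs.union hns), ← integral_indicator (hs.inter hns),
      ← integral_indicator hs, ← integral_indicator hns,
      ← integral_add (hw.indicator (hs.union hns)) (hw.indicator (hs.inter hns)),
      ← integral_add (hw.indicator hs) (hw.indicator hns)]
    congr 1; ext x
    exact congrFun (indicator_union_add_inter w s (-s)) x
  rw [← h4, h2, h3, add_zero]

/-- The even (`o = false`) and odd (`o = true`) Gaussians `e^{-t x²}` and `x e^{-t x²}`. -/
def gaussGen (o : Bool) (t x : ℝ) : ℂ := (x : ℂ) ^ o.toNat * Complex.exp (-t * x ^ 2)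

/-- A function that is orthogonal to all even and odd Gaussians vanishes. -/
lemma ae_eq_zero_of_integral_gaussGen {k : ℝ} (hk : -1 / 2 ≤ k) {u : ℝ → ℂ}
    (hi : ∀ o t, 0 < t → Integrable (fun x => u x * gaussGen o t x) (muK k))
    (h : ∀ o t, 0 < t → ∫ x, u x * gaussGen o t x ∂muK k = 0) : u =ᵐ[muK k] 0 := by
  -- Only t = 1 + n is needed, since multiplying a Gaussian with t = 1 by exp(-nx²) gives one with t
  -- = 1 + n. The even family yields u(x) + u(-x) = 0 and the odd one x(u(x) - u(-x)) = 0.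
  have key : ∀ o, ∀ᵐ x ∂muK k, u x * gaussGen o 1 x + u (-x) * gaussGen o 1 (-x) = 0 := by
    intro o
    refine ae_add_neg_eq_zero hk (w := fun x => u x * gaussGen o 1 x) (hi o 1 one_pos) fun n => ?_
    rw [← h o (1 + n) (by positivity)]
    congr 1; ext x
    rw [gaussGen, gaussGen, mul_assoc, mul_assoc, ← Complex.exp_add]
    push_cast
    ring_nf
  have hne : ∀ᵐ x ∂muK k, x ≠ 0 :=
    (ae_muK_iff hk).2 (compl_mem_ae_iff.2 (measure_singleton (0 : ℝ)))
  filter_upwards [key false, key true, hne] with x h0 h1 hx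
  simp only [gaussGen, Bool.toNat_false, Bool.toNat_true, pow_zero, pow_one, one_mul,
    Complex.ofReal_neg, neg_sq] at h0 h1
  have he : Complex.exp (-((1 : ℝ) : ℂ) * (x : ℂ) ^ 2) ≠ 0 := Complex.exp_ne_zero _
  have hx' : (x : ℂ) ≠ 0 := by exact_mod_cast hx
  have h2 : 2 * (x * Complex.exp (-((1 : ℝ) : ℂ) * (x : ℂ) ^ 2)) * u x = 0 := by
    linear_combination h1 + x * h0
  simpa [he, hx'] using h2

/-! ### The Dunkl transform on integrable functions -/

/-- The kernel `E_k(-i l, x)` of the Dunkl transform. -/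
def dunklChar (k l x : ℝ) : ℂ := dunklExp k (-Complex.I * l * x)

lemma dunklChar_comm (k l x : ℝ) : dunklChar k l x = dunklChar k x l := by
  rw [dunklChar, dunklChar]; ring_nf

lemma norm_dunklChar_le {k : ℝ} (hk : -1 / 2 ≤ k) (l x : ℝ) : ‖dunklChar k l x‖ ≤ 1 := by
  have h := norm_dunklExp_le hk (-Complex.I * l * x)
  have h0 : (-Complex.I * l * x).re = 0 := by simp
  rwa [h0, abs_zero, Real.exp_zero] at h

lemma conj_dunklChar {k : ℝ} (hk : -1 / 2 ≤ k) (l x : ℝ) :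
    conj (dunklChar k l x) = dunklExp k (Complex.I * x * l) := by
  rw [dunklChar, conj_dunklExp hk]
  congr 1
  simp only [map_mul, map_neg, Complex.conj_I, Complex.conj_ofReal]
  ring

lemma measurable_dunklChar {k : ℝ} (hk : -1 / 2 ≤ k) :
    Measurable fun p : ℝ × ℝ => dunklChar k p.1 p.2 := by
  have := measurable_dunklExp hk
  unfold dunklChar
  fun_prop

lemma measurable_dunklChar_left {k : ℝ} (hk : -1 / 2 ≤ k) (x : ℝ) :
    Measurable fun l => dunklChar k l x := by
  have := measurable_dunklExp hk
  unfold dunklChar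
  fun_prop

/-- The Dunkl transform of an integrable function. -/
def dunklF (k : ℝ) (f : ℝ → ℂ) (l : ℝ) : ℂ := ∫ x, f x * dunklChar k l x ∂muK k

/-- The inverse Dunkl transform of an integrable function. -/
def dunklFinv (k : ℝ) (f : ℝ → ℂ) (y : ℝ) : ℂ := ∫ l, f l * conj (dunklChar k l y) ∂muK k

lemma norm_dunklF_le {k : ℝ} (hk : -1 / 2 ≤ k) {f : ℝ → ℂ} (hf : Integrable f (muK k)) (l : ℝ) :
    ‖dunklF k f l‖ ≤ ∫ x, ‖f x‖ ∂muK k := by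
  refine norm_integral_le_of_norm_le hf.norm (ae_of_all _ fun x => ?_)
  rw [norm_mul]
  exact mul_le_of_le_one_right (norm_nonneg _) (norm_dunklChar_le hk l x)

lemma aestronglyMeasurable_dunklF {k : ℝ} (hk : -1 / 2 ≤ k) {f : ℝ → ℂ}
    (hf : AEStronglyMeasurable f (muK k)) (μ : Measure ℝ) :
    AEStronglyMeasurable (dunklF k f) μ := by
  have e : dunklF k f = fun l => ∫ x, hf.mk f x * dunklChar k l x ∂muK k := by
    ext l
    exact integral_congr_ae (by filter_upwards [hf.ae_eq_mk] with x hx; rw [hx])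
  rw [e]
  refine StronglyMeasurable.aestronglyMeasurable ?_
  refine StronglyMeasurable.integral_prod_right'
    (f := fun p : ℝ × ℝ => hf.mk f p.2 * dunklChar k p.1 p.2) ?_
  exact (hf.stronglyMeasurable_mk.comp_measurable measurable_snd).mul
    (measurable_dunklChar hk).stronglyMeasurable

lemma integrable_prod_dunklChar {k : ℝ} (hk : -1 / 2 ≤ k) {f g : ℝ → ℂ}
    (hf : Integrable f (muK k)) (hg : Integrable g (muK k)) :
    Integrable (fun p : ℝ × ℝ => f p.1 * g p.2 * dunklChar k p.2 p.1)
      ((muK k).prod (muK k)) := by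
  refine (hf.mul_prod hg).mul_bdd (c := 1) ?_ (ae_of_all _ fun p => norm_dunklChar_le hk _ _)
  exact ((measurable_dunklChar hk).comp measurable_swap).aestronglyMeasurable

/-- The multiplication formula: Fubini and the symmetry of the kernel in l and x. It is the source
of Plancherel on Gaussians and of the integral formula for the unitary transform. -/
lemma integral_dunklF_mul {k : ℝ} (hk : -1 / 2 ≤ k) {f g : ℝ → ℂ}
    (hf : Integrable f (muK k)) (hg : Integrable g (muK k)) :
    ∫ l, dunklF k f l * g l ∂muK k = ∫ x, f x * dunklF k g x ∂muK k := by
  have h := integral_integral_swap (f := fun x l => f x * g l * dunklChar k l x)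
    (integrable_prod_dunklChar hk hf hg)
  simp only [dunklF]
  calc _ = ∫ l, ∫ x, f x * g l * dunklChar k l x ∂muK k ∂muK k := by
        congr 1; ext l; rw [← integral_mul_const]; congr 1; ext x; ring
    _ = _ := by
        rw [← h]; congr 1; ext x; rw [← integral_const_mul]; congr 1; ext l
        rw [dunklChar_comm]; ring

lemma conj_dunklF_conj {k : ℝ} (f : ℝ → ℂ) (y : ℝ) :
    conj (dunklF k (fun x => conj (f x)) y) = dunklFinv k f y := by
  rw [dunklF, dunklFinv, ← integral_conj]
  congr 1; ext x
  rw [map_mul, Complex.conj_conj, dunklChar_comm]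

lemma dunklFinv_conj {k : ℝ} (f : ℝ → ℂ) (y : ℝ) :
    dunklFinv k (fun x => conj (f x)) y = conj (dunklF k f y) := by
  rw [← conj_dunklF_conj]; simp

lemma integral_dunklFinv_mul {k : ℝ} (hk : -1 / 2 ≤ k) {f g : ℝ → ℂ}
    (hf : Integrable f (muK k)) (hg : Integrable g (muK k)) :
    ∫ l, dunklFinv k f l * g l ∂muK k = ∫ x, f x * dunklFinv k g x ∂muK k := by
  have hf' : Integrable (fun x => conj (f x)) (muK k) := (Complex.conjLIE.integrable_comp_iff).2 hf
  have hg' : Integrable (fun x => conj (g x)) (muK k) := (Complex.conjLIE.integrable_comp_iff).2 hg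
  have h := congrArg conj (integral_dunklF_mul hk hf' hg')
  rw [← integral_conj, ← integral_conj] at h
  simpa only [map_mul, Complex.conj_conj, conj_dunklF_conj] using h

/-! ### Gaussians -/

lemma measurable_gaussGen (o : Bool) (t : ℝ) : Measurable (gaussGen o t) := by
  unfold gaussGen; fun_prop

lemma conj_gaussGen (o : Bool) (t x : ℝ) : conj (gaussGen o t x) = gaussGen o t x := by
  simp only [gaussGen, map_mul, map_pow, Complex.conj_ofReal, ← Complex.exp_conj, map_neg]

lemma integrable_gaussGen {k t : ℝ} (hk : -1 / 2 ≤ k) (ht : 0 < t) (o : Bool) :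
    Integrable (gaussGen o t) (muK k) := by
  have := integrable_mul_gauss_of_le hk ht o.toNat (c := 0) (g := fun _ => 1) (by fun_prop)
    (by simp)
  refine this.congr (ae_of_all _ fun x => ?_)
  simp only [gaussGen, one_mul]

lemma memLp_gaussGen {k t : ℝ} (hk : -1 / 2 ≤ k) (ht : 0 < t) (o : Bool) :
    MemLp (gaussGen o t) 2 (muK k) := by
  rw [memLp_two_iff_integrable_sq_norm (measurable_gaussGen o t).aestronglyMeasurable]
  have := integrable_abs_pow_mul_gauss hk (show 0 < 2 * t by positivity) (2 * o.toNat)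
  refine this.congr (ae_of_all _ fun x => ?_)
  have h1 : ‖Complex.exp (-t * x ^ 2)‖ = Real.exp (-t * x ^ 2) := by
    rw [Complex.norm_exp]; norm_cast
  simp only []
  rw [gaussGen, norm_mul, norm_pow, Complex.norm_real, Real.norm_eq_abs, h1, mul_pow,
    ← Real.exp_nat_mul, ← pow_mul, mul_comm 2]
  push_cast
  ring_nf

/-- The factor in the Dunkl transform of a Gaussian. -/
def gaussCoeff (k : ℝ) (o : Bool) (t : ℝ) : ℂ :=
  (-Complex.I / (2 * t)) ^ o.toNat * (((2 * t) ^ (-(k + 1)) : ℝ) : ℂ)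

/-- At z = -il the exponent z²/(4t) is -l²/(4t). Up to scalars the transform thus permutes the
Gaussians by the involution t ↦ 1/(4t). -/
lemma dunklF_gaussGen {k t : ℝ} (hk : -1 / 2 ≤ k) (ht : 0 < t) (o : Bool) (l : ℝ) :
    dunklF k (gaussGen o t) l = gaussCoeff k o t * gaussGen o (1 / (4 * t)) l := by
  have e : dunklF k (gaussGen o t) l = ∫ y : ℝ, dunklExp k (-Complex.I * l * y) *
      ((y : ℂ) ^ o.toNat * Complex.exp (-t * y ^ 2)) ∂muK k := by
    rw [dunklF]; congr 1; ext y; rw [mul_comm]; rfl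
  have e2 : Complex.exp ((-Complex.I * l) ^ 2 / (4 * t)) =
      Complex.exp (-((1 / (4 * t) : ℝ) : ℂ) * l ^ 2) := by
    congr 1; push_cast; rw [mul_pow, neg_sq, Complex.I_sq]; ring
  rw [e]
  cases o
  · rw [Bool.toNat_false, integral_dunklExp_gauss hk ht, gaussValue, gaussCoeff, gaussGen, e2]
    simp
  · rw [Bool.toNat_true, integral_dunklExp_id_gauss hk ht, gaussValue, gaussCoeff, gaussGen, e2]
    simp only [Bool.toNat_true, pow_one]
    ring

/-- This is Fourier inversion on the Gaussians: the parameters 2t and 2 · 1/(4t) are reciprocal, and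
the factors -i in the odd case cancel after conjugation. -/
lemma conj_gaussCoeff_mul {k t : ℝ} (ht : 0 < t) (o : Bool) :
    conj (gaussCoeff k o t) * gaussCoeff k o (1 / (4 * t)) = 1 := by
  have h1 : ((2 * t) ^ (-(k + 1)) : ℝ) * (2 * (1 / (4 * t))) ^ (-(k + 1)) = 1 := by
    rw [← Real.mul_rpow (by positivity) (by positivity),
      show 2 * t * (2 * (1 / (4 * t))) = 1 by field_simp; norm_num, Real.one_rpow]
  have h1' : ((((2 * t) ^ (-(k + 1)) : ℝ) : ℂ)) * (((2 * (1 / (4 * t))) ^ (-(k + 1)) : ℝ) : ℂ) = 1 := by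
    exact_mod_cast h1
  have ht' : (t : ℂ) ≠ 0 := by exact_mod_cast ht.ne'
  have h2 : (conj (-Complex.I / (2 * t)) * (-Complex.I / (2 * ((1 / (4 * t) : ℝ) : ℂ)))) = 1 := by
    simp only [map_div₀, map_neg, map_mul, Complex.conj_I, Complex.conj_ofReal, map_ofNat, neg_neg]
    push_cast
    field_simp
    rw [Complex.I_sq]; ring
  rw [gaussCoeff, gaussCoeff, map_mul, map_pow, Complex.conj_ofReal,
    mul_mul_mul_comm, ← mul_pow, h1', h2, one_pow, one_mul]

/-- The test by which the properties of the transform below are proved. Asking for integrability of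
the products, rather than square integrability, also admits bounded functions such as transforms of
L¹ functions. -/
lemma ae_eq_of_integral_gaussGen {k : ℝ} (hk : -1 / 2 ≤ k) {u v : ℝ → ℂ}
    (hu : ∀ o t, 0 < t → Integrable (fun x => u x * gaussGen o t x) (muK k))
    (hv : ∀ o t, 0 < t → Integrable (fun x => v x * gaussGen o t x) (muK k))
    (h : ∀ o t, 0 < t → ∫ x, u x * gaussGen o t x ∂muK k = ∫ x, v x * gaussGen o t x ∂muK k) :
    u =ᵐ[muK k] v := by
  have e : ∀ o t, (fun x => (u - v) x * gaussGen o t x) =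
      (fun x => u x * gaussGen o t x) - fun x => v x * gaussGen o t x := by
    intro o t; ext x; simp [sub_mul]
  rw [← sub_ae_eq_zero]
  refine ae_eq_zero_of_integral_gaussGen hk (fun o t ht => ?_) fun o t ht => ?_
  · rw [e]; exact (hu o t ht).sub (hv o t ht)
  · rw [e, integral_sub' (hu o t ht) (hv o t ht), h o t ht, sub_self]

/-! ### The unitary Dunkl transform on `L²` -/

/-- The Hilbert space `L²_k`. -/
abbrev DunklL2 (k : ℝ) := Lp ℂ 2 (muK k)

lemma inner_toLp {μ : Measure ℝ} {f g : ℝ → ℂ} (hf : MemLp f 2 μ) (hg : MemLp g 2 μ) :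
    inner ℂ (hf.toLp f) (hg.toLp g) = ∫ x, g x * conj (f x) ∂μ := by
  rw [L2.inner_def]
  refine integral_congr_ae ?_
  filter_upwards [hf.coeFn_toLp, hg.coeFn_toLp] with x h1 h2
  rw [h1, h2, RCLike.inner_apply]

lemma inner_toLp_left {μ : Measure ℝ} {f : ℝ → ℂ} (hf : MemLp f 2 μ) (g : Lp ℂ 2 μ) :
    inner ℂ (hf.toLp f) g = ∫ x, g x * conj (f x) ∂μ := by
  rw [L2.inner_def]
  refine integral_congr_ae ?_
  filter_upwards [hf.coeFn_toLp] with x h1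
  rw [h1, RCLike.inner_apply]

/-- The index set of the Gaussians. -/
abbrev GaussIndex := Bool × {t : ℝ // 0 < t}

lemma GaussIndex.pos (i : GaussIndex) : 0 < (i.2 : ℝ) := i.2.2

/-- The index of the Gaussian that appears in the Dunkl transform of the one with index `i`. -/
def GaussIndex.dual (i : GaussIndex) : GaussIndex :=
  (i.1, ⟨1 / (4 * i.2.1), by have := i.2.2; positivity⟩)

/-- The Gaussians as elements of `L²_k`. -/
def gaussVec {k : ℝ} (hk : -1 / 2 ≤ k) (i : GaussIndex) : DunklL2 k :=
  (memLp_gaussGen hk i.pos i.1).toLp (gaussGen i.1 i.2)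

/-- The Dunkl transforms of the Gaussians as elements of `L²_k`. -/
def gaussVecF {k : ℝ} (hk : -1 / 2 ≤ k) (i : GaussIndex) : DunklL2 k :=
  gaussCoeff k i.1 i.2 • gaussVec hk i.dual

/-- The multiplication formula moves the transform of one Gaussian onto the conjugate transform of
the other, and inversion on Gaussians undoes it. -/
lemma integral_conj_dunklF_gaussGen {k : ℝ} (hk : -1 / 2 ≤ k) (i j : GaussIndex) :
    ∫ x, dunklF k (gaussGen j.1 j.2) x * conj (dunklF k (gaussGen i.1 i.2) x) ∂muK k =
      ∫ x, gaussGen j.1 j.2 x * conj (gaussGen i.1 i.2 x) ∂muK k := by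
  have hi := i.pos
  have hi' : 0 < 1 / (4 * (i.2 : ℝ)) := by positivity
  have e : (fun x => conj (dunklF k (gaussGen i.1 i.2) x)) =
      fun x => conj (gaussCoeff k i.1 i.2) * gaussGen i.1 (1 / (4 * i.2)) x := by
    ext x; rw [dunklF_gaussGen hk hi, map_mul, conj_gaussGen]
  have hint : Integrable (fun x => conj (dunklF k (gaussGen i.1 i.2) x)) (muK k) := by
    rw [e]; exact (integrable_gaussGen hk hi' _).const_mul _
  rw [integral_dunklF_mul hk (integrable_gaussGen hk j.pos _) hint, e]
  congr 1; ext x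
  congr 1
  have e2 : dunklF k (fun x => conj (gaussCoeff k i.1 i.2) * gaussGen i.1 (1 / (4 * i.2)) x) x =
      conj (gaussCoeff k i.1 i.2) * dunklF k (gaussGen i.1 (1 / (4 * i.2))) x := by
    rw [dunklF, dunklF, ← integral_const_mul]; congr 1; ext y; ring
  rw [e2, dunklF_gaussGen hk hi', ← mul_assoc, conj_gaussCoeff_mul hi, one_mul, conj_gaussGen]
  congr 1; field_simp

lemma memLp_dunklF_gaussGen {k : ℝ} (hk : -1 / 2 ≤ k) (i : GaussIndex) :
    MemLp (dunklF k (gaussGen i.1 i.2)) 2 (muK k) := by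
  have : dunklF k (gaussGen i.1 i.2) =
      gaussCoeff k i.1 i.2 • gaussGen i.1 (1 / (4 * i.2)) := by
    ext x; exact dunklF_gaussGen hk i.pos _ _
  rw [this]
  have hi := i.pos
  exact (memLp_gaussGen hk (by positivity) _).const_smul _

lemma gaussVecF_eq {k : ℝ} (hk : -1 / 2 ≤ k) (i : GaussIndex) :
    gaussVecF hk i = (memLp_dunklF_gaussGen hk i).toLp _ := by
  rw [gaussVecF, gaussVec, ← MemLp.toLp_const_smul, MemLp.toLp_eq_toLp_iff]
  exact ae_of_all _ fun x => (dunklF_gaussGen hk i.pos _ _).symm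

lemma inner_gaussVecF {k : ℝ} (hk : -1 / 2 ≤ k) (i j : GaussIndex) :
    inner ℂ (gaussVecF hk i) (gaussVecF hk j) = inner ℂ (gaussVec hk i) (gaussVec hk j) := by
  rw [gaussVecF_eq, gaussVecF_eq, inner_toLp, gaussVec, gaussVec, inner_toLp,
    integral_conj_dunklF_gaussGen hk]

lemma integrable_mul_of_memLp {μ : Measure ℝ} {f g : ℝ → ℂ} (hf : MemLp f 2 μ)
    (hg : MemLp g 2 μ) : Integrable (fun x => f x * g x) μ :=
  hf.integrable_mul hg

lemma eq_zero_of_inner_gaussVec {k : ℝ} (hk : -1 / 2 ≤ k) {w : DunklL2 k}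
    (h : ∀ i, inner ℂ (gaussVec hk i) w = 0) : w = 0 := by
  rw [Lp.eq_zero_iff_ae_eq_zero]
  refine ae_eq_zero_of_integral_gaussGen hk
    (fun o t ht => integrable_mul_of_memLp (Lp.memLp w) (memLp_gaussGen hk ht o)) fun o t ht => ?_
  have := h (o, ⟨t, ht⟩)
  rw [gaussVec, inner_toLp_left] at this
  simpa only [conj_gaussGen] using this

/-- Linear combinations of Gaussians. -/
def gaussComb {k : ℝ} (hk : -1 / 2 ≤ k) : (GaussIndex →₀ ℂ) →ₗ[ℂ] DunklL2 k :=
  Finsupp.linearCombination ℂ (gaussVec hk)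

/-- Linear combinations of Dunkl transforms of Gaussians. -/
def gaussCombF {k : ℝ} (hk : -1 / 2 ≤ k) : (GaussIndex →₀ ℂ) →ₗ[ℂ] DunklL2 k :=
  Finsupp.linearCombination ℂ (gaussVecF hk)

lemma gaussComb_single {k : ℝ} (hk : -1 / 2 ≤ k) (i : GaussIndex) :
    gaussComb hk (Finsupp.single i 1) = gaussVec hk i := by simp [gaussComb]

/-- Both families have the same Gram matrix. This makes the map from combinations of Gaussians to
combinations of their transforms well defined and isometric. -/
lemma norm_gaussCombF {k : ℝ} (hk : -1 / 2 ≤ k) (c : GaussIndex →₀ ℂ) :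
    ‖gaussCombF hk c‖ = ‖gaussComb hk c‖ := by
  rw [@norm_eq_sqrt_re_inner ℂ, @norm_eq_sqrt_re_inner ℂ _ _ _ _ (gaussComb hk c)]
  congr 2
  simp only [gaussCombF, gaussComb, Finsupp.linearCombination_apply, Finsupp.sum,
    sum_inner, inner_sum, inner_smul_left, inner_smul_right, inner_gaussVecF]

lemma denseRange_gaussComb {k : ℝ} (hk : -1 / 2 ≤ k) : DenseRange (gaussComb hk) := by
  have h1 : (LinearMap.range (gaussComb hk)).topologicalClosure = ⊤ := by
    rw [Submodule.topologicalClosure_eq_top_iff, Submodule.eq_bot_iff]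
    intro w hw
    refine eq_zero_of_inner_gaussVec hk fun i => ?_
    exact (Submodule.mem_orthogonal _ _).1 hw _ ⟨Finsupp.single i 1, gaussComb_single hk i⟩
  have h2 := Submodule.dense_iff_topologicalClosure_eq_top.2 h1
  rwa [LinearMap.coe_range] at h2

/-- The Dunkl transform on `L²_k` as a continuous linear map. -/
def dunklCLM {k : ℝ} (hk : -1 / 2 ≤ k) : DunklL2 k →L[ℂ] DunklL2 k :=
  (gaussCombF hk).extendOfNorm (gaussComb hk)

lemma dunklCLM_gaussComb {k : ℝ} (hk : -1 / 2 ≤ k) (c : GaussIndex →₀ ℂ) :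
    dunklCLM hk (gaussComb hk c) = gaussCombF hk c :=
  LinearMap.extendOfNorm_eq (denseRange_gaussComb hk)
    ⟨1, fun c => by rw [one_mul, norm_gaussCombF]⟩ c

lemma norm_dunklCLM {k : ℝ} (hk : -1 / 2 ≤ k) (f : DunklL2 k) : ‖dunklCLM hk f‖ = ‖f‖ := by
  refine (denseRange_gaussComb hk).induction_on f
    (isClosed_eq (by fun_prop) (by fun_prop)) fun c => ?_
  rw [dunklCLM_gaussComb, norm_gaussCombF]

lemma dunklCLM_gaussVec {k : ℝ} (hk : -1 / 2 ≤ k) (i : GaussIndex) :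
    dunklCLM hk (gaussVec hk i) = gaussVecF hk i := by
  rw [← gaussComb_single, dunklCLM_gaussComb]; simp [gaussCombF]

/-- The Dunkl transform on `L²_k` as a linear isometry. -/
def dunklIsometry {k : ℝ} (hk : -1 / 2 ≤ k) : DunklL2 k →ₗᵢ[ℂ] DunklL2 k :=
  ⟨dunklCLM hk, norm_dunklCLM hk⟩

/-- The preimage of a Gaussian under the Dunkl transform. -/
def gaussVecInv {k : ℝ} (hk : -1 / 2 ≤ k) (i : GaussIndex) : DunklL2 k :=
  conj (gaussCoeff k i.1 i.2) • gaussVec hk i.dual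

lemma dunklCLM_gaussVecInv {k : ℝ} (hk : -1 / 2 ≤ k) (i : GaussIndex) :
    dunklCLM hk (gaussVecInv hk i) = gaussVec hk i := by
  have hd : i.dual.dual = i := by
    have hi := i.pos
    refine Prod.ext rfl (Subtype.ext ?_)
    simp only [GaussIndex.dual]
    field_simp
  rw [gaussVecInv, map_smul, dunklCLM_gaussVec, gaussVecF, hd, smul_smul]
  have := conj_gaussCoeff_mul (k := k) i.pos i.1
  rw [show gaussCoeff k i.dual.1 i.dual.2 = gaussCoeff k i.1 (1 / (4 * i.2)) from rfl, this,
    one_smul]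

/-- The range of an isometry of a complete space is closed, and it contains every Gaussian by
inversion on Gaussians. -/
lemma dunklIsometry_surjective {k : ℝ} (hk : -1 / 2 ≤ k) :
    Function.Surjective (dunklIsometry hk) := by
  have hcl : IsClosed (range (dunklIsometry hk)) :=
    (dunklIsometry hk).isometry.isClosedEmbedding.isClosed_range
  have hr : ∀ f, f ∈ range (dunklIsometry hk) := by
    intro f
    refine (denseRange_gaussComb hk).induction_on f hcl fun c => ?_
    have h1 : LinearMap.range (gaussComb hk) ≤ LinearMap.range (dunklCLM hk).toLinearMap := by
      rw [gaussComb, Finsupp.range_linearCombination, Submodule.span_le]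
      rintro _ ⟨i, rfl⟩
      exact ⟨gaussVecInv hk i, dunklCLM_gaussVecInv hk i⟩
    obtain ⟨g, hg⟩ := h1 ⟨c, rfl⟩
    exact ⟨g, hg⟩
  exact hr

/-- The Dunkl transform as a unitary operator on `L²_k`. -/
def dunklU {k : ℝ} (hk : -1 / 2 ≤ k) : DunklL2 k ≃ₗᵢ[ℂ] DunklL2 k :=
  LinearIsometryEquiv.ofSurjective (dunklIsometry hk) (dunklIsometry_surjective hk)

lemma dunklU_gaussVec {k : ℝ} (hk : -1 / 2 ≤ k) (i : GaussIndex) :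
    dunklU hk (gaussVec hk i) = gaussVecF hk i := dunklCLM_gaussVec hk i

lemma dunklU_gaussVecInv {k : ℝ} (hk : -1 / 2 ≤ k) (i : GaussIndex) :
    dunklU hk (gaussVecInv hk i) = gaussVec hk i := dunklCLM_gaussVecInv hk i

lemma gaussVecInv_eq {k : ℝ} (hk : -1 / 2 ≤ k) (i : GaussIndex) :
    gaussVecInv hk i = (memLp_dunklF_gaussGen hk i).star.toLp _ := by
  rw [gaussVecInv, gaussVec, ← MemLp.toLp_const_smul, MemLp.toLp_eq_toLp_iff]
  refine ae_of_all _ fun x => ?_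
  simp only [Pi.smul_apply, smul_eq_mul, Pi.star_apply]
  rw [dunklF_gaussGen hk i.pos, star_mul', RCLike.star_def, conj_gaussGen]
  rfl

/-- Unitarity moves the operator onto the Gaussian, where it is explicit. Gaussians are real, so the
inner product becomes a bilinear pairing. -/
lemma integral_dunklU_mul_gaussGen {k : ℝ} (hk : -1 / 2 ≤ k) (f : DunklL2 k) (i : GaussIndex) :
    ∫ x, dunklU hk f x * gaussGen i.1 i.2 x ∂muK k =
      ∫ x, f x * dunklF k (gaussGen i.1 i.2) x ∂muK k := by
  have h : inner ℂ (gaussVec hk i) (dunklU hk f) = inner ℂ (gaussVecInv hk i) f := by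
    rw [← dunklU_gaussVecInv, LinearIsometryEquiv.inner_map_map]
  rw [gaussVec, inner_toLp_left, gaussVecInv_eq, inner_toLp_left] at h
  simpa [conj_gaussGen] using h

lemma integral_dunklU_symm_mul_gaussGen {k : ℝ} (hk : -1 / 2 ≤ k) (f : DunklL2 k)
    (i : GaussIndex) :
    ∫ x, (dunklU hk).symm f x * gaussGen i.1 i.2 x ∂muK k =
      ∫ x, f x * dunklFinv k (gaussGen i.1 i.2) x ∂muK k := by
  have h : inner ℂ (gaussVec hk i) ((dunklU hk).symm f) = inner ℂ (gaussVecF hk i) f := by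
    rw [← dunklU_gaussVec, ← LinearIsometryEquiv.inner_map_map (dunklU hk),
      LinearIsometryEquiv.apply_symm_apply]
  rw [gaussVec, inner_toLp_left, gaussVecF_eq, inner_toLp_left] at h
  simpa only [conj_gaussGen, ← dunklFinv_conj] using h

lemma integrable_bdd_mul_gaussGen {k : ℝ} (hk : -1 / 2 ≤ k) {g : ℝ → ℂ} {C : ℝ}
    (hg : AEStronglyMeasurable g (muK k)) (hC : ∀ x, ‖g x‖ ≤ C) (o : Bool) {t : ℝ} (ht : 0 < t) :
    Integrable (fun x => g x * gaussGen o t x) (muK k) :=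
  (integrable_gaussGen hk ht o).bdd_mul (c := C) hg (ae_of_all _ hC)

/-- On integrable functions in `L²_k`, the unitary Dunkl transform is given by the integral. -/
lemma dunklU_toLp {k : ℝ} (hk : -1 / 2 ≤ k) {f : ℝ → ℂ} (hf1 : Integrable f (muK k))
    (hf2 : MemLp f 2 (muK k)) : dunklU hk (hf2.toLp f) =ᵐ[muK k] dunklF k f := by
  have hi1 : ∀ o t, 0 < t → Integrable (fun x => dunklU hk (hf2.toLp f) x * gaussGen o t x)
      (muK k) := fun o t ht => integrable_mul_of_memLp (Lp.memLp _) (memLp_gaussGen hk ht o)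
  have hi2 : ∀ o t, 0 < t → Integrable (fun x => dunklF k f x * gaussGen o t x) (muK k) :=
    fun o t ht => integrable_bdd_mul_gaussGen hk (aestronglyMeasurable_dunklF hk hf1.1 _)
      (norm_dunklF_le hk hf1) o ht
  refine ae_eq_of_integral_gaussGen hk hi1 hi2 fun o t ht => ?_
  rw [integral_dunklF_mul hk hf1 (integrable_gaussGen hk ht o),
    integral_dunklU_mul_gaussGen hk _ (o, ⟨t, ht⟩)]
  exact integral_congr_ae (by filter_upwards [hf2.coeFn_toLp] with x hx; rw [hx])

lemma norm_dunklFinv_le {k : ℝ} (hk : -1 / 2 ≤ k) {f : ℝ → ℂ} (hf : Integrable f (muK k)) (l : ℝ) :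
    ‖dunklFinv k f l‖ ≤ ∫ x, ‖f x‖ ∂muK k := by
  have hf' : Integrable (fun x => conj (f x)) (muK k) := (Complex.conjLIE.integrable_comp_iff).2 hf
  rw [← conj_dunklF_conj, RCLike.norm_conj]
  simpa using norm_dunklF_le hk hf' l

lemma aestronglyMeasurable_dunklFinv {k : ℝ} (hk : -1 / 2 ≤ k) {f : ℝ → ℂ}
    (hf : AEStronglyMeasurable f (muK k)) (μ : Measure ℝ) :
    AEStronglyMeasurable (dunklFinv k f) μ := by
  have h := Complex.continuous_conj.comp_aestronglyMeasurable (aestronglyMeasurable_dunklF hk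
    (Complex.continuous_conj.comp_aestronglyMeasurable hf) μ)
  refine h.congr (ae_of_all _ fun x => ?_)
  exact conj_dunklF_conj f x

/-- On integrable functions in `L²_k`, the inverse of the unitary Dunkl transform is given by the
integral. -/
lemma dunklU_symm_toLp {k : ℝ} (hk : -1 / 2 ≤ k) {f : ℝ → ℂ} (hf1 : Integrable f (muK k))
    (hf2 : MemLp f 2 (muK k)) : (dunklU hk).symm (hf2.toLp f) =ᵐ[muK k] dunklFinv k f := by
  have hi1 : ∀ o t, 0 < t → Integrable (fun x => (dunklU hk).symm (hf2.toLp f) x * gaussGen o t x)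
      (muK k) := fun o t ht => integrable_mul_of_memLp (Lp.memLp _) (memLp_gaussGen hk ht o)
  have hi2 : ∀ o t, 0 < t → Integrable (fun x => dunklFinv k f x * gaussGen o t x) (muK k) :=
    fun o t ht => integrable_bdd_mul_gaussGen hk (aestronglyMeasurable_dunklFinv hk hf1.1 _)
      (norm_dunklFinv_le hk hf1) o ht
  refine ae_eq_of_integral_gaussGen hk hi1 hi2 fun o t ht => ?_
  rw [integral_dunklFinv_mul hk hf1 (integrable_gaussGen hk ht o),
    integral_dunklU_symm_mul_gaussGen hk _ (o, ⟨t, ht⟩)]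
  exact integral_congr_ae (by filter_upwards [hf2.coeFn_toLp] with x hx; rw [hx])

/-! ### The kernel of the Dunkl translation -/

/-- The positive symmetric part of the kernel `dunklW`. -/
def dunklP (k x y z : ℝ) : ℝ :=
  if |(|x| - |y|)| ≤ |z| ∧ |z| ≤ |x| + |y| then
    Real.Gamma (k + 1) ^ 2 / ((2 : ℝ) ^ (k - 1) * √Real.pi * Real.Gamma (k + 1 / 2)) *
      ((((|x| + |y|) ^ 2 - z ^ 2) * (z ^ 2 - (|x| - |y|) ^ 2)) ^ (k - 1 / 2) /
        |x * y * z| ^ (2 * k))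
  else 0

/-- The signed factor of the kernel `dunklW`. -/
def dunklSign (x y z : ℝ) : ℝ := 1 - sigmaQ x y z + sigmaQ z x y + sigmaQ z y x

lemma dunklW_eq (k x y z : ℝ) : dunklW k x y z = dunklSign x y z * dunklP k x y z := by
  rw [dunklW, dunklP, dunklSign]
  split_ifs
  · ring
  · simp

/-- The first factor is even in z, and in the second only (x + y)/z is odd. Averaging over z and -z
therefore leaves 1 - σ against an even function, and (x + y)(1 - σ)/z against an odd one. -/
lemma dunklSign_eq {x y z : ℝ} (hx : x ≠ 0) (hy : y ≠ 0) (hz : z ≠ 0) :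
    dunklSign x y z = (1 - sigmaQ x y z) * (1 + (x + y) / z) := by
  simp only [dunklSign, sigmaQ]; field_simp; ring

lemma dunklSign_symm {x y z : ℝ} (hx : x ≠ 0) (hy : y ≠ 0) (hz : z ≠ 0) :
    dunklSign (-x) z y = dunklSign x y z := by
  simp only [dunklSign, sigmaQ]; field_simp; ring

/-- Both conditions say that |x|, |y|, |z| are the sides of a possibly degenerate triangle. The
product in `dunklP` is, by Heron, sixteen times the squared area, which makes the whole kernel
symmetric. -/
lemma dunklP_support_swap {x y z : ℝ} :
    (|(|x| - |z|)| ≤ |y| ∧ |y| ≤ |x| + |z|) ↔ (|(|x| - |y|)| ≤ |z| ∧ |z| ≤ |x| + |y|) := by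
  rw [abs_le (a := |x| - |z|), abs_le (a := |x| - |y|)]
  constructor <;> rintro ⟨⟨h1, h2⟩, h3⟩ <;> refine ⟨⟨?_, ?_⟩, ?_⟩ <;> linarith

lemma dunklP_symm (k x y z : ℝ) : dunklP k x z y = dunklP k x y z := by
  simp only [dunklP, dunklP_support_swap (x := x) (y := y) (z := z)]
  congr 3
  · congr 1
    rw [← sq_abs y, ← sq_abs z]; ring
  · congr 2; ring

lemma dunklP_neg_left (k x y z : ℝ) : dunklP k (-x) y z = dunklP k x y z := by
  simp [dunklP]

lemma dunklP_neg_right (k x y z : ℝ) : dunklP k x y (-z) = dunklP k x y z := by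
  simp [dunklP]

lemma dunklP_comm (k x y z : ℝ) : dunklP k y x z = dunklP k x y z := by
  rw [dunklP, dunklP, abs_sub_comm, add_comm |y|, mul_comm y x, sub_sq_comm]

/-- The reason why translation by -x is the transpose of translation by x. -/
lemma dunklW_symm (k : ℝ) {x y z : ℝ} (hx : x ≠ 0) (hy : y ≠ 0) (hz : z ≠ 0) :
    dunklW k (-x) z y = dunklW k x y z := by
  rw [dunklW_eq, dunklW_eq, dunklSign_symm hx hy hz, dunklP_neg_left, dunklP_symm]

lemma dunklW_comm (k x y z : ℝ) : dunklW k y x z = dunklW k x y z := by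
  rw [dunklW_eq, dunklW_eq, dunklP_comm]
  congr 1
  simp only [dunklSign, sigmaQ]; ring

lemma dunklP_nonneg {k : ℝ} (hk : -1 / 2 < k) (x y z : ℝ) : 0 ≤ dunklP k x y z := by
  unfold dunklP
  split_ifs with h
  · have h2 : 0 < Real.Gamma (k + 1 / 2) := Real.Gamma_pos_of_pos (by linarith)
    have h3 : 0 ≤ (|x| + |y|) ^ 2 - z ^ 2 := by
      rw [← sq_abs z]; nlinarith [abs_nonneg z, h.2, abs_nonneg x, abs_nonneg y]
    have h4 : 0 ≤ z ^ 2 - (|x| - |y|) ^ 2 := by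
      rw [← sq_abs z, ← sq_abs (|x| - |y|)]
      nlinarith [abs_nonneg z, h.1, abs_nonneg (|x| - |y|)]
    positivity
  · exact le_rfl

/-- By the law of cosines σ is, up to sign, the cosine of the angle opposite |z|. -/
lemma abs_one_sub_sigmaQ_le {x y z : ℝ} (hx : x ≠ 0) (hy : y ≠ 0)
    (h : |(|x| - |y|)| ≤ |z| ∧ |z| ≤ |x| + |y|) : |1 - sigmaQ x y z| ≤ 2 := by
  have h3 : z ^ 2 ≤ (|x| + |y|) ^ 2 := by
    rw [← sq_abs z]; exact pow_le_pow_left₀ (abs_nonneg _) h.2 2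
  have h4 : (|x| - |y|) ^ 2 ≤ z ^ 2 := by
    rw [← sq_abs z, ← sq_abs (|x| - |y|)]; exact pow_le_pow_left₀ (abs_nonneg _) h.1 2
  have hxy : 0 < |2 * x * y| := by positivity
  have h5 : |sigmaQ x y z| ≤ 1 := by
    rw [sigmaQ, abs_div, div_le_one hxy, abs_le, abs_mul, abs_mul, abs_two]
    have e1 := sq_abs x
    have e2 := sq_abs y
    constructor <;> nlinarith
  rw [abs_le] at h5 ⊢
  constructor <;> linarith [h5.1, h5.2]

/-- In the factored form only (x + y)/z could be large. If x and y have opposite signs then |x + y|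
= ||x| - |y|| ≤ |z|. If they have the same sign, 1 - σ = (z² - (x - y)²)/(2xy) is small enough to
compensate, and the product is at most 4. With |1 - σ| ≤ 2 this adds up to 6. -/
lemma abs_dunklSign_le {x y z : ℝ} (hx : x ≠ 0) (hy : y ≠ 0) (hz : z ≠ 0)
    (h : |(|x| - |y|)| ≤ |z| ∧ |z| ≤ |x| + |y|) : |dunklSign x y z| ≤ 6 := by
  have hs := abs_one_sub_sigmaQ_le hx hy h
  rw [dunklSign_eq hx hy hz, mul_add, mul_one]
  have hx' : 0 < |x| := abs_pos.2 hx
  have hy' : 0 < |y| := abs_pos.2 hy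
  have hz' : 0 < |z| := abs_pos.2 hz
  suffices hq : |(1 - sigmaQ x y z) * ((x + y) / z)| ≤ 4 by
    calc _ ≤ |1 - sigmaQ x y z| + |(1 - sigmaQ x y z) * ((x + y) / z)| := abs_add_le _ _
      _ ≤ 6 := by linarith
  rcases lt_or_gt_of_ne (mul_ne_zero hx hy) with hxy | hxy
  · have h1 : |x + y| ≤ |z| := by
      refine le_trans (le_of_eq ?_) h.1
      rcases mul_neg_iff.1 hxy with ⟨ha, hb⟩ | ⟨ha, hb⟩
      · rw [abs_of_pos ha, abs_of_neg hb, sub_neg_eq_add]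
      · rw [abs_of_neg ha, abs_of_pos hb, ← abs_neg]; congr 1; ring
    rw [abs_mul, abs_div]
    have : |x + y| / |z| ≤ 1 := (div_le_one hz').2 h1
    nlinarith [abs_nonneg (1 - sigmaQ x y z), div_nonneg (abs_nonneg (x + y)) hz'.le]
  · have e1 : 1 - sigmaQ x y z = (|z| - |(|x| - |y|)|) * (|z| + |(|x| - |y|)|) / (2 * (|x| * |y|)) := by
      rw [← abs_mul x y, abs_of_pos hxy, sigmaQ]
      have : (|z| - |(|x| - |y|)|) * (|z| + |(|x| - |y|)|) = z ^ 2 - (x - y) ^ 2 := by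
        have e3 := sq_abs z
        have e4 := sq_abs (|x| - |y|)
        have e5 := sq_abs x
        have e6 := sq_abs y
        have e7 : |x| * |y| = x * y := by rw [← abs_mul, abs_of_pos hxy]
        linear_combination e3 - e4 - e5 - e6 + 2 * e7
      rw [this]
      field_simp
      ring
    have e2 : |x + y| ≤ |x| + |y| := abs_add_le x y
    have h0 : 0 ≤ |z| - |(|x| - |y|)| := by linarith [h.1]
    rw [e1, abs_mul, abs_div, abs_div, abs_mul, abs_of_nonneg h0,
      abs_of_nonneg (show 0 ≤ |z| + |(|x| - |y|)| by positivity), abs_of_pos (show 0 < 2 * (|x| * |y|) by positivity), div_mul_div_comm, div_le_iff₀ (by positivity)]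
    have h2 : (|z| - |(|x| - |y|)|) * (|x| + |y|) ≤ 4 * (|x| * |y|) := by
      rcases le_total |x| |y| with hle | hle
      · have : |z| - |(|x| - |y|)| ≤ 2 * |x| := by
          rw [abs_of_nonpos (show |x| - |y| ≤ 0 by linarith)]; linarith [h.2]
        nlinarith
      · have : |z| - |(|x| - |y|)| ≤ 2 * |y| := by
          rw [abs_of_nonneg (show 0 ≤ |x| - |y| by linarith)]; linarith [h.2]
        nlinarith
    have h3 : |z| + |(|x| - |y|)| ≤ 2 * |z| := by linarith [h.1]
    calc (|z| - |(|x| - |y|)|) * (|z| + |(|x| - |y|)|) * |x + y|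
        ≤ (|z| - |(|x| - |y|)|) * (2 * |z|) * (|x| + |y|) := by gcongr
      _ = 2 * |z| * ((|z| - |(|x| - |y|)|) * (|x| + |y|)) := by ring
      _ ≤ 2 * |z| * (4 * (|x| * |y|)) := by gcongr
      _ = _ := by ring

lemma abs_dunklW_le {k : ℝ} (hk : -1 / 2 < k) {x y z : ℝ} (hx : x ≠ 0) (hy : y ≠ 0)
    (hz : z ≠ 0) : |dunklW k x y z| ≤ 6 * dunklP k x y z := by
  rw [dunklW_eq, abs_mul, abs_of_nonneg (dunklP_nonneg hk x y z)]
  by_cases h : |(|x| - |y|)| ≤ |z| ∧ |z| ≤ |x| + |y|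
  · exact mul_le_mul_of_nonneg_right (abs_dunklSign_le hx hy hz h) (dunklP_nonneg hk x y z)
  · rw [dunklP, if_neg h]; simp

lemma measurable_dunklP (k : ℝ) : Measurable fun p : ℝ × ℝ × ℝ => dunklP k p.1 p.2.1 p.2.2 := by
  unfold dunklP
  refine Measurable.ite ?_ (by fun_prop) (by fun_prop)
  have h1 : MeasurableSet {p : ℝ × ℝ × ℝ | |(|p.1| - |p.2.1|)| ≤ |p.2.2|} :=
    measurableSet_le (by fun_prop) (by fun_prop)
  have h2 : MeasurableSet {p : ℝ × ℝ × ℝ | |p.2.2| ≤ |p.1| + |p.2.1|} :=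
    measurableSet_le (by fun_prop) (by fun_prop)
  exact h1.inter h2

lemma measurable_dunklSign :
    Measurable fun p : ℝ × ℝ × ℝ => dunklSign p.1 p.2.1 p.2.2 := by
  unfold dunklSign sigmaQ; fun_prop

lemma measurable_dunklW (k : ℝ) : Measurable fun p : ℝ × ℝ × ℝ => dunklW k p.1 p.2.1 p.2.2 := by
  simp only [dunklW_eq]
  exact measurable_dunklSign.mul (measurable_dunklP k)

lemma ae_ne_zero_muK {k : ℝ} : ∀ᵐ x ∂muK k, x ≠ 0 :=
  (muK_absolutelyContinuous k).ae_le (compl_mem_ae_iff.2 (measure_singleton (0 : ℝ)))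

lemma integral_of_even {f : ℝ → ℂ} (hf : ∀ x, f (-x) = f x) :
    ∫ x, f x = 2 * ∫ x in Ioi (0 : ℝ), f x := by
  have e : ∫ x in Iic (0 : ℝ), f x = ∫ x in Ioi (0 : ℝ), f x := by
    have := integral_comp_neg_Iic 0 f
    simpa only [hf, neg_zero] using this
  by_cases hi : Integrable f
  · rw [← intervalIntegral.integral_Iic_add_Ioi (b := 0) hi.integrableOn hi.integrableOn, e, two_mul]
  -- Without integrability both sides are 0 by convention: integrability on the half-line would give
  -- it on the whole line by evenness.
  · rw [integral_undef hi, integral_undef, mul_zero]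
    intro h
    have h' : IntegrableOn f (Iic 0) := by
      have h2 := (integrableOn_Ici_iff_integrableOn_Ioi (b := (0 : ℝ))).2 h
      have := (Measure.measurePreserving_neg (volume : Measure ℝ)).integrableOn_comp_preimage
        (MeasurableEquiv.neg ℝ).measurableEmbedding (f := f) (s := Ici 0)
      have h3 := this.2 h2
      simpa [Function.comp_def, hf] using h3
    have hu := h'.union h
    rw [Iic_union_Ioi, integrableOn_univ] at hu
    exact hi hu

/-- The substitution `z² = x² + y² + 2 x y s`. -/
lemma integral_sq_mul_dunklP {k : ℝ} (hk : -1 / 2 < k) {x y : ℝ} (hx : x ≠ 0) (hy : y ≠ 0)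
    (H : ℝ → ℂ) :
    ∫ z, H (z ^ 2) * (dunklP k x y z : ℂ) ∂muK k =
      ∫ s, H (x ^ 2 + y ^ 2 + 2 * x * y * s) * (gegenbauerDensity k s : ℂ) := by
  have hx' : 0 < |x| := abs_pos.2 hx
  have hy' : 0 < |y| := abs_pos.2 hy
  have hG1 : 0 < Real.Gamma (k + 1) := Real.Gamma_pos_of_pos (by linarith)
  have hG2 : 0 < Real.Gamma (k + 1 / 2) := Real.Gamma_pos_of_pos (by linarith)
  set c : ℝ := Real.Gamma (k + 1) / ((2 : ℝ) ^ (2 * k) * √Real.pi * Real.Gamma (k + 1 / 2)) with hc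
  -- The density, in the variable w = z², of the image of the kernel measure under squaring. The
  -- powers of |z| from the kernel and from the measure leave only the Jacobian.
  set q : ℝ → ℝ := fun w => if (|x| - |y|) ^ 2 ≤ w ∧ w ≤ (|x| + |y|) ^ 2 then
    c * ((((|x| + |y|) ^ 2 - w) * (w - (|x| - |y|) ^ 2)) ^ (k - 1 / 2) / (|x| * |y|) ^ (2 * k))
    else 0 with hq
  have hpos : ∀ z ∈ Ioi (0 : ℝ), 2 * (muDensity k z * dunklP k x y z) = 2 * z * q (z ^ 2) := by
    intro z hz
    have hz' : (0 : ℝ) < z := hz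
    have hiff : (|(|x| - |y|)| ≤ |z| ∧ |z| ≤ |x| + |y|) ↔
        ((|x| - |y|) ^ 2 ≤ z ^ 2 ∧ z ^ 2 ≤ (|x| + |y|) ^ 2) := by
      rw [sq_le_sq, sq_le_sq, abs_of_nonneg (show 0 ≤ |x| + |y| by positivity)]
    rw [dunklP, hq, muDensity]
    simp only [hiff]
    split_ifs with h
    · rw [abs_mul, abs_mul, Real.mul_rpow (by positivity) (abs_nonneg _), abs_of_pos hz',
        Real.rpow_add hz', Real.rpow_one, hc,
        show (2 : ℝ) ^ (2 * k) = 2 ^ (k - 1) * 2 ^ (k + 1) by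
          rw [← Real.rpow_add two_pos]; congr 1; ring]
      have : z ^ (2 * k) ≠ 0 := (Real.rpow_pos_of_pos hz' _).ne'
      field_simp
    · simp
  have hswap : ∫ z, H (z ^ 2) * (dunklP k x y z : ℂ) ∂muK k = ∫ w, (q w : ℂ) * H w := by
    rw [integral_muK hk.le]
    rw [integral_of_even fun z => by rw [muDensity_neg, dunklP_neg_right, neg_sq],
      ← integral_const_mul]
    have h1 : ∀ z ∈ Ioi (0 : ℝ), 2 * ((muDensity k z : ℂ) * (H (z ^ 2) * (dunklP k x y z : ℂ))) =
        (2 * z ^ ((2 : ℝ) - 1)) • ((q (z ^ (2 : ℝ)) : ℂ) * H (z ^ (2 : ℝ))) := by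
      intro z hz
      have := congrArg (fun r : ℝ => (r : ℂ)) (hpos z hz)
      push_cast at this
      rw [Real.rpow_two, show (2 : ℝ) - 1 = 1 by norm_num, Real.rpow_one, Complex.real_smul]
      push_cast
      linear_combination H (z ^ 2) * this
    rw [setIntegral_congr_fun measurableSet_Ioi h1,
      integral_comp_rpow_Ioi_of_pos (g := fun w => (q w : ℂ) * H w) two_pos,
      ← integral_Ici_eq_integral_Ioi]
    refine setIntegral_eq_integral_of_forall_compl_eq_zero fun w hw => ?_
    rw [hq]
    simp only []
    rw [if_neg]
    · simp
    · intro h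
      exact hw ((sq_nonneg _).trans h.1)
  have haff : ∫ w, (q w : ℂ) * H w = ∫ s, ((|2 * x * y| * q (x ^ 2 + y ^ 2 + 2 * x * y * s) : ℝ) : ℂ) *
      H (x ^ 2 + y ^ 2 + 2 * x * y * s) := by
    have h1 := Measure.integral_comp_mul_left (fun w => (q (x ^ 2 + y ^ 2 + w) : ℂ) * H (x ^ 2 + y ^ 2 + w)) (2 * x * y)
    have h2 := integral_add_left_eq_self (μ := volume) (fun w => (q w : ℂ) * H w) (x ^ 2 + y ^ 2)
    have h3 : |2 * x * y| ≠ 0 := by positivity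
    rw [h2, abs_inv] at h1
    have h4 : ∫ w, (q w : ℂ) * H w = |2 * x * y| • ∫ s,  (q (x ^ 2 + y ^ 2 + 2 * x * y * s) : ℂ) *
      H (x ^ 2 + y ^ 2 + 2 * x * y * s) := by
      rw [h1, smul_smul, mul_inv_cancel₀ h3, one_smul]
    rw [h4, ← integral_smul]
    congr 1; ext s
    rw [Complex.real_smul]; push_cast; ring
  rw [hswap, haff]
  refine integral_congr_ae ?_
  -- The triangle condition is closed and the support condition s² < 1 is open; they differ only at
  -- s = ±1.
  filter_upwards [compl_mem_ae_iff.2 (measure_singleton (1 : ℝ)),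
    compl_mem_ae_iff.2 (measure_singleton (-1 : ℝ))] with s hs1 hs2
  have hs : s ^ 2 ≠ 1 := by
    intro h
    rcases sq_eq_one_iff.1 h with h | h
    · exact hs1 h
    · exact hs2 h
  rw [mul_comm]
  congr 2
  have hxy : 0 < |x| * |y| := by positivity
  have eX := sq_abs x
  have eY := sq_abs y
  have hXY : (|x| * |y|) ^ 2 = (x * y) ^ 2 := by rw [← abs_mul, sq_abs]
  have hiff : ((|x| - |y|) ^ 2 ≤ x ^ 2 + y ^ 2 + 2 * x * y * s ∧
      x ^ 2 + y ^ 2 + 2 * x * y * s ≤ (|x| + |y|) ^ 2) ↔ s ^ 2 < 1 := by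
    have : s ^ 2 < 1 ↔ s ^ 2 ≤ 1 := ⟨le_of_lt, fun h => lt_of_le_of_ne h hs⟩
    rw [this]
    have h1 : s ^ 2 ≤ 1 ↔ |x * y * s| ≤ |x| * |y| := by
      rw [sq_le_one_iff_abs_le_one, abs_mul, abs_mul]
      exact (mul_le_iff_le_one_right hxy).symm
    rw [h1, abs_le]
    constructor
    · rintro ⟨h1, h2⟩; constructor <;> nlinarith
    · rintro ⟨h1, h2⟩; constructor <;> nlinarith
  rw [hq, gegenbauerDensity]
  simp only [hiff]
  split_ifs with h
  · have e1 : ((|x| + |y|) ^ 2 - (x ^ 2 + y ^ 2 + 2 * x * y * s)) *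
        (x ^ 2 + y ^ 2 + 2 * x * y * s - (|x| - |y|) ^ 2) = (2 * (|x| * |y|)) ^ 2 * (1 - s ^ 2) := by
      have : (|x| + |y|) ^ 2 = x ^ 2 + y ^ 2 + 2 * (|x| * |y|) := by linear_combination eX + eY
      have h' : (|x| - |y|) ^ 2 = x ^ 2 + y ^ 2 - 2 * (|x| * |y|) := by linear_combination eX + eY
      rw [this, h']
      linear_combination 4 * s ^ 2 * hXY
    have e2 : ((2 * (|x| * |y|)) ^ 2) ^ (k - 1 / 2) =
        2 ^ (2 * k) * (|x| * |y|) ^ (2 * k) / (2 * (|x| * |y|)) := by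
      rw [← Real.rpow_natCast, ← Real.rpow_mul (by positivity),
        show ((2 : ℕ) : ℝ) * (k - 1 / 2) = 2 * k - 1 by push_cast; ring,
        Real.rpow_sub_one (by positivity), Real.mul_rpow (by norm_num) hxy.le]
    rw [e1, Real.mul_rpow (by positivity) (by linarith), e2, hc, abs_mul, abs_mul, abs_two]
    have h1 : (2 : ℝ) ^ (2 * k) ≠ 0 := (Real.rpow_pos_of_pos two_pos _).ne'
    have h2 : (|x| * |y|) ^ (2 * k) ≠ 0 := (Real.rpow_pos_of_pos hxy _).ne'
    field_simp
  · simp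

/-! ### Translation of Gaussians -/

lemma integral_dunklP {k : ℝ} (hk : -1 / 2 < k) {x y : ℝ} (hx : x ≠ 0) (hy : y ≠ 0) :
    ∫ z, (dunklP k x y z : ℂ) ∂muK k = 1 := by
  have h := integral_sq_mul_dunklP hk hx hy fun _ => 1
  simp only [one_mul] at h
  rw [h, integral_complex_ofReal, integral_gegenbauerDensity hk, Complex.ofReal_one]

lemma integral_dunklP_real {k : ℝ} (hk : -1 / 2 < k) {x y : ℝ} (hx : x ≠ 0) (hy : y ≠ 0) :
    ∫ z, dunklP k x y z ∂muK k = 1 := by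
  have h := integral_dunklP hk hx hy
  rw [integral_complex_ofReal] at h
  exact_mod_cast h

lemma integrable_dunklP {k : ℝ} (hk : -1 / 2 < k) {x y : ℝ} (hx : x ≠ 0) (hy : y ≠ 0) :
    Integrable (fun z => dunklP k x y z) (muK k) := by
  by_contra h
  have h1 := integral_dunklP_real hk hx hy
  rw [integral_undef h] at h1
  norm_num at h1

lemma measurable_dunklW_right (k x y : ℝ) : Measurable fun z => dunklW k x y z :=
  (measurable_dunklW k).comp (g := fun p : ℝ × ℝ × ℝ => dunklW k p.1 p.2.1 p.2.2)
    (f := fun z => (x, y, z)) (by fun_prop)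

lemma norm_gaussGen_le {t : ℝ} (ht : 0 < t) (o : Bool) (z : ℝ) : ‖gaussGen o t z‖ ≤ 1 + |z| := by
  have h1 : ‖Complex.exp (-t * z ^ 2)‖ ≤ 1 := by
    rw [Complex.norm_exp, Real.exp_le_one_iff]
    have : (-(t : ℂ) * (z : ℂ) ^ 2).re = -(t * z ^ 2) := by norm_cast; ring
    rw [this]
    have : 0 ≤ t * z ^ 2 := by positivity
    linarith
  rw [gaussGen, norm_mul, norm_pow, Complex.norm_real, Real.norm_eq_abs]
  have h0 := abs_nonneg z
  cases o
  · rw [Bool.toNat_false, pow_zero]; linarith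
  · rw [Bool.toNat_true, pow_one]; nlinarith

lemma integrable_gaussGen_mul_dunklW {k : ℝ} (hk : -1 / 2 < k) {x y : ℝ} (hx : x ≠ 0) (hy : y ≠ 0)
    {t : ℝ} (ht : 0 < t) (o : Bool) :
    Integrable (fun z => gaussGen o t z * (dunklW k x y z : ℂ)) (muK k) := by
  have hm := measurable_dunklW_right k x y
  have hg := measurable_gaussGen o t
  refine ((integrable_dunklP hk hx hy).const_mul ((1 + (|x| + |y|)) * 6)).mono' (by fun_prop) ?_
  filter_upwards [ae_ne_zero_muK] with z hz
  rw [norm_mul, Complex.norm_real, Real.norm_eq_abs]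
  have h1 := abs_dunklW_le hk hx hy hz
  by_cases hs : |(|x| - |y|)| ≤ |z| ∧ |z| ≤ |x| + |y|
  · have h2 := (norm_gaussGen_le ht o z).trans (show 1 + |z| ≤ 1 + (|x| + |y|) by linarith [hs.2])
    calc _ ≤ (1 + (|x| + |y|)) * (6 * dunklP k x y z) := by gcongr
      _ = _ := by ring
  · rw [dunklW, if_neg hs, dunklP, if_neg hs]; simp

/-- The Dunkl translate of a Gaussian. -/
def transGauss (k : ℝ) (o : Bool) (t x y : ℝ) : ℂ :=
  ((x : ℂ) + y) ^ o.toNat * Complex.exp (-t * x ^ 2) *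
    (dunklExp k (-2 * t * x * y) * Complex.exp (-t * y ^ 2))

/-- Averaging over z and -z leaves a function of z², to which the substitution z² = x² + y² + 2xys
applies. There 1 - σ becomes 1 + s, and what remains is the Poisson integral of the kernel at -2txy.
-/
lemma integral_gaussGen_mul_dunklW {k : ℝ} (hk : -1 / 2 < k) {x y : ℝ} (hx : x ≠ 0) (hy : y ≠ 0)
    {t : ℝ} (ht : 0 < t) (o : Bool) :
    ∫ z, gaussGen o t z * (dunklW k x y z : ℂ) ∂muK k = transGauss k o t x y := by
  have i1 := integrable_gaussGen_mul_dunklW hk hx hy ht o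
  have i2 := integrable_comp_neg_muK hk.le i1
  have e := integral_comp_neg_muK (k := k) (fun z => gaussGen o t z * (dunklW k x y z : ℂ))
  have e2 := integral_add i1 i2
  rw [e, ← two_mul] at e2
  apply mul_left_cancel₀ (two_ne_zero (α := ℂ))
  have hx' : (x : ℂ) ≠ 0 := by exact_mod_cast hx
  have hy' : (y : ℂ) ≠ 0 := by exact_mod_cast hy
  set H : ℝ → ℂ := fun w => Complex.exp (-t * w) * (1 - (x ^ 2 + y ^ 2 - w) / (2 * x * y)) with hH
  have h3 : ∀ᵐ z ∂muK k, gaussGen o t z * (dunklW k x y z : ℂ) +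
      gaussGen o t (-z) * (dunklW k x y (-z) : ℂ) =
      2 * ((x : ℂ) + y) ^ o.toNat * (H (z ^ 2) * (dunklP k x y z : ℂ)) := by
    filter_upwards [ae_ne_zero_muK] with z hz
    have hz' : (z : ℂ) ≠ 0 := by exact_mod_cast hz
    rw [dunklW_eq, dunklW_eq, dunklP_neg_right, dunklSign_eq hx hy hz,
      dunklSign_eq hx hy (neg_ne_zero.2 hz), hH]
    simp only [gaussGen, sigmaQ, Complex.ofReal_neg, neg_sq]
    push_cast
    cases o
    · simp only [Bool.toNat_false, pow_zero]; field_simp; ring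
    · simp only [Bool.toNat_true, pow_one]; field_simp; ring
  rw [← e2, integral_congr_ae h3, integral_const_mul, integral_sq_mul_dunklP hk hx hy,
    mul_assoc]
  congr 1
  rw [transGauss, mul_assoc (((x : ℂ) + y) ^ o.toNat)]
  congr 1
  rw [dunklExp_eq_integral hk, ← integral_mul_const, ← integral_const_mul]
  congr 1; ext s
  rw [hH]
  simp only []
  have e4 : Complex.exp (-t * ((x ^ 2 + y ^ 2 + 2 * x * y * s : ℝ) : ℂ)) =
      Complex.exp (-t * x ^ 2) * (Complex.exp (-2 * t * x * y * s) * Complex.exp (-t * y ^ 2)) := by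
    rw [← Complex.exp_add, ← Complex.exp_add]; congr 1; push_cast; ring
  rw [e4]
  have e5 : (1 - ((x : ℂ) ^ 2 + y ^ 2 - ((x ^ 2 + y ^ 2 + 2 * x * y * s : ℝ) : ℂ)) / (2 * x * y)) =
      1 + s := by
    push_cast; field_simp; ring
  rw [e5]
  ring

lemma transGauss_zero_left {k : ℝ} (hk : -1 / 2 ≤ k) (o : Bool) (t y : ℝ) :
    transGauss k o t 0 y = gaussGen o t y := by
  simp [transGauss, gaussGen, dunklExp_zero hk]

lemma transGauss_neg_half (o : Bool) (t x y : ℝ) :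
    transGauss (-1 / 2) o t x y = gaussGen o t (x + y) := by
  rw [transGauss, gaussGen, dunklExp_neg_half, ← Complex.exp_add, mul_assoc, ← Complex.exp_add]
  push_cast
  congr 2; ring

lemma memLp_mul_gauss_of_le {k u c : ℝ} (hk : -1 / 2 ≤ k) (hu : 0 < u) (n : ℕ) {g : ℝ → ℂ}
    (hm : Measurable g) (hg : ∀ y, ‖g y‖ ≤ Real.exp (c * |y|)) :
    MemLp (fun y => g y * ((y : ℂ) ^ n * Complex.exp (-u * y ^ 2))) 2 (muK k) := by
  rw [memLp_two_iff_integrable_sq_norm (by fun_prop)]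
  have h := (integrable_mul_gauss_of_le hk (show 0 < 2 * u by positivity) (2 * n) (c := 2 * c)
    (g := fun y => g y ^ 2) (by fun_prop) fun y => by
      rw [norm_pow, mul_assoc, two_mul, Real.exp_add, sq]
      gcongr <;> exact hg y).norm
  refine h.congr (ae_of_all _ fun y => ?_)
  simp only []
  rw [← norm_pow, mul_pow, mul_pow, ← pow_mul, mul_comm n, ← Complex.exp_nat_mul]
  congr 4; push_cast; ring

lemma transGauss_eq (k : ℝ) (o : Bool) (t x : ℝ) :
    transGauss k o t x = fun y : ℝ => Complex.exp (-t * x ^ 2) *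
      (x ^ o.toNat * (dunklExp k (-2 * t * x * y) * ((y : ℂ) ^ 0 * Complex.exp (-t * y ^ 2))) +
      o.toNat * (dunklExp k (-2 * t * x * y) * ((y : ℂ) ^ 1 * Complex.exp (-t * y ^ 2)))) := by
  ext y
  rw [transGauss]
  cases o
  · simp only [Bool.toNat_false]; push_cast; ring
  · simp only [Bool.toNat_true]; push_cast; ring

lemma integrable_transGauss {k t : ℝ} (hk : -1 / 2 ≤ k) (ht : 0 < t) (o : Bool) (x : ℝ) :
    Integrable (transGauss k o t x) (muK k) := by
  rw [transGauss_eq]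
  exact (((integrable_dunklExp_mul_gauss hk ht 0 _).const_mul _).add
    ((integrable_dunklExp_mul_gauss hk ht 1 _).const_mul _)).const_mul _

lemma memLp_transGauss {k t : ℝ} (hk : -1 / 2 ≤ k) (ht : 0 < t) (o : Bool) (x : ℝ) :
    MemLp (transGauss k o t x) 2 (muK k) := by
  have hm := measurable_dunklExp hk
  have h : ∀ n : ℕ, MemLp (fun y : ℝ => dunklExp k (-2 * t * x * y) *
      ((y : ℂ) ^ n * Complex.exp (-t * y ^ 2))) 2 (muK k) := fun n =>
    memLp_mul_gauss_of_le hk ht n (by fun_prop) (norm_dunklExp_mul_le hk _)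
  rw [transGauss_eq]
  exact (((h 0).const_mul _).add ((h 1).const_mul _)).const_mul _

lemma conj_transGauss {k : ℝ} (hk : -1 / 2 ≤ k) (o : Bool) (t x y : ℝ) :
    conj (transGauss k o t x y) = transGauss k o t x y := by
  simp only [transGauss, map_mul, map_pow, map_add, Complex.conj_ofReal, ← Complex.exp_conj,
    map_neg, conj_dunklExp hk, map_ofNat]

/-! ### Duality for the Dunkl translation -/

lemma muDensity_neg_half (x : ℝ) : muDensity (-1 / 2) x = muDensity (-1 / 2) 0 := by
  rw [muDensity, muDensity]; norm_num

lemma integrable_dunklP_mul {k : ℝ} (hk : -1 / 2 < k) {x : ℝ} (hx : x ≠ 0) {g : ℝ → ℝ}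
    (hg : Integrable g (muK k)) :
    Integrable (fun p : ℝ × ℝ => dunklP k x p.1 p.2 * g p.1) ((muK k).prod (muK k)) := by
  have hm : AEStronglyMeasurable (fun p : ℝ × ℝ => dunklP k x p.1 p.2 * g p.1)
      ((muK k).prod (muK k)) := by
    refine AEStronglyMeasurable.mul ?_ hg.1.comp_fst
    exact ((measurable_dunklP k).comp (g := fun p : ℝ × ℝ × ℝ => dunklP k p.1 p.2.1 p.2.2)
      (f := fun p : ℝ × ℝ => (x, p.1, p.2)) (by fun_prop)).aestronglyMeasurable
  rw [integrable_prod_iff hm]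
  constructor
  · filter_upwards [ae_ne_zero_muK] with y hy
    exact (integrable_dunklP hk hx hy).mul_const _
  · refine hg.norm.congr ?_
    filter_upwards [ae_ne_zero_muK] with y hy
    simp only [norm_mul]
    rw [integral_mul_const]
    simp only [Real.norm_of_nonneg (dunklP_nonneg hk x y _)]
    rw [integral_dunklP_real hk hx hy, one_mul]

/-- A Schur test: |W| ≤ 6P, the product |f||g| is at most half the sum of squares, and P has mass
one in each of the variables y and z. -/
lemma integrable_mul_dunklW_mul {k : ℝ} (hk : -1 / 2 < k) {x : ℝ} (hx : x ≠ 0) {f g : ℝ → ℂ}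
    (hf : MemLp f 2 (muK k)) (hg : MemLp g 2 (muK k)) :
    Integrable (fun p : ℝ × ℝ => f p.2 * (dunklW k x p.1 p.2 : ℂ) * g p.1)
      ((muK k).prod (muK k)) := by
  have h1 := integrable_dunklP_mul hk hx ((memLp_two_iff_integrable_sq_norm hg.1).1 hg)
  have h2 := (integrable_dunklP_mul hk hx ((memLp_two_iff_integrable_sq_norm hf.1).1 hf)).swap
  have hW : Measurable fun p : ℝ × ℝ => dunklW k x p.1 p.2 :=
    (measurable_dunklW k).comp (g := fun p : ℝ × ℝ × ℝ => dunklW k p.1 p.2.1 p.2.2)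
      (f := fun p : ℝ × ℝ => (x, p.1, p.2)) (by fun_prop)
  refine ((h1.add h2).const_mul 3).mono' ?_ ?_
  · refine (hf.1.comp_snd.mul ?_).mul hg.1.comp_fst
    exact (by fun_prop : Measurable fun p : ℝ × ℝ => (dunklW k x p.1 p.2 : ℂ)).aestronglyMeasurable
  · have hne1 : ∀ᵐ p ∂(muK k).prod (muK k), p.1 ≠ 0 :=
      Measure.quasiMeasurePreserving_fst.ae ae_ne_zero_muK
    have hne2 : ∀ᵐ p ∂(muK k).prod (muK k), p.2 ≠ 0 :=
      Measure.quasiMeasurePreserving_snd.ae ae_ne_zero_muK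
    filter_upwards [hne1, hne2] with p hp1 hp2
    have hW' := abs_dunklW_le hk hx hp1 hp2
    have hP := dunklP_nonneg hk x p.1 p.2
    simp only [Pi.add_apply, Function.comp, Prod.fst_swap, Prod.snd_swap]
    rw [norm_mul, norm_mul, Complex.norm_real, Real.norm_eq_abs, dunklP_symm k x p.1 p.2]
    have h3 : ‖f p.2‖ * ‖g p.1‖ ≤ (‖g p.1‖ ^ 2 + ‖f p.2‖ ^ 2) / 2 := by
      nlinarith [sq_nonneg (‖f p.2‖ - ‖g p.1‖)]
    calc ‖f p.2‖ * |dunklW k x p.1 p.2| * ‖g p.1‖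
        = |dunklW k x p.1 p.2| * (‖f p.2‖ * ‖g p.1‖) := by ring
      _ ≤ 6 * dunklP k x p.1 p.2 * ((‖g p.1‖ ^ 2 + ‖f p.2‖ ^ 2) / 2) := by gcongr
      _ = _ := by ring

/-- The transpose of translation by x is translation by -x, tested on Gaussians, whose translates
are explicit. In the nondegenerate case this is Fubini with the symmetry of W; at k = -1/2 it is
translation invariance of a multiple of Lebesgue measure. -/
lemma dunklTranslation_duality {k : ℝ} (hk : -1 / 2 ≤ k) (x : ℝ) {f : ℝ → ℂ}
    (hf : MemLp f 2 (muK k)) (o : Bool) {t : ℝ} (ht : 0 < t) :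
    Integrable (fun y => dunklTranslation k x f y * gaussGen o t y) (muK k) ∧
    ∫ y, dunklTranslation k x f y * gaussGen o t y ∂muK k =
      ∫ z, f z * transGauss k o t (-x) z ∂muK k := by
  have hg := memLp_gaussGen hk ht o
  by_cases hx : x = 0
  · subst hx
    simp only [dunklTranslation, true_or, or_true, if_true, zero_add, neg_zero,
      transGauss_zero_left hk, and_true]
    exact integrable_mul_of_memLp hf hg
  rcases hk.eq_or_lt with rfl | hk'
  · simp only [dunklTranslation, true_or, if_true, transGauss_neg_half]
    have hi : Integrable (fun z => f z * gaussGen o t (-x + z)) (muK (-1 / 2)) := by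
      have := memLp_transGauss hk ht o (-x)
      simp only [funext (transGauss_neg_half o t (-x))] at this
      exact integrable_mul_of_memLp hf this
    constructor
    · rw [integrable_muK_iff hk] at hi ⊢
      refine (hi.comp_add_left x).congr (ae_of_all _ fun y => ?_)
      simp only []
      rw [muDensity_neg_half y, muDensity_neg_half (x + y), neg_add_cancel_left]
    · rw [integral_muK hk, integral_muK hk, ← integral_add_left_eq_self (fun z =>
        (muDensity (-1 / 2) z : ℂ) * (f z * gaussGen o t (-x + z))) x]
      congr 1; ext y
      rw [muDensity_neg_half y, muDensity_neg_half (x + y), neg_add_cancel_left]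
  · have hint := integrable_mul_dunklW_mul hk' hx hf hg
    have hT : ∀ᵐ y ∂muK k, ∫ z, f z * (dunklW k x y z : ℂ) * gaussGen o t y ∂muK k =
        dunklTranslation k x f y * gaussGen o t y := by
      filter_upwards [ae_ne_zero_muK] with y hy
      rw [dunklTranslation, if_neg, integral_mul_const]
      simp only [hx, hy, or_self, or_false]
      exact hk'.ne'
    constructor
    · exact hint.integral_prod_left.congr hT
    · rw [← integral_congr_ae hT, integral_integral_swap hint]
      refine integral_congr_ae ?_
      filter_upwards [ae_ne_zero_muK] with z hz
      rw [← integral_gaussGen_mul_dunklW hk' (neg_ne_zero.2 hx) hz ht, ← integral_const_mul]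
      refine integral_congr_ae ?_
      filter_upwards [ae_ne_zero_muK] with y hy
      rw [dunklW_symm k hx hy hz]; ring

/-! ### The Dunkl translation on the transform side -/

/-- Both exponents equal -tx²/(4st + 1), and the two products of prefactors agree. This is the
scalar identity to which every parity case of the next lemma reduces. -/
lemma gaussValue_reciprocity {k s t : ℝ} (hs : 0 < s) (ht : 0 < t) (x : ℝ) :
    (((2 * s) ^ (-(k + 1)) : ℝ) : ℂ) * (Complex.exp (-t * x ^ 2) *
      gaussValue k (t + 1 / (4 * s)) (-2 * t * x)) =
    (((2 * t) ^ (-(k + 1)) : ℝ) : ℂ) * gaussValue k (s + 1 / (4 * t)) (Complex.I * x) := by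
  have h1 : ((2 * s) ^ (-(k + 1)) : ℝ) * (2 * (t + 1 / (4 * s))) ^ (-(k + 1)) =
      (2 * t) ^ (-(k + 1)) * (2 * (s + 1 / (4 * t))) ^ (-(k + 1)) := by
    rw [← Real.mul_rpow (by positivity) (by positivity),
      ← Real.mul_rpow (by positivity) (by positivity)]
    congr 1; field_simp
  have h1' : (((2 * s) ^ (-(k + 1)) : ℝ) : ℂ) * (((2 * (t + 1 / (4 * s))) ^ (-(k + 1)) : ℝ) : ℂ) =
      (((2 * t) ^ (-(k + 1)) : ℝ) : ℂ) * (((2 * (s + 1 / (4 * t))) ^ (-(k + 1)) : ℝ) : ℂ) := by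
    exact_mod_cast h1
  have hs' : (s : ℂ) ≠ 0 := by exact_mod_cast hs.ne'
  have ht' : (t : ℂ) ≠ 0 := by exact_mod_cast ht.ne'
  have hu' : 4 * (s : ℂ) * t + 1 ≠ 0 := by
    exact_mod_cast (show 4 * s * t + 1 ≠ 0 by positivity)
  have h2 : Complex.exp (-t * x ^ 2) * Complex.exp ((-2 * t * x) ^ 2 /
      (4 * ((t + 1 / (4 * s) : ℝ) : ℂ))) =
      Complex.exp ((Complex.I * x) ^ 2 / (4 * ((s + 1 / (4 * t) : ℝ) : ℂ))) := by
    rw [← Complex.exp_add]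
    congr 1
    rw [mul_pow Complex.I, Complex.I_sq]
    have e1 : (4 * ((t + 1 / (4 * s) : ℝ) : ℂ)) = (4 * s * t + 1) / s := by
      push_cast; field_simp
    have e2 : (4 * ((s + 1 / (4 * t) : ℝ) : ℂ)) = (4 * s * t + 1) / t := by
      push_cast; field_simp
    rw [e1, e2]
    obtain ⟨D, hD⟩ : ∃ D : ℂ, D = 4 * s * t + 1 := ⟨_, rfl⟩
    rw [← hD] at hu' ⊢
    field_simp
    rw [hD]; ring
  rw [gaussValue, gaussValue, ← h2]
  linear_combination Complex.exp (-t * x ^ 2) * Complex.exp ((-2 * t * x) ^ 2 /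
      (4 * ((t + 1 / (4 * s) : ℝ) : ℂ))) * h1'

/-- The transform of a translated Gaussian is the character times the transform of the Gaussian, in
weak form. Both sides are combinations of Gaussian integrals with y-degree at most 2. -/
lemma integral_transGauss_mul {k s t : ℝ} (hk : -1 / 2 ≤ k) (hs : 0 < s) (ht : 0 < t)
    (o p : Bool) (x : ℝ) :
    ∫ y, transGauss k o t x y * dunklF k (gaussGen p s) y ∂muK k =
      ∫ l, conj (dunklChar k l x) * dunklF k (gaussGen o t) l * gaussGen p s l ∂muK k := by
  have hu : 0 < t + 1 / (4 * s) := by positivity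
  have hv : 0 < s + 1 / (4 * t) := by positivity
  have hs' : (s : ℂ) ≠ 0 := by exact_mod_cast hs.ne'
  have ht' : (t : ℂ) ≠ 0 := by exact_mod_cast ht.ne'
  have hu' : 4 * (s : ℂ) * t + 1 ≠ 0 := by
    exact_mod_cast (show 4 * s * t + 1 ≠ 0 by positivity)
  have eu : ((t + 1 / (4 * s) : ℝ) : ℂ) = (4 * s * t + 1) / (4 * s) := by
    push_cast; field_simp
  have ev : ((s + 1 / (4 * t) : ℝ) : ℂ) = (4 * s * t + 1) / (4 * t) := by
    push_cast; field_simp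
  set A : ℕ → ℝ → ℂ := fun n y => dunklExp k (-2 * t * x * y) *
    ((y : ℂ) ^ n * Complex.exp (-((t + 1 / (4 * s) : ℝ) : ℂ) * y ^ 2)) with hA
  set B : ℕ → ℝ → ℂ := fun n l => dunklExp k (Complex.I * x * l) *
    ((l : ℂ) ^ n * Complex.exp (-((s + 1 / (4 * t) : ℝ) : ℂ) * l ^ 2)) with hB
  have iA : ∀ n, Integrable (A n) (muK k) := fun n =>
    integrable_dunklExp_mul_gauss hk hu n _
  have hL : ∀ y, transGauss k o t x y * dunklF k (gaussGen p s) y =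
      gaussCoeff k p s * Complex.exp (-t * x ^ 2) * (x ^ o.toNat * A p.toNat y +
        o.toNat * A (1 + p.toNat) y) := by
    intro y
    rw [dunklF_gaussGen hk hs, gaussGen, transGauss_eq, hA]
    have e : Complex.exp (-((t + 1 / (4 * s) : ℝ) : ℂ) * y ^ 2) =
        Complex.exp (-t * y ^ 2) * Complex.exp (-((1 / (4 * s) : ℝ) : ℂ) * y ^ 2) := by
      rw [← Complex.exp_add]; congr 1; push_cast; ring
    simp only [e, pow_add]
    ring
  have hR : ∀ l, conj (dunklChar k l x) * dunklF k (gaussGen o t) l * gaussGen p s l =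
      gaussCoeff k o t * B (o.toNat + p.toNat) l := by
    intro l
    rw [dunklF_gaussGen hk ht, gaussGen, gaussGen, conj_dunklChar hk, hB]
    have e : Complex.exp (-((s + 1 / (4 * t) : ℝ) : ℂ) * l ^ 2) =
        Complex.exp (-s * l ^ 2) * Complex.exp (-((1 / (4 * t) : ℝ) : ℂ) * l ^ 2) := by
      rw [← Complex.exp_add]; congr 1; push_cast; ring
    simp only [e, pow_add]
    ring
  rw [integral_congr_ae (ae_of_all _ hL), integral_congr_ae (ae_of_all _ hR), integral_const_mul,
    integral_const_mul, integral_add ((iA _).const_mul _) ((iA _).const_mul _),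
    integral_const_mul, integral_const_mul]
  have A0 : ∫ y, A 0 y ∂muK k = _ := integral_dunklExp_gauss hk hu (-2 * t * x)
  have A1 : ∫ y, A 1 y ∂muK k = _ := integral_dunklExp_id_gauss hk hu (-2 * t * x)
  have A2 : ∫ y, A 2 y ∂muK k = _ := integral_dunklExp_sq_gauss hk hu (-2 * t * x)
  have B0 : ∫ y, B 0 y ∂muK k = _ := integral_dunklExp_gauss hk hv (Complex.I * x)
  have B1 : ∫ y, B 1 y ∂muK k = _ := integral_dunklExp_id_gauss hk hv (Complex.I * x)
  have B2 : ∫ y, B 2 y ∂muK k = _ := integral_dunklExp_sq_gauss hk hv (Complex.I * x)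
  have hrec := gaussValue_reciprocity (k := k) hs ht x
  rw [eu] at A1 A2
  rw [ev] at B1 B2
  have hI := Complex.I_sq
  obtain ⟨D, hD⟩ : ∃ D : ℂ, D = 4 * s * t + 1 := ⟨_, rfl⟩
  rw [← hD] at hu' A1 A2 B1 B2
  clear hL hR
  unfold gaussCoeff
  generalize gaussValue k (t + 1 / (4 * s)) (-2 * t * x) = a at *
  generalize gaussValue k (s + 1 / (4 * t)) (Complex.I * x) = b at *
  generalize Complex.exp (-t * x ^ 2) = e at *
  generalize (((2 * s) ^ (-(k + 1)) : ℝ) : ℂ) = S at *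
  generalize (((2 * t) ^ (-(k + 1)) : ℝ) : ℂ) = T at *
  -- In each parity case c1 and c2 bring the two rational coefficients to a common form with D = 4st
  -- + 1, and the reciprocity identity is multiplied by it.
  cases o <;> cases p <;>
    simp only [Bool.toNat_false, Bool.toNat_true, pow_zero, pow_one, add_zero, zero_add,
      Nat.cast_zero, Nat.cast_one, Nat.reduceAdd, one_mul, zero_mul, A0, A1, A2, B0, B1, B2]
  · linear_combination hrec
  · have c1 : (-Complex.I / (2 * s)) * (-2 * t * x / (2 * (D / (4 * s)))) =
        2 * Complex.I * t * x / D := by field_simp; ring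
    have c2 : Complex.I * x / (2 * (D / (4 * t))) = 2 * Complex.I * t * x / D := by
      field_simp; ring
    linear_combination S * e * a * c1 - T * b * c2 + 2 * Complex.I * t * x / D * hrec
  · have c1 : x + -2 * t * x / (2 * (D / (4 * s))) = x / D := by
      field_simp; rw [hD]; ring
    have c2 : (-Complex.I / (2 * t)) * (Complex.I * x / (2 * (D / (4 * t)))) = x / D := by
      field_simp; rw [hI]; ring
    linear_combination S * e * a * c1 - T * b * c2 + x / D * hrec
  · have c1 : (-Complex.I / (2 * s)) * (x * (-2 * t * x / (2 * (D / (4 * s)))) +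
        ((k + 1) / (D / (4 * s)) + (-2 * t * x) ^ 2 / (4 * (D / (4 * s)) ^ 2))) =
        -Complex.I * (2 * (k + 1) / D - 2 * t * x ^ 2 / D ^ 2) := by
      field_simp; rw [hD]; ring
    have c2 : (-Complex.I / (2 * t)) * ((k + 1) / (D / (4 * t)) +
        (Complex.I * x) ^ 2 / (4 * (D / (4 * t)) ^ 2)) =
        -Complex.I * (2 * (k + 1) / D - 2 * t * x ^ 2 / D ^ 2) := by
      rw [mul_pow, hI]; field_simp; ring
    linear_combination S * e * a * c1 - T * b * c2 +
      -Complex.I * (2 * (k + 1) / D - 2 * t * x ^ 2 / D ^ 2) * hrec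

lemma dunklF_transGauss {k t : ℝ} (hk : -1 / 2 ≤ k) (ht : 0 < t) (o : Bool) (x : ℝ) :
    dunklF k (transGauss k o t x) =ᵐ[muK k]
      fun l => conj (dunklChar k l x) * dunklF k (gaussGen o t) l := by
  have hm1 := aestronglyMeasurable_dunklF hk (integrable_transGauss hk ht o x).1 (muK k)
  have hm2 := aestronglyMeasurable_dunklF hk (integrable_gaussGen hk ht o).1 (muK k)
  have hm3 : AEStronglyMeasurable (fun l => conj (dunklChar k l x)) (muK k) :=
    Complex.continuous_conj.comp_aestronglyMeasurable
      (measurable_dunklChar_left hk x).aestronglyMeasurable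
  refine ae_eq_of_integral_gaussGen hk (fun p s hs => integrable_bdd_mul_gaussGen hk hm1
    (norm_dunklF_le hk (integrable_transGauss hk ht o x)) p hs) (fun p s hs =>
    integrable_bdd_mul_gaussGen hk (hm3.mul hm2) (C := ∫ x, ‖gaussGen o t x‖ ∂muK k)
      (fun l => ?_) p hs) fun p s hs => ?_
  · rw [Pi.mul_apply, norm_mul, RCLike.norm_conj, ← one_mul (∫ x, ‖gaussGen o t x‖ ∂muK k)]
    exact mul_le_mul (norm_dunklChar_le hk l x) (norm_dunklF_le hk (integrable_gaussGen hk ht o) l)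
      (norm_nonneg _) zero_le_one
  · rw [integral_dunklF_mul hk (integrable_transGauss hk ht o x) (integrable_gaussGen hk hs p),
      integral_transGauss_mul hk hs ht]

lemma memLp_char_mul {k : ℝ} (hk : -1 / 2 ≤ k) {g : ℝ → ℂ} (hg : MemLp g 2 (muK k)) (x : ℝ) :
    MemLp (fun l => conj (dunklChar k l x) * g l) 2 (muK k) := by
  have hm3 : AEStronglyMeasurable (fun l => conj (dunklChar k l x)) (muK k) :=
    Complex.continuous_conj.comp_aestronglyMeasurable
      (measurable_dunklChar_left hk x).aestronglyMeasurable
  refine hg.mono (hm3.mul hg.1) (ae_of_all _ fun l => ?_)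
  rw [norm_mul, RCLike.norm_conj]
  exact mul_le_of_le_one_left (norm_nonneg _) (norm_dunklChar_le hk l x)

lemma dunklChar_neg {k : ℝ} (hk : -1 / 2 ≤ k) (l x : ℝ) :
    dunklChar k l (-x) = conj (dunklChar k l x) := by
  rw [conj_dunklChar hk, dunklChar]
  congr 1; push_cast; ring

/-- The Plancherel formula. -/
lemma integral_dunklU_mul_conj {k : ℝ} (hk : -1 / 2 ≤ k) (f g : DunklL2 k) :
    ∫ x, dunklU hk f x * conj (dunklU hk g x) ∂muK k = ∫ x, f x * conj (g x) ∂muK k := by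
  have h := LinearIsometryEquiv.inner_map_map (dunklU hk) g f
  simpa only [L2.inner_def, RCLike.inner_apply] using h

/-- The Dunkl transform turns the Dunkl translation into multiplication by the kernel. -/
lemma dunklTranslation_ae_eq {k : ℝ} (hk : -1 / 2 ≤ k) (x : ℝ) {f : ℝ → ℂ}
    (hf : MemLp f 2 (muK k)) :
    dunklTranslation k x f =ᵐ[muK k] (dunklU hk).symm
      ((memLp_char_mul hk (Lp.memLp (dunklU hk (hf.toLp f))) x).toLp _) := by
  refine ae_eq_of_integral_gaussGen hk (fun o t ht => (dunklTranslation_duality hk x hf o ht).1)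
    (fun o t ht => integrable_mul_of_memLp (Lp.memLp _) (memLp_gaussGen hk ht o)) fun o t ht => ?_
  rw [(dunklTranslation_duality hk x hf o ht).2,
    integral_dunklU_symm_mul_gaussGen hk _ (o, ⟨t, ht⟩)]
  have hT := memLp_transGauss hk ht o (-x)
  have h := integral_dunklU_mul_conj hk (hf.toLp f) (hT.toLp _)
  have e1 : ∫ z, f z * transGauss k o t (-x) z ∂muK k =
      ∫ z, hf.toLp f z * conj (hT.toLp _ z) ∂muK k := by
    refine integral_congr_ae ?_
    filter_upwards [hf.coeFn_toLp, hT.coeFn_toLp] with z h1 h2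
    rw [h1, h2, conj_transGauss hk]
  rw [e1, ← h]
  refine integral_congr_ae ?_
  filter_upwards [dunklU_toLp hk (integrable_transGauss hk ht o (-x)) hT,
    dunklF_transGauss hk ht o (-x),
    (memLp_char_mul hk (Lp.memLp (dunklU hk (hf.toLp f))) x).coeFn_toLp] with l h1 h2 h3
  have h4 : dunklFinv k (gaussGen o t) l = conj (dunklF k (gaussGen o t) l) := by
    rw [← dunklFinv_conj]; simp only [conj_gaussGen]
  simp only [h1, h2, h3, h4, dunklChar_neg hk, map_mul, Complex.conj_conj]
  ring

/-! ### Dilations -/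

lemma gaussGen_comp_mul (o : Bool) (t a x : ℝ) :
    gaussGen o t (a * x) = (a : ℂ) ^ o.toNat * gaussGen o (t * a ^ 2) x := by
  rw [gaussGen, gaussGen]
  push_cast
  rw [mul_pow, mul_assoc]
  congr 3; ring

lemma dunklF_comp_inv_mul {k a : ℝ} (ha : 0 < a) (g : ℝ → ℂ) (x : ℝ) :
    dunklF k (fun y => g (a⁻¹ * y)) x = ((a ^ (2 * k + 2) : ℝ) : ℂ) * dunklF k g (a * x) := by
  have h := integral_comp_mul_muK (k := k) (inv_ne_zero ha.ne')
    (fun y => g y * dunklChar k (a * x) y)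
  rw [abs_of_pos (inv_pos.2 ha), Real.inv_rpow ha.le, Real.rpow_neg ha.le, inv_inv] at h
  rw [dunklF, dunklF, ← h]
  congr 1; ext y
  congr 1
  have ha' : (a : ℂ) ≠ 0 := by exact_mod_cast ha.ne'
  rw [dunklChar, dunklChar]
  congr 1
  push_cast
  field_simp

/-- The Dunkl transform turns dilations into dilations. -/
lemma dunklU_dilation {k a : ℝ} (hk : -1 / 2 ≤ k) (ha : 0 < a) {f g : ℝ → ℂ}
    (hf : MemLp f 2 (muK k)) (hg : MemLp g 2 (muK k))
    (hgf : ∀ x, g x = ((1 / a ^ (2 * k + 2) : ℝ) : ℂ) * f (x / a)) :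
    dunklU hk (hg.toLp g) =ᵐ[muK k] fun l => dunklU hk (hf.toLp f) (a * l) := by
  have hL : MemLp (fun l => dunklU hk (hf.toLp f) (a * l)) 2 (muK k) :=
    memLp_comp_mul_muK ha.ne' (Lp.memLp _)
  have hap : 0 < a ^ (2 * k + 2) := Real.rpow_pos_of_pos ha _
  have hap' : ((a ^ (2 * k + 2) : ℝ) : ℂ) ≠ 0 := by exact_mod_cast hap.ne'
  have ha' : (a : ℂ) ≠ 0 := by exact_mod_cast ha.ne'
  refine ae_eq_of_integral_gaussGen hk
    (fun o t ht => integrable_mul_of_memLp (Lp.memLp _) (memLp_gaussGen hk ht o))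
    (fun o t ht => integrable_mul_of_memLp hL (memLp_gaussGen hk ht o)) fun o t ht => ?_
  have ht' : 0 < t * a⁻¹ ^ 2 := by positivity
  -- A dilated Gaussian is again a multiple of a Gaussian, so both pairings can be moved onto f,
  -- where they meet in the same integral.
  have e1 : ∫ x, dunklU hk (hg.toLp g) x * gaussGen o t x ∂muK k =
      ∫ x, f x * dunklF k (gaussGen o t) (a * x) ∂muK k := by
    rw [integral_dunklU_mul_gaussGen hk _ (o, ⟨t, ht⟩)]
    have h := integral_comp_mul_muK (k := k) (inv_ne_zero ha.ne')
      (fun x => f x * dunklF k (gaussGen o t) (a * x))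
    rw [abs_of_pos (inv_pos.2 ha), Real.inv_rpow ha.le, Real.rpow_neg ha.le, inv_inv] at h
    rw [← mul_right_inj' hap', ← h, ← integral_const_mul]
    refine integral_congr_ae ?_
    filter_upwards [hg.coeFn_toLp] with x hx
    rw [hx, hgf, mul_inv_cancel_left₀ ha.ne', div_eq_inv_mul x a, one_div, Complex.ofReal_inv]
    generalize ((a ^ (2 * k + 2) : ℝ) : ℂ) = A at hap' ⊢
    field_simp
  have e2 : ∫ x, dunklU hk (hf.toLp f) (a * x) * gaussGen o t x ∂muK k =
      ∫ x, f x * dunklF k (gaussGen o t) (a * x) ∂muK k := by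
    have h := integral_comp_mul_muK (k := k) ha.ne'
      (fun x => dunklU hk (hf.toLp f) x * gaussGen o t (a⁻¹ * x))
    simp only [inv_mul_cancel_left₀ ha.ne'] at h
    rw [h, abs_of_pos ha, Real.rpow_neg ha.le]
    have h2 := integral_dunklU_mul_gaussGen hk (hf.toLp f) (o, ⟨t * a⁻¹ ^ 2, ht'⟩)
    simp only [] at h2
    have h3 : ∫ x, dunklU hk (hf.toLp f) x * gaussGen o t (a⁻¹ * x) ∂muK k =
        ((a⁻¹ : ℝ) : ℂ) ^ o.toNat *
          ∫ x, dunklU hk (hf.toLp f) x * gaussGen o (t * a⁻¹ ^ 2) x ∂muK k := by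
      rw [← integral_const_mul]; congr 1; ext x; rw [gaussGen_comp_mul]; ring
    have h4 : ∀ x, dunklF k (fun y => gaussGen o t (a⁻¹ * y)) x =
        ((a⁻¹ : ℝ) : ℂ) ^ o.toNat * dunklF k (gaussGen o (t * a⁻¹ ^ 2)) x := by
      intro x
      rw [dunklF, dunklF, ← integral_const_mul]; congr 1; ext y; rw [gaussGen_comp_mul]; ring
    rw [h3, h2, ← integral_const_mul, ← integral_const_mul]
    refine integral_congr_ae ?_
    filter_upwards [hf.coeFn_toLp] with x hx
    have h5 := h4 x
    rw [dunklF_comp_inv_mul ha] at h5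
    rw [hx]
    push_cast at h5 ⊢
    linear_combination -((a ^ (2 * k + 2) : ℝ) : ℂ)⁻¹ * f x * h5 +
      f x * dunklF k (gaussGen o t) (a * x) * inv_mul_cancel₀ hap'
  rw [e1, e2]

/-! ### Convergence in `L²` -/

/-- Dominated convergence for products with a fixed square integrable function. -/
lemma tendsto_eLpNorm_mul_zero {ι : Type*} {l : Filter ι} [l.IsCountablyGenerated]
    {μ : Measure ℝ} {G : ℝ → ℂ} (hG : MemLp G 2 μ) (K : ι → ℝ → ℂ) (B : ℝ)
    (hm : ∀ᶠ i in l, AEStronglyMeasurable (K i) μ)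
    (hB : ∀ᶠ i in l, ∀ᵐ x ∂μ, ‖K i x‖ ≤ B)
    (hK : ∀ᵐ x ∂μ, Tendsto (fun i => K i x) l (𝓝 0)) :
    Tendsto (fun i => eLpNorm (fun x => K i x * G x) 2 μ) l (𝓝 0) := by
  have hGint : ∫⁻ x, ‖G x‖ₑ ^ (2 : ℝ) ∂μ ≠ ⊤ := by
    have := lintegral_rpow_enorm_lt_top_of_eLpNorm_lt_top two_ne_zero ENNReal.ofNat_ne_top hG.2
    simpa using this.ne
  have h : Tendsto (fun i => ∫⁻ x, ‖K i x * G x‖ₑ ^ (2 : ℝ) ∂μ) l (𝓝 (∫⁻ _, 0 ∂μ)) := by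
    refine tendsto_lintegral_filter_of_dominated_convergence'
      (fun x => ENNReal.ofReal B ^ (2 : ℝ) * ‖G x‖ₑ ^ (2 : ℝ)) ?_ ?_ ?_ ?_
    · filter_upwards [hm] with i hi
      exact (hi.mul hG.1).enorm.pow_const _
    · filter_upwards [hB] with i hi
      filter_upwards [hi] with x hx
      rw [enorm_mul, ENNReal.mul_rpow_of_nonneg _ _ (by norm_num)]
      gcongr
      rw [← ofReal_norm]
      exact ENNReal.ofReal_le_ofReal hx
    · rw [lintegral_const_mul' _ _ (by simp)]
      exact ENNReal.mul_ne_top (by simp) hGint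
    · filter_upwards [hK] with x hx
      have h1 : Tendsto (fun i => K i x * G x) l (𝓝 0) := by simpa using hx.mul_const (G x)
      have h2 := (ENNReal.continuous_rpow_const (y := 2)).tendsto _ |>.comp h1.enorm
      simpa [Function.comp_def] using h2
  simp only [lintegral_const, zero_mul] at h
  have h3 := (ENNReal.continuous_rpow_const (y := 1 / 2)).tendsto _ |>.comp h
  simp only [eLpNorm_eq_lintegral_rpow_enorm_toReal two_ne_zero ENNReal.ofNat_ne_top,
    ENNReal.toReal_ofNat]
  simpa [Function.comp_def] using h3

/-! ### Chirps -/

lemma norm_chirp (s x : ℝ) : ‖chirp s x‖ = 1 := by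
  rw [chirp, show Complex.I / 2 * ((s * x ^ 2 : ℝ) : ℂ) = ((s * x ^ 2 / 2 : ℝ) : ℂ) * Complex.I by
    push_cast; ring, Complex.norm_exp_ofReal_mul_I]

lemma conj_chirp (s x : ℝ) : conj (chirp s x) = chirp (-s) x := by
  rw [chirp, chirp, ← Complex.exp_conj]
  congr 1
  simp only [map_mul, map_div₀, Complex.conj_I, Complex.conj_ofReal, map_ofNat]
  push_cast; ring

lemma chirp_mul_chirp (s t x : ℝ) : chirp s x * chirp t x = chirp (s + t) x := by
  rw [chirp, chirp, chirp, ← Complex.exp_add]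
  congr 1; push_cast; ring

lemma chirp_zero (x : ℝ) : chirp 0 x = 1 := by simp [chirp]

lemma chirp_neg_mul_chirp (s x : ℝ) : chirp (-s) x * chirp s x = 1 := by
  rw [chirp_mul_chirp, neg_add_cancel, chirp_zero]

lemma continuous_chirp (s : ℝ) : Continuous (chirp s) := by
  unfold chirp; fun_prop

lemma memLp_chirp_mul {p : ENNReal} {μ : Measure ℝ} {f : ℝ → ℂ} (hf : MemLp f p μ) (s : ℝ) :
    MemLp (fun x => chirp s x * f x) p μ :=
  hf.of_le ((continuous_chirp s).aestronglyMeasurable.mul hf.1)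
    (ae_of_all _ fun x => by rw [norm_mul, norm_chirp, one_mul])

/-! ### The linear canonical transform in terms of the Dunkl transform -/

lemma ibPow_ne_zero (k : ℝ) {b : ℝ} (hb : b ≠ 0) : ibPow k b ≠ 0 := by
  have : Complex.I * (b : ℂ) ≠ 0 := mul_ne_zero Complex.I_ne_zero (by exact_mod_cast hb)
  rw [ibPow, Complex.cpow_def_of_ne_zero this]
  exact Complex.exp_ne_zero _

/-- Conjugation commutes with the principal power because ib lies off the negative real axis. -/
lemma conj_ibPow (k : ℝ) {b : ℝ} (hb : b ≠ 0) : conj (ibPow k b) = ibPow k (-b) := by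
  have h : (Complex.I * (b : ℂ)).arg ≠ Real.pi := by
    rw [Ne, Complex.arg_eq_pi_iff]
    simp [hb]
  have h2 := Complex.conj_cpow (Complex.I * (b : ℂ)) ((k : ℂ) + 1) h
  simp only [map_add, map_one, Complex.conj_ofReal, map_mul, Complex.conj_I] at h2
  rw [ibPow, ibPow, ← h2]
  push_cast
  ring_nf

lemma lcdtIntegral_eq (k : ℝ) (M : Matrix.SpecialLinearGroup (Fin 2) ℝ) (f : ℝ → ℂ) (l : ℝ) :
    lcdtIntegral k M f l = 1 / ibPow k (M 0 1) * chirp (M 1 1 / M 0 1) l *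
      dunklF k (fun x => chirp (M 0 0 / M 0 1) x * f x) ((M 0 1)⁻¹ * l) := by
  rw [lcdtIntegral, dunklF, mul_assoc, ← integral_const_mul (chirp _ l)]
  congr 1
  refine integral_congr_ae (ae_of_all _ fun x => ?_)
  simp only []
  rw [lcKernel, dunklKernel_eq, dunklChar]
  have : -Complex.I * (l : ℂ) / ((M 0 1 : ℝ) : ℂ) * x =
      -Complex.I * (((M 0 1)⁻¹ * l : ℝ) : ℂ) * x := by push_cast; ring
  rw [this]; ring

lemma eLpNorm_dunklU {k : ℝ} (hk : -1 / 2 ≤ k) (F : DunklL2 k) :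
    eLpNorm (dunklU hk F) 2 (muK k) = eLpNorm F 2 (muK k) := by
  rw [← Lp.enorm_def, ← Lp.enorm_def, enorm_eq_iff_norm_eq]
  exact (dunklU hk).norm_map F

lemma eLpNorm_unimodular_mul {μ : Measure ℝ} (c : ℂ) (s : ℝ) (h : ℝ → ℂ) :
    eLpNorm (fun l => c * chirp s l * h l) 2 μ = ‖c‖ₑ * eLpNorm h 2 μ := by
  rw [← eLpNorm_const_smul]
  refine eLpNorm_congr_norm_ae (ae_of_all _ fun x => ?_)
  simp [norm_chirp]

lemma muK_Icc_lt_top {k : ℝ} (hk : -1 / 2 ≤ k) (a b : ℝ) : muK k (Icc a b) < ⊤ := by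
  have : IsLocallyFiniteMeasure (muK k) := by
    refine IsLocallyFiniteMeasure.withDensity_ofReal ?_
    have : Continuous fun x : ℝ => |x| ^ (2 * k + 1) :=
      continuous_abs.rpow_const fun x => Or.inr (by linarith)
    fun_prop
  exact isCompact_Icc.measure_lt_top

lemma integrable_indicator_Icc {k : ℝ} (hk : -1 / 2 ≤ k) {f : ℝ → ℂ} (hf : MemLp f 2 (muK k))
    (a b : ℝ) : Integrable ((Icc a b).indicator f) (muK k) := by
  have h1 : MemLp ((Icc a b).indicator fun _ : ℝ => (1 : ℂ)) 2 (muK k) :=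
    memLp_indicator_const 2 measurableSet_Icc 1 (Or.inr (muK_Icc_lt_top hk a b).ne)
  refine (integrable_mul_of_memLp hf h1).congr (ae_of_all _ fun x => ?_)
  by_cases hx : x ∈ Icc a b <;> simp [hx]

/-- The prefactor and the dilation by 1/b scale the norm by a constant and U is isometric, so the
error is a constant times the norm of f outside [-n, n]. -/
lemma isLCDT_dunklU {k : ℝ} (hk : -1 / 2 ≤ k) (M : Matrix.SpecialLinearGroup (Fin 2) ℝ)
    (hb : M 0 1 ≠ 0) {f : ℝ → ℂ} (hf : MemLp f 2 (muK k)) :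
    IsLCDT k M f fun l => 1 / ibPow k (M 0 1) * chirp (M 1 1 / M 0 1) l *
      dunklU hk ((memLp_chirp_mul hf (M 0 0 / M 0 1)).toLp _) ((M 0 1)⁻¹ * l) := by
  set s := M 0 0 / M 0 1
  set F := (memLp_chirp_mul hf s).toLp _ with hF
  have hb' := inv_ne_zero hb
  refine ⟨?_, ?_⟩
  · have h := (memLp_chirp_mul (memLp_comp_mul_muK hb' (Lp.memLp (dunklU hk F)))
      (M 1 1 / M 0 1)).const_mul (1 / ibPow k (M 0 1))
    simpa only [mul_assoc] using h
  · have hn : ∀ n : ℕ, MemLp ((Icc (-(n : ℝ)) n).indicator f) 2 (muK k) := fun n =>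
      hf.indicator measurableSet_Icc
    have key : ∀ n : ℕ, eLpNorm (fun l =>
        lcdtIntegral k M ((Icc (-(n : ℝ)) n).indicator f) l - 1 / ibPow k (M 0 1) *
          chirp (M 1 1 / M 0 1) l * dunklU hk F ((M 0 1)⁻¹ * l)) 2 (muK k) =
        ‖1 / ibPow k (M 0 1)‖ₑ * (ENNReal.ofReal (|(M 0 1)⁻¹| ^ (-(2 * k + 2))) ^ (1 / 2 : ℝ) *
          eLpNorm (fun x => (Icc (-(n : ℝ)) n)ᶜ.indicator (fun _ => (-1 : ℂ)) x * f x)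
            2 (muK k)) := by
      intro n
      simp only [lcdtIntegral_eq, ← mul_sub]
      rw [eLpNorm_unimodular_mul]
      congr 1
      rw [eLpNorm_comp_mul_muK hb' (fun l => dunklF k (fun x => chirp s x *
        (Icc (-(n : ℝ)) n).indicator f x) l - dunklU hk F l)]
      congr 1
      have hm := memLp_chirp_mul (hn n) s
      have hi : Integrable (fun x => chirp s x * (Icc (-(n : ℝ)) n).indicator f x) (muK k) := by
        have := memLp_chirp_mul
          (memLp_one_iff_integrable.2 (integrable_indicator_Icc hk hf (-(n : ℝ)) n)) s
        exact memLp_one_iff_integrable.1 this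
      have e : (fun l => dunklF k (fun x => chirp s x *
          (Icc (-(n : ℝ)) n).indicator f x) l - dunklU hk F l) =ᵐ[muK k]
          dunklU hk (hm.toLp _ - F) := by
        rw [map_sub]
        filter_upwards [dunklU_toLp hk hi hm, Lp.coeFn_sub (dunklU hk (hm.toLp _)) (dunklU hk F)]
          with l h1 h2
        rw [h2, Pi.sub_apply, h1]
      rw [eLpNorm_congr_ae e, eLpNorm_dunklU]
      refine eLpNorm_congr_norm_ae ?_
      filter_upwards [Lp.coeFn_sub (hm.toLp _) F, hm.coeFn_toLp,
        (memLp_chirp_mul hf s).coeFn_toLp] with x h1 h2 h3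
      rw [h1, Pi.sub_apply, h2, hF, h3, ← mul_sub, norm_mul, norm_chirp, one_mul]
      by_cases hx : x ∈ Icc (-(n : ℝ)) n
      · simp [hx, -mem_Icc]
      · simp [hx, -mem_Icc]
    simp only [key]
    have h0 : Tendsto (fun n : ℕ => eLpNorm (fun x => (Icc (-(n : ℝ)) n)ᶜ.indicator
        (fun _ => (-1 : ℂ)) x * f x) 2 (muK k)) atTop (𝓝 0) := by
      refine tendsto_eLpNorm_mul_zero hf _ 1 (Eventually.of_forall fun n =>
        (measurable_const.indicator measurableSet_Icc.compl).aestronglyMeasurable)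
        (Eventually.of_forall fun n => ae_of_all _ fun x => ?_) (ae_of_all _ fun x => ?_)
      · by_cases hx : x ∈ Icc (-(n : ℝ)) n <;> simp [hx, -mem_Icc]
      · refine tendsto_const_nhds.congr' ?_
        filter_upwards [eventually_ge_atTop ⌈|x|⌉₊] with n hn
        have : |x| ≤ n := Nat.ceil_le.1 hn
        rw [indicator_of_notMem]
        rw [notMem_compl_iff]
        exact abs_le.1 this
    have h1 := ENNReal.Tendsto.const_mul (a := ENNReal.ofReal (|(M 0 1)⁻¹| ^ (-(2 * k + 2))) ^
      (1 / 2 : ℝ)) h0 (Or.inr (by simp))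
    have h2 := ENNReal.Tendsto.const_mul (a := ‖1 / ibPow k (M 0 1)‖ₑ) h1 (Or.inr (by simp))
    simpa using h2

/-- `lcdt` is an arbitrary choice among L² limits of the truncated transforms; such limits are
unique almost everywhere. -/
lemma lcdt_ae_eq {k : ℝ} (hk : -1 / 2 ≤ k) (M : Matrix.SpecialLinearGroup (Fin 2) ℝ)
    (hb : M 0 1 ≠ 0) {f : ℝ → ℂ} (hf : MemLp f 2 (muK k)) :
    lcdt k M f =ᵐ[muK k] fun l => 1 / ibPow k (M 0 1) * chirp (M 1 1 / M 0 1) l *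
      dunklU hk ((memLp_chirp_mul hf (M 0 0 / M 0 1)).toLp _) ((M 0 1)⁻¹ * l) := by
  have h1 := isLCDT_dunklU hk M hb hf
  have hex : ∃ g, IsLCDT k M f g := ⟨_, h1⟩
  have h2 : IsLCDT k M f (lcdt k M f) := by
    rw [lcdt, dif_pos hex]; exact Classical.choose_spec hex
  set g0 := fun l => 1 / ibPow k (M 0 1) * chirp (M 1 1 / M 0 1) l *
      dunklU hk ((memLp_chirp_mul hf (M 0 0 / M 0 1)).toLp _) ((M 0 1)⁻¹ * l)
  set g := lcdt k M f
  have hm : ∀ n : ℕ, AEStronglyMeasurable (lcdtIntegral k M ((Icc (-(n : ℝ)) n).indicator f))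
      (muK k) := by
    intro n
    have hi : AEStronglyMeasurable (fun x => chirp (M 0 0 / M 0 1) x *
        (Icc (-(n : ℝ)) n).indicator f x) (muK k) :=
      (continuous_chirp _).aestronglyMeasurable.mul (hf.1.indicator measurableSet_Icc)
    have := (aestronglyMeasurable_dunklF hk hi (muK k)).comp_quasiMeasurePreserving
      (quasiMeasurePreserving_mul (k := k) (inv_ne_zero hb))
    rw [funext (lcdtIntegral_eq k M _)]
    exact ((continuous_chirp _).aestronglyMeasurable.const_mul _).mul this
  have h3 : eLpNorm (fun l => g l - g0 l) 2 (muK k) = 0 := by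
    have h4 : Tendsto (fun _ : ℕ => eLpNorm (fun l => g l - g0 l) 2 (muK k)) atTop (𝓝 0) := by
      refine tendsto_of_tendsto_of_tendsto_of_le_of_le tendsto_const_nhds
        (by simpa using h1.2.add h2.2) (fun n => zero_le) fun n => ?_
      have := eLpNorm_sub_le ((hm n).sub h1.1.1) ((hm n).sub h2.1.1) (p := 2) (by norm_num)
      refine le_trans (le_of_eq ?_) this
      congr 1; ext l; simp
    exact tendsto_nhds_unique tendsto_const_nhds h4
  filter_upwards [(eLpNorm_eq_zero_iff (h2.1.1.sub h1.1.1) two_ne_zero).1 h3] with l hl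
  exact sub_eq_zero.1 hl

/-! ### The admissibility condition -/

lemma quasiMeasurePreserving_mul_volume {a : ℝ} (ha : a ≠ 0) :
    Measure.QuasiMeasurePreserving (fun x : ℝ => a * x) volume volume :=
  ⟨by fun_prop, by rw [Real.map_volume_mul_left ha]; exact Measure.smul_absolutelyContinuous⟩

/-- The two-wavelet condition in terms of the Dunkl transforms of the chirped wavelets. -/
lemma IsTwoWavelet.ae_dunklU {k : ℝ} (hk : -1 / 2 ≤ k)
    {M : Matrix.SpecialLinearGroup (Fin 2) ℝ} (hb : M 0 1 ≠ 0) {ψ φ : ℝ → ℂ} {C : ℂ}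
    (h : IsTwoWavelet k M ψ φ C) {P Q : ℝ → ℂ}
    (hP : P = dunklU hk ((memLp_chirp_mul h.1 (M 0 0 / M 0 1)).toLp _))
    (hQ : Q = dunklU hk ((memLp_chirp_mul h.2.1 (M 0 0 / M 0 1)).toLp _)) :
    ∀ᵐ l : ℝ, IntegrableOn (fun α : ℝ => conj (P (α * l)) * Q (α * l) / (α : ℂ)) (Ioi 0) ∧
      ∫ α in Ioi (0 : ℝ), conj (P (α * l)) * Q (α * l) / (α : ℂ) =
        conj C * (ibPow k (M 0 1) * ibPow k (-(M 0 1))) := by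
  set b := M 0 1
  have hib := ibPow_ne_zero k hb
  have hib' : conj (ibPow k b) ≠ 0 := (map_ne_zero _).2 hib
  have hlψ : ∀ᵐ x, lcdt k M ψ x = 1 / ibPow k b * chirp (M 1 1 / b) x * P (b⁻¹ * x) := by
    rw [hP]; exact (ae_muK_iff hk).1 (lcdt_ae_eq hk M hb h.1)
  have hlφ : ∀ᵐ x, lcdt k M φ x = 1 / ibPow k b * chirp (M 1 1 / b) x * Q (b⁻¹ * x) := by
    rw [hQ]; exact (ae_muK_iff hk).1 (lcdt_ae_eq hk M hb h.2.1)
  -- The condition is read at bl, since the canonical transform at blα involves the Dunkl transform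
  -- at αl. The chirps cancel between the two factors and only the powers of ib and -ib survive.
  have hq := (quasiMeasurePreserving_mul_volume hb).ae h.2.2
  filter_upwards [hq, compl_mem_ae_iff.2 (measure_singleton (0 : ℝ))] with l hl hl0
  have hbl : b * l ≠ 0 := mul_ne_zero hb hl0
  have e : (fun α : ℝ => conj (P (α * l)) * Q (α * l) / (α : ℂ)) =ᵐ[volume.restrict (Ioi 0)]
      fun α => (ibPow k b * conj (ibPow k b)) *
        conj (lcdt k M ψ (b * l * α) * conj (lcdt k M φ (b * l * α)) / (α : ℂ)) := by
    refine ae_restrict_of_ae ?_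
    filter_upwards [(quasiMeasurePreserving_mul_volume hbl).ae hlψ,
      (quasiMeasurePreserving_mul_volume hbl).ae hlφ] with α h1 h2
    have e2 : b⁻¹ * (b * l * α) = α * l := by field_simp
    rw [h1, h2, e2]
    have hc := chirp_neg_mul_chirp (M 1 1 / b) (b * l * α)
    simp only [map_mul, map_div₀, Complex.conj_conj, map_one, Complex.conj_ofReal, conj_chirp, neg_neg]
    rw [eq_comm]
    calc _ = (ibPow k b * (1 / ibPow k b)) * (conj (ibPow k b) * (1 / conj (ibPow k b))) *
          (chirp (-(M 1 1 / b)) (b * l * α) * chirp (M 1 1 / b) (b * l * α)) *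
          (conj (P (α * l)) * Q (α * l) / (α : ℂ)) := by ring
      _ = _ := by rw [hc, mul_one_div_cancel hib, mul_one_div_cancel hib']; ring
  refine ⟨?_, ?_⟩
  · rw [IntegrableOn, integrable_congr e]
    refine Integrable.const_mul ?_ _
    exact Complex.conjLIE.integrable_comp_iff.2 hl.1
  · rw [integral_congr_ae e, integral_const_mul, integral_conj, hl.2, conj_ibPow k hb]
    ring

/-- The multiplier `∫_ε^δ h(α l) dα/α`. -/
def dilationMultiplier (h : ℝ → ℂ) (ε δ l : ℝ) : ℂ := ∫ α in Ioo ε δ, h (α * l) / (α : ℂ)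

lemma stronglyMeasurable_dilationMultiplier {h : ℝ → ℂ} (hh : Measurable h) (ε δ : ℝ) :
    StronglyMeasurable (dilationMultiplier h ε δ) := by
  have : Measurable fun p : ℝ × ℝ => h (p.2 * p.1) / (p.2 : ℂ) := by fun_prop
  exact this.stronglyMeasurable.integral_prod_right

lemma integral_norm_dilation (h : ℝ → ℂ) {c : ℝ} (hc : 0 < c) (l : ℝ) :
    ∫ α in Ioi (0 : ℝ), ‖h (α * (c * l)) / (α : ℂ)‖ =
      ∫ α in Ioi (0 : ℝ), ‖h (α * l) / (α : ℂ)‖ := by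
  have := integral_comp_mul_left_Ioi (fun α : ℝ => ‖h (α * l) / (α : ℂ)‖) 0 hc
  rw [mul_zero, smul_eq_mul, inv_mul_eq_div, eq_div_iff hc.ne', mul_comm,
    ← integral_const_mul] at this
  rw [← this]
  refine setIntegral_congr_fun measurableSet_Ioi fun α (hα : 0 < α) => ?_
  simp only [norm_div, Complex.norm_real, Real.norm_eq_abs, abs_of_pos hα, abs_mul, abs_of_pos hc]
  rw [show α * (c * l) = c * α * l by ring]
  field_simp

/-- Invariance of dα/α under dilation makes the full integral of the norm a function of the sign of
l alone, so its values at 1 and -1 bound it. One null set serves for all ε and δ. -/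
lemma exists_dilationMultiplier_bound {h : ℝ → ℂ}
    (hi : ∀ᵐ l : ℝ, IntegrableOn (fun α : ℝ => h (α * l) / (α : ℂ)) (Ioi 0)) :
    ∃ B : ℝ, ∀ᵐ l : ℝ, ∀ ε δ : ℝ, 0 < ε → ‖dilationMultiplier h ε δ l‖ ≤ B := by
  refine ⟨max (∫ α in Ioi (0 : ℝ), ‖h (α * 1) / (α : ℂ)‖)
    (∫ α in Ioi (0 : ℝ), ‖h (α * (-1)) / (α : ℂ)‖), ?_⟩
  filter_upwards [hi, compl_mem_ae_iff.2 (measure_singleton (0 : ℝ))] with l hl hl0 ε δ hε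
  have h1 : ‖dilationMultiplier h ε δ l‖ ≤ ∫ α in Ioi (0 : ℝ), ‖h (α * l) / (α : ℂ)‖ := by
    refine (norm_integral_le_integral_norm _).trans ?_
    exact setIntegral_mono_set hl.norm (ae_of_all _ fun _ => norm_nonneg _)
      (LE.le.eventuallyLE fun x hx => hε.trans hx.1)
  refine h1.trans ?_
  rcases lt_or_gt_of_ne hl0 with h2 | h2
  · refine le_trans (le_of_eq ?_) (le_max_right _ _)
    rw [← integral_norm_dilation h (neg_pos.2 h2) (-1)]
    simp
  · refine le_trans (le_of_eq ?_) (le_max_left _ _)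
    rw [← integral_norm_dilation h h2 1]
    simp

lemma tendsto_dilationMultiplier {h : ℝ → ℂ} {l : ℝ}
    (hi : IntegrableOn (fun α : ℝ => h (α * l) / (α : ℂ)) (Ioi 0)) :
    Tendsto (fun p : ℝ × ℝ => dilationMultiplier h p.1 p.2 l) (𝓝[>] 0 ×ˢ atTop)
      (𝓝 (∫ α in Ioi (0 : ℝ), h (α * l) / (α : ℂ))) := by
  have e : ∀ᶠ p : ℝ × ℝ in 𝓝[>] 0 ×ˢ atTop,
      ∫ α in Ioi (0 : ℝ), (Ioo p.1 p.2).indicator (fun α => h (α * l) / (α : ℂ)) α =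
        dilationMultiplier h p.1 p.2 l := by
    have : ∀ᶠ p : ℝ × ℝ in 𝓝[>] (0 : ℝ) ×ˢ (atTop : Filter ℝ), 0 < p.1 :=
      tendsto_fst.eventually self_mem_nhdsWithin
    filter_upwards [this] with p hp
    rw [integral_indicator measurableSet_Ioo, Measure.restrict_restrict measurableSet_Ioo,
      inter_eq_left.2 (Ioo_subset_Ioi_self.trans (Ioi_subset_Ioi hp.le)), dilationMultiplier]
  refine Tendsto.congr' e ?_
  refine tendsto_integral_filter_of_dominated_convergence
    (fun α => ‖h (α * l) / (α : ℂ)‖) (Eventually.of_forall fun p =>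
      hi.1.indicator measurableSet_Ioo) (Eventually.of_forall fun p => ae_of_all _ fun α =>
      norm_indicator_le_norm_self _ _) hi.norm ?_
  filter_upwards [ae_restrict_mem measurableSet_Ioi] with α hα
  refine tendsto_const_nhds.congr' ?_
  have h1 : ∀ᶠ p : ℝ × ℝ in 𝓝[>] (0 : ℝ) ×ˢ (atTop : Filter ℝ), p.1 < α :=
    tendsto_fst.eventually (nhdsWithin_le_nhds (gt_mem_nhds hα))
  have h2 : ∀ᶠ p : ℝ × ℝ in 𝓝[>] (0 : ℝ) ×ˢ (atTop : Filter ℝ), α < p.2 :=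
    tendsto_snd.eventually (eventually_gt_atTop α)
  filter_upwards [h1, h2] with p hp1 hp2
  rw [indicator_of_mem]
  exact ⟨hp1, hp2⟩

/-! ### Boundedness -/

/-- At bl the canonical transform differs from the Dunkl transform at l by a factor of constant
modulus. The bound will keep products with dilates of this function in L². -/
lemma exists_bound_of_lcdt {k : ℝ} (hk : -1 / 2 ≤ k)
    {M : Matrix.SpecialLinearGroup (Fin 2) ℝ} (hb : M 0 1 ≠ 0) {ψ : ℝ → ℂ}
    (hψ : MemLp ψ 2 (muK k)) (h : MemLp (lcdt k M ψ) ⊤ (muK k)) :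
    ∃ B : ℝ, 0 ≤ B ∧ ∀ᵐ l ∂muK k,
      ‖dunklU hk ((memLp_chirp_mul hψ (M 0 0 / M 0 1)).toLp _) l‖ ≤ B := by
  have hib := ibPow_ne_zero k hb
  refine ⟨‖ibPow k (M 0 1)‖ * (eLpNorm (lcdt k M ψ) ⊤ (muK k)).toReal, by positivity, ?_⟩
  have h1 : ∀ᵐ l ∂muK k, ‖lcdt k M ψ l‖ ≤ (eLpNorm (lcdt k M ψ) ⊤ (muK k)).toReal := by
    filter_upwards [ae_le_eLpNormEssSup (f := lcdt k M ψ) (μ := muK k)] with l hl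
    rw [← eLpNorm_exponent_top] at hl
    rw [← toReal_enorm]
    exact ENNReal.toReal_mono h.2.ne hl
  filter_upwards [(quasiMeasurePreserving_mul (k := k) hb).ae h1,
    (quasiMeasurePreserving_mul (k := k) hb).ae (lcdt_ae_eq hk M hb hψ)] with l h2 h3
  rw [h3, norm_mul, norm_mul, norm_chirp, mul_one, inv_mul_cancel_left₀ hb, norm_div, norm_one,
    one_div, inv_mul_le_iff₀ (norm_pos_iff.2 hib)] at h2
  exact h2

lemma integral_norm_mul_le {μ : Measure ℝ} {u v : ℝ → ℂ} (hu : MemLp u 2 μ) (hv : MemLp v 2 μ) :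
    ∫ x, ‖u x * v x‖ ∂μ ≤ (eLpNorm u 2 μ).toReal * (eLpNorm v 2 μ).toReal := by
  have h := eLpNorm_smul_le_mul_eLpNorm (p := 2) (q := 2) (r := 1) hv.1 hu.1
  rw [← ENNReal.toReal_mul]
  refine (integral_norm_eq_lintegral_enorm (hu.1.mul hv.1)).trans_le ?_
  rw [← eLpNorm_one_eq_lintegral_enorm]
  exact ENNReal.toReal_mono (ENNReal.mul_ne_top hu.2.ne hv.2.ne) h

lemma memLp_bdd_mul {μ : Measure ℝ} {u v : ℝ → ℂ} {B : ℝ} (hu : MemLp u 2 μ)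
    (hv : AEStronglyMeasurable v μ) (hB : ∀ᵐ x ∂μ, ‖v x‖ ≤ B) :
    MemLp (fun x => u x * v x) 2 μ := by
  refine hu.of_le_mul (c := B) (hu.1.mul hv) ?_
  filter_upwards [hB] with x hx
  rw [norm_mul, mul_comm]
  gcongr

/-- The dual form of the inversion formula. -/
lemma conj_dunklU_symm {k : ℝ} (hk : -1 / 2 ≤ k) {w : ℝ → ℂ} (hw : MemLp w 2 (muK k)) :
    (fun x => conj ((dunklU hk).symm (hw.toLp w) x)) =ᵐ[muK k] dunklU hk (hw.star.toLp _) := by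
  have hm : MemLp (fun x => conj ((dunklU hk).symm (hw.toLp w) x)) 2 (muK k) :=
    (Lp.memLp ((dunklU hk).symm (hw.toLp w))).star
  refine ae_eq_of_integral_gaussGen hk
    (fun o t ht => integrable_mul_of_memLp hm (memLp_gaussGen hk ht o))
    (fun o t ht => integrable_mul_of_memLp (Lp.memLp _) (memLp_gaussGen hk ht o)) fun o t ht => ?_
  rw [integral_dunklU_mul_gaussGen hk _ (o, ⟨t, ht⟩)]
  have e : ∀ x, conj ((dunklU hk).symm (hw.toLp w) x) * gaussGen o t x =
      conj ((dunklU hk).symm (hw.toLp w) x * gaussGen o t x) := by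
    intro x; rw [map_mul, conj_gaussGen]
  simp only [e]
  rw [integral_conj, integral_dunklU_symm_mul_gaussGen hk _ (o, ⟨t, ht⟩), ← integral_conj]
  refine integral_congr_ae ?_
  filter_upwards [hw.coeFn_toLp, hw.star.coeFn_toLp] with x h1 h2
  have h4 : dunklFinv k (gaussGen o t) x = conj (dunklF k (gaussGen o t) x) := by
    rw [← dunklFinv_conj]; simp only [conj_gaussGen]
  rw [h1, h2, map_mul, h4, Complex.conj_conj]
  rfl

/-- Plancherel in bilinear form, needed because the reconstruction integrand carries no conjugate:
the conjugate of an inverse transform is the transform of the conjugate. -/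
lemma integral_dunklU_mul_dunklU_symm {k : ℝ} (hk : -1 / 2 ≤ k) {h w : ℝ → ℂ}
    (hh : MemLp h 2 (muK k)) (hw : MemLp w 2 (muK k)) :
    ∫ x, dunklU hk (hh.toLp h) x * (dunklU hk).symm (hw.toLp w) x ∂muK k =
      ∫ x, h x * w x ∂muK k := by
  have h1 := integral_dunklU_mul_conj hk (hh.toLp h) (hw.star.toLp _)
  have e1 : ∫ x, dunklU hk (hh.toLp h) x * (dunklU hk).symm (hw.toLp w) x ∂muK k =
      ∫ x, dunklU hk (hh.toLp h) x * conj (dunklU hk (hw.star.toLp _) x) ∂muK k := by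
    refine integral_congr_ae ?_
    filter_upwards [conj_dunklU_symm hk hw] with x hx
    rw [← hx, Complex.conj_conj]
  rw [e1, h1]
  refine integral_congr_ae ?_
  filter_upwards [hh.coeFn_toLp, hw.star.coeFn_toLp] with x h1 h2
  rw [h1, h2]
  simp

/-! ### Dilated and translated wavelets -/

/-- The `L¹`-normalized dilation `α^{-(2k+2)} f(x/α)`. -/
def dilate (k α : ℝ) (f : ℝ → ℂ) (x : ℝ) : ℂ := ((1 / α ^ (2 * k + 2) : ℝ) : ℂ) * f (x / α)

lemma memLp_dilate {k α : ℝ} (hα : 0 < α) {f : ℝ → ℂ} (hf : MemLp f 2 (muK k)) :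
    MemLp (dilate k α f) 2 (muK k) := by
  have := (memLp_comp_mul_muK (inv_ne_zero hα.ne') hf).const_mul ((1 / α ^ (2 * k + 2) : ℝ) : ℂ)
  simp only [← div_eq_inv_mul] at this
  exact this

/-- Lets the translate occurring in the reconstruction be read as a function of β with y fixed, so
that Plancherel can be used in β. -/
lemma dunklTranslation_comm (k x : ℝ) (f : ℝ → ℂ) (y : ℝ) :
    dunklTranslation k x f y = dunklTranslation k y f x := by
  simp only [dunklTranslation, or_comm (a := x = 0), add_comm x y, dunklW_comm k x y]

/-- The parameter (a/b)(1 - 1/α²) is such that this chirp times the one inside the canonical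
translation is the chirp of parameter a/b at z/α. The canonical dilation thus becomes a plain
dilation of the chirped wavelet. -/
lemma lcWavelet_eq (k : ℝ) (M : Matrix.SpecialLinearGroup (Fin 2) ℝ) (ψ : ℝ → ℂ)
    (α β y : ℝ) :
    lcWavelet k M ψ α β y = ((α ^ (k + 1) : ℝ) : ℂ) *
      (chirp (-(M 0 0 / M 0 1)) β * chirp (-(M 0 0 / M 0 1)) y *
        dunklTranslation k β (dilate k α fun z => chirp (M 0 0 / M 0 1) z * ψ z) y) := by
  rw [lcWavelet, lcTranslation]
  congr 4
  ext z
  rw [lcDilation, dilate]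
  have h : chirp (M 0 0 / M 0 1) z * chirp (-(M 0 0 / M 0 1 * (1 - 1 / α ^ 2))) z =
      chirp (M 0 0 / M 0 1) (z / α) := by
    rw [chirp_mul_chirp, chirp, chirp]
    congr 3
    ring
  rw [← h]; ring

lemma dunklTranslation_dilate_ae_eq {k α : ℝ} (hk : -1 / 2 ≤ k) (hα : 0 < α) {f : ℝ → ℂ}
    (hf : MemLp f 2 (muK k)) (x : ℝ) :
    dunklTranslation k x (dilate k α f) =ᵐ[muK k] (dunklU hk).symm ((memLp_char_mul hk
      (memLp_comp_mul_muK hα.ne' (Lp.memLp (dunklU hk (hf.toLp f)))) x).toLp _) := by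
  have h := dunklTranslation_ae_eq hk x (memLp_dilate hα hf)
  have e : (memLp_char_mul hk (Lp.memLp (dunklU hk ((memLp_dilate hα hf).toLp _))) x).toLp _ =
      (memLp_char_mul hk (memLp_comp_mul_muK hα.ne' (Lp.memLp (dunklU hk (hf.toLp f)))) x).toLp
        _ := by
    rw [MemLp.toLp_eq_toLp_iff]
    filter_upwards [dunklU_dilation hk hα hf (memLp_dilate hα hf) fun _ => rfl] with l hl
    rw [hl]
  rwa [e] at h

/-- Plancherel turns the translate into the character and the dilate into l ↦ αl. By symmetry of the
kernel the result is a Dunkl transform in β. -/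
lemma integral_mul_conj_dunklTranslation {k α : ℝ} (hk : -1 / 2 ≤ k) (hα : 0 < α) {f G : ℝ → ℂ}
    (hf : MemLp f 2 (muK k)) (hG : MemLp G 2 (muK k)) (β : ℝ) :
    ∫ y, G y * conj (dunklTranslation k β (dilate k α f) y) ∂muK k =
      dunklF k (fun l => dunklU hk (hG.toLp G) l * conj (dunklU hk (hf.toLp f) (α * l))) β := by
  set w := memLp_char_mul hk
      (memLp_comp_mul_muK hα.ne' (Lp.memLp (dunklU hk (hf.toLp f)))) β with hw
  have h := integral_dunklU_mul_conj hk (hG.toLp G) ((dunklU hk).symm (w.toLp _))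
  rw [LinearIsometryEquiv.apply_symm_apply] at h
  have e1 : ∫ y, G y * conj (dunklTranslation k β (dilate k α f) y) ∂muK k =
      ∫ y, hG.toLp G y * conj ((dunklU hk).symm (w.toLp _) y) ∂muK k := by
    refine integral_congr_ae ?_
    filter_upwards [hG.coeFn_toLp, dunklTranslation_dilate_ae_eq hk hα hf β] with y h1 h2
    rw [h1, h2]
  rw [e1, ← h, dunklF]
  refine integral_congr_ae ?_
  filter_upwards [w.coeFn_toLp] with l hl
  rw [hl, map_mul, Complex.conj_conj, dunklChar_comm k β l]
  ring

lemma lcWaveletTransform_eq {k α : ℝ} (hk : -1 / 2 ≤ k) (M : Matrix.SpecialLinearGroup (Fin 2) ℝ)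
    (hα : 0 < α) {ψ f : ℝ → ℂ} (hψ : MemLp ψ 2 (muK k)) (hf : MemLp f 2 (muK k)) (β : ℝ) :
    lcWaveletTransform k M ψ f α β = 1 / ibPow k (M 0 1) * (((α ^ (k + 1) : ℝ) : ℂ) *
      chirp (M 0 0 / M 0 1) β * dunklF k (fun l =>
        dunklU hk ((memLp_chirp_mul hf (M 0 0 / M 0 1)).toLp _) l *
        conj (dunklU hk ((memLp_chirp_mul hψ (M 0 0 / M 0 1)).toLp _) (α * l))) β) := by
  rw [← integral_mul_conj_dunklTranslation hk hα, lcWaveletTransform,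
    ← integral_const_mul (((α ^ (k + 1) : ℝ) : ℂ) * chirp (M 0 0 / M 0 1) β)]
  congr 1
  refine integral_congr_ae (ae_of_all _ fun y => ?_)
  simp only [lcWavelet_eq k M ψ, map_mul, Complex.conj_ofReal, conj_chirp, neg_neg]
  ring

/-- The chirps in β coming from the two wavelets cancel, and the two normalizing powers multiply to
α^(2k+2). -/
lemma calderonIntegrand_eq {k α : ℝ} (hk : -1 / 2 ≤ k) (M : Matrix.SpecialLinearGroup (Fin 2) ℝ)
    (hα : 0 < α) {ψ f : ℝ → ℂ} (φ : ℝ → ℂ) (hψ : MemLp ψ 2 (muK k)) (hf : MemLp f 2 (muK k))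
    (y β : ℝ) :
    calderonIntegrand k M ψ φ f y (α, β) =
      1 / ibPow k (M 0 1) * chirp (-(M 0 0 / M 0 1)) y * (((α ^ (2 * k + 2) : ℝ) : ℂ) *
      (dunklF k (fun l =>
        dunklU hk ((memLp_chirp_mul hf (M 0 0 / M 0 1)).toLp _) l *
        conj (dunklU hk ((memLp_chirp_mul hψ (M 0 0 / M 0 1)).toLp _) (α * l))) β *
      dunklTranslation k y (dilate k α fun z => chirp (M 0 0 / M 0 1) z * φ z) β)) := by
  have h1 := chirp_neg_mul_chirp (M 0 0 / M 0 1) β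
  have h2 : ((α ^ (2 * k + 2) : ℝ) : ℂ) = ((α ^ (k + 1) : ℝ) : ℂ) * ((α ^ (k + 1) : ℝ) : ℂ) := by
    rw [← Complex.ofReal_mul, ← Real.rpow_add hα]; congr 2; ring
  rw [calderonIntegrand, lcWaveletTransform_eq hk M hα hψ hf, lcWavelet_eq k M φ, h2,
    dunklTranslation_comm k β]
  generalize dunklF k _ _ = A
  generalize dunklTranslation _ _ _ _ = T
  linear_combination (1 / ibPow k (M 0 1) * chirp (-(M 0 0 / M 0 1)) y *
    (α ^ (k + 1) : ℝ) * (α ^ (k + 1) : ℝ) * A * T) * h1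

/-! ### Bounds for fixed dilation parameter -/

lemma toReal_eLpNorm_mul_le {μ : Measure ℝ} {u v : ℝ → ℂ} {B : ℝ} (h0 : 0 ≤ B)
    (hu : MemLp u 2 μ) (hB : ∀ᵐ x ∂μ, ‖v x‖ ≤ B) :
    (eLpNorm (fun x => u x * v x) 2 μ).toReal ≤ B * (eLpNorm u 2 μ).toReal := by
  have h : eLpNorm (fun x => u x * v x) 2 μ ≤ ENNReal.ofReal B * eLpNorm u 2 μ := by
    refine eLpNorm_le_mul_eLpNorm_of_ae_le_mul ?_ 2
    filter_upwards [hB] with x hx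
    rw [norm_mul, mul_comm]
    gcongr
  have := ENNReal.toReal_mono (ENNReal.mul_ne_top (by simp) hu.2.ne) h
  rwa [ENNReal.toReal_mul, ENNReal.toReal_ofReal h0] at this

lemma toReal_eLpNorm_comp_mul_le {k ε α : ℝ} (hk : -1 / 2 ≤ k) (hε : 0 < ε) (hα : ε < α)
    (u : ℝ → ℂ) :
    (eLpNorm (fun l => u (α * l)) 2 (muK k)).toReal ≤
      (ε ^ (-(2 * k + 2))) ^ (1 / 2 : ℝ) * (eLpNorm u 2 (muK k)).toReal := by
  have hα0 := hε.trans hα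
  rw [eLpNorm_comp_mul_muK hα0.ne', ENNReal.toReal_mul, ← ENNReal.toReal_rpow, abs_of_pos hα0,
    ENNReal.toReal_ofReal (by positivity)]
  gcongr ?_ ^ (1 / 2 : ℝ) * _
  exact Real.rpow_le_rpow_of_nonpos hε hα.le (by linarith)

/-- The constant bounding the integrals over `β` for `α > ε`. -/
def sliceBound (k ε B : ℝ) (g Q : ℝ → ℂ) : ℝ :=
  B * (eLpNorm g 2 (muK k)).toReal *
    ((ε ^ (-(2 * k + 2))) ^ (1 / 2 : ℝ) * (eLpNorm Q 2 (muK k)).toReal)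

lemma ae_bound_comp_mul {k α B : ℝ} (hα : 0 < α) {P : ℝ → ℂ} (hB : ∀ᵐ l ∂muK k, ‖P l‖ ≤ B) :
    ∀ᵐ l ∂muK k, ‖conj (P (α * l))‖ ≤ B := by
  filter_upwards [(quasiMeasurePreserving_mul (k := k) hα.ne').ae hB] with l hl
  rwa [RCLike.norm_conj]

lemma memLp_slice {k α B : ℝ} (hα : 0 < α) {g P : ℝ → ℂ}
    (hg : MemLp g 2 (muK k)) (hP : MemLp P 2 (muK k)) (hB : ∀ᵐ l ∂muK k, ‖P l‖ ≤ B) :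
    MemLp (fun l => g l * conj (P (α * l))) 2 (muK k) :=
  memLp_bdd_mul hg (memLp_comp_mul_muK hα.ne' hP).star.1 (ae_bound_comp_mul hα hB)

lemma integral_norm_slice_le {k ε α B : ℝ} (hk : -1 / 2 ≤ k) (hε : 0 < ε) (hα : ε < α)
    (h0 : 0 ≤ B) {g P Q : ℝ → ℂ} (hg : MemLp g 2 (muK k)) (hP : MemLp P 2 (muK k))
    (hQ : MemLp Q 2 (muK k)) (hB : ∀ᵐ l ∂muK k, ‖P l‖ ≤ B) :
    ∫ l, ‖g l * conj (P (α * l)) * Q (α * l)‖ ∂muK k ≤ sliceBound k ε B g Q := by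
  have hα0 := hε.trans hα
  refine (integral_norm_mul_le (memLp_slice hα0 hg hP hB) (memLp_comp_mul_muK hα0.ne' hQ)).trans ?_
  exact mul_le_mul (toReal_eLpNorm_mul_le h0 hg (ae_bound_comp_mul hα0 hB))
    (toReal_eLpNorm_comp_mul_le hk hε hα Q) ENNReal.toReal_nonneg (by positivity)

/-- The integral over `β` for fixed `α`. -/
lemma slice_translation {k ε α B : ℝ} (hk : -1 / 2 ≤ k) (hε : 0 < ε) (hα : ε < α)
    (h0 : 0 ≤ B) {g P Θ : ℝ → ℂ} (hg : MemLp g 2 (muK k)) (hP : MemLp P 2 (muK k))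
    (hΘ : MemLp Θ 2 (muK k)) (hB : ∀ᵐ l ∂muK k, ‖P l‖ ≤ B) (y : ℝ) :
    Integrable (fun β => dunklF k (fun l => g l * conj (P (α * l))) β *
      dunklTranslation k y (dilate k α Θ) β) (muK k) ∧
    ∫ β, ‖dunklF k (fun l => g l * conj (P (α * l))) β *
      dunklTranslation k y (dilate k α Θ) β‖ ∂muK k ≤
        sliceBound k ε B g (dunklU hk (hΘ.toLp Θ)) ∧
    ∫ β, dunklF k (fun l => g l * conj (P (α * l))) β *
      dunklTranslation k y (dilate k α Θ) β ∂muK k =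
        dunklFinv k (fun l => g l * conj (P (α * l)) * dunklU hk (hΘ.toLp Θ) (α * l)) y := by
  have hα0 := hε.trans hα
  have hQ : MemLp (dunklU hk (hΘ.toLp Θ)) 2 (muK k) := Lp.memLp _
  have hQα := memLp_comp_mul_muK hα0.ne' hQ
  -- Boundedness of P enters here: the product stays in L², so its Dunkl transform is square
  -- integrable in β.
  have hH := memLp_slice hα0 hg hP hB
  have hH1 : Integrable (fun l => g l * conj (P (α * l))) (muK k) :=
    integrable_mul_of_memLp hg (memLp_comp_mul_muK hα0.ne' hP).star
  have hw := memLp_char_mul hk hQα y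
  have e1 := dunklU_toLp hk hH1 hH
  have e2 : dunklTranslation k y (dilate k α Θ) =ᵐ[muK k] (dunklU hk).symm (hw.toLp _) :=
    dunklTranslation_dilate_ae_eq hk hα0 hΘ y
  have m1 : MemLp (dunklF k fun l => g l * conj (P (α * l))) 2 (muK k) :=
    (memLp_congr_ae e1).1 (Lp.memLp _)
  have m2 : MemLp (dunklTranslation k y (dilate k α Θ)) 2 (muK k) :=
    (memLp_congr_ae e2).2 (Lp.memLp _)
  have n1 : eLpNorm (dunklF k fun l => g l * conj (P (α * l))) 2 (muK k) =
      eLpNorm (fun l => g l * conj (P (α * l))) 2 (muK k) := by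
    rw [← eLpNorm_congr_ae e1, eLpNorm_dunklU, eLpNorm_congr_ae hH.coeFn_toLp]
  have n2 : eLpNorm (dunklTranslation k y (dilate k α Θ)) 2 (muK k) ≤
      eLpNorm (fun l => dunklU hk (hΘ.toLp Θ) (α * l)) 2 (muK k) := by
    rw [eLpNorm_congr_ae e2, ← eLpNorm_dunklU hk, LinearIsometryEquiv.apply_symm_apply,
      eLpNorm_congr_ae hw.coeFn_toLp]
    refine eLpNorm_mono fun l => ?_
    rw [norm_mul, RCLike.norm_conj]
    exact mul_le_of_le_one_left (norm_nonneg _) (norm_dunklChar_le hk l y)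
  refine ⟨integrable_mul_of_memLp m1 m2, (integral_norm_mul_le m1 m2).trans ?_, ?_⟩
  · rw [n1]
    refine mul_le_mul (toReal_eLpNorm_mul_le h0 hg (ae_bound_comp_mul hα0 hB))
      ((ENNReal.toReal_mono hQα.2.ne n2).trans (toReal_eLpNorm_comp_mul_le hk hε hα _))
      ENNReal.toReal_nonneg (by positivity)
  · have h := integral_dunklU_mul_dunklU_symm hk hH hw
    have e3 : ∫ β, dunklF k (fun l => g l * conj (P (α * l))) β *
        dunklTranslation k y (dilate k α Θ) β ∂muK k =
        ∫ β, dunklU hk (hH.toLp _) β * (dunklU hk).symm (hw.toLp _) β ∂muK k := by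
      refine integral_congr_ae ?_
      filter_upwards [e1, e2] with β h1 h2
      rw [h1, h2]
    rw [e3, h, dunklFinv]
    refine integral_congr_ae (ae_of_all _ fun l => ?_)
    simp only []
    ring

/-! ### Integration over the dilation parameter -/

/-- The measure `dα / α^{2k+3}` on `(ε, δ)`. -/
def scaleMeasure (k ε δ : ℝ) : Measure ℝ :=
  (volume.restrict (Ioo ε δ)).withDensity fun α => ENNReal.ofReal (1 / α ^ (2 * k + 3))

lemma nuK_restrict {k ε δ : ℝ} (hε : 0 < ε) :
    (nuK k).restrict (Ioo ε δ ×ˢ univ) = (scaleMeasure k ε δ).prod (muK k) := by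
  have h : (volume.restrict (Ioi (0 : ℝ))).restrict (Ioo ε δ) = volume.restrict (Ioo ε δ) := by
    rw [Measure.restrict_restrict measurableSet_Ioo,
      inter_eq_left.2 (Ioo_subset_Ioi_self.trans (Ioi_subset_Ioi hε.le))]
  rw [nuK, ← Measure.prod_restrict, Measure.restrict_univ,
    restrict_withDensity measurableSet_Ioo, h, scaleMeasure]

lemma ae_scaleMeasure (k ε δ : ℝ) : ∀ᵐ α ∂scaleMeasure k ε δ, α ∈ Ioo ε δ :=
  (withDensity_absolutelyContinuous _ _).ae_le (ae_restrict_mem measurableSet_Ioo)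

lemma isFiniteMeasure_scaleMeasure {k ε δ : ℝ} (hk : -1 / 2 ≤ k) (hε : 0 < ε) :
    IsFiniteMeasure (scaleMeasure k ε δ) := by
  refine isFiniteMeasure_withDensity_ofReal (Integrable.of_bound (C := 1 / ε ^ (2 * k + 3))
    (Measurable.aestronglyMeasurable (by fun_prop)) ?_).2
  filter_upwards [ae_restrict_mem measurableSet_Ioo] with α hα
  have hα0 := hε.trans hα.1
  rw [Real.norm_of_nonneg (by positivity)]
  gcongr
  · linarith
  · exact hα.1.le

lemma integral_scaleMeasure {k ε δ : ℝ} (hε : 0 < ε) (u : ℝ → ℂ) :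
    ∫ α, ((α ^ (2 * k + 2) : ℝ) : ℂ) * u α ∂scaleMeasure k ε δ =
      ∫ α in Ioo ε δ, u α / (α : ℂ) := by
  rw [scaleMeasure, integral_withDensity_eq_integral_toReal_smul (by fun_prop) (by simp)]
  refine setIntegral_congr_fun measurableSet_Ioo fun α hα => ?_
  have hα0 := hε.trans hα.1
  have h1 : α ^ (2 * k + 3) = α ^ (2 * k + 2) * α := by
    rw [← Real.rpow_add_one hα0.ne']; congr 1; ring
  have h2 : α ^ (2 * k + 2) ≠ 0 := (Real.rpow_pos_of_pos hα0 _).ne'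
  have h3 : 1 / α ^ (2 * k + 3) * α ^ (2 * k + 2) = 1 / α := by
    rw [h1]
    generalize α ^ (2 * k + 2) = A at h2
    field_simp
  rw [ENNReal.toReal_ofReal (by positivity), Complex.real_smul, ← mul_assoc,
    ← Complex.ofReal_mul, h3]
  push_cast
  ring

lemma integrable_prod_of_bound {m : Measure ℝ} {μ : Measure ℝ} [IsFiniteMeasure m] [SFinite μ]
    {F : ℝ × ℝ → ℂ} {D : ℝ} (hF : AEStronglyMeasurable F (m.prod μ))
    (h1 : ∀ᵐ α ∂m, Integrable (fun β => F (α, β)) μ)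
    (h2 : ∀ᵐ α ∂m, ∫ β, ‖F (α, β)‖ ∂μ ≤ D) : Integrable F (m.prod μ) := by
  rw [integrable_prod_iff hF]
  refine ⟨h1, Integrable.of_bound hF.norm.integral_prod_right' D ?_⟩
  filter_upwards [h2] with α hα
  rwa [Real.norm_of_nonneg (integral_nonneg fun _ => norm_nonneg _)]

/-! ### Joint measurability -/

lemma stronglyMeasurable_dunklF_slice {k : ℝ} (hk : -1 / 2 ≤ k) {g P : ℝ → ℂ} (hg : Measurable g)
    (hP : Measurable P) :
    StronglyMeasurable fun p : ℝ × ℝ => dunklF k (fun l => g l * conj (P (p.1 * l))) p.2 := by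
  have := measurable_dunklExp hk
  have h : Measurable fun q : (ℝ × ℝ) × ℝ =>
      g q.2 * conj (P (q.1.1 * q.2)) * dunklChar k q.1.2 q.2 := by
    unfold dunklChar
    have h1 : Measurable fun q : (ℝ × ℝ) × ℝ => conj (P (q.1.1 * q.2)) :=
      Complex.continuous_conj.measurable.comp (hP.comp (by fun_prop))
    fun_prop
  exact h.stronglyMeasurable.integral_prod_right

/-- Replace f by a Borel representative. In the point-mass case the exceptional set must stay null
under (α, β) ↦ (y + β)/α, which follows from Fubini on a measurable hull; in the other case the
change is invisible under the integral. -/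
lemma aestronglyMeasurable_dunklTranslation_dilate {k : ℝ} (hk : -1 / 2 ≤ k) {m : Measure ℝ}
    [SFinite m] (hm : ∀ᵐ α ∂m, 0 < α) {f : ℝ → ℂ} (hf : MemLp f 2 (muK k)) (y : ℝ) :
    AEStronglyMeasurable (fun p : ℝ × ℝ => dunklTranslation k y (dilate k p.1 f) p.2)
      (m.prod (muK k)) := by
  obtain ⟨f', hf', hff'⟩ := hf.1
  have hf'm : Measurable f' := hf'.measurable
  have hm1 : ∀ᵐ p ∂m.prod (muK k), 0 < p.1 := Measure.quasiMeasurePreserving_fst.ae hm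
  by_cases hc : k = -1 / 2 ∨ y = 0
  · have h1 : Measurable fun p : ℝ × ℝ => dilate k p.1 f' (y + p.2) := by
      unfold dilate; fun_prop
    refine h1.aestronglyMeasurable.congr ?_
    set N := toMeasurable volume {x | f x = f' x}ᶜ
    have hN : volume N = 0 := by
      rw [measure_toMeasurable]
      exact (ae_muK_iff hk).1 hff'
    have hNm : MeasurableSet N := measurableSet_toMeasurable _ _
    have h2 : ∀ᵐ p ∂m.prod (muK k), (y + p.2) / p.1 ∉ N := by
      have hms : MeasurableSet {p : ℝ × ℝ | (y + p.2) / p.1 ∉ N} := by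
        have : Measurable fun p : ℝ × ℝ => (y + p.2) / p.1 := by fun_prop
        exact (this hNm).compl
      rw [Measure.ae_prod_iff_ae_ae hms]
      filter_upwards [hm] with α hα
      rw [ae_muK_iff hk]
      have hN' : ∀ᵐ x : ℝ, x ∉ N := compl_mem_ae_iff.2 hN
      have h3 := (measurePreserving_add_left volume y).quasiMeasurePreserving.ae
        ((quasiMeasurePreserving_mul_volume (inv_ne_zero hα.ne')).ae hN')
      simpa only [div_eq_inv_mul] using h3
    filter_upwards [h2] with p hp
    have h4 : f ((y + p.2) / p.1) = f' ((y + p.2) / p.1) := by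
      by_contra hne
      exact hp (subset_toMeasurable _ _ hne)
    rw [dunklTranslation, if_pos (by tauto), dilate, dilate, h4]
  · have h1 : StronglyMeasurable fun p : ℝ × ℝ =>
        ∫ z, dilate k p.1 f' z * (dunklW k y p.2 z : ℂ) ∂muK k := by
      have hW : Measurable fun q : (ℝ × ℝ) × ℝ => dunklW k y q.1.2 q.2 :=
        (measurable_dunklW k).comp (measurable_const.prodMk
          ((measurable_snd.comp measurable_fst).prodMk measurable_snd))
      have : Measurable fun q : (ℝ × ℝ) × ℝ =>
          dilate k q.1.1 f' q.2 * (dunklW k y q.1.2 q.2 : ℂ) := by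
        unfold dilate; fun_prop
      exact this.stronglyMeasurable.integral_prod_right
    refine h1.aestronglyMeasurable.congr ?_
    filter_upwards [hm1, Measure.quasiMeasurePreserving_snd.ae (ae_ne_zero_muK (k := k))]
      with p hp1 hp2
    rw [dunklTranslation, if_neg (by tauto)]
    refine integral_congr_ae ?_
    filter_upwards [(quasiMeasurePreserving_mul (k := k) (inv_ne_zero hp1.ne')).ae hff'] with z hz
    rw [dilate, dilate, div_eq_inv_mul z p.1, hz]

/-! ### The truncated reconstruction as a multiplier -/

/-- The scale measure is finite on (ε, δ), and the integrals over β of the norm are bounded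
uniformly in α by the slice estimate. -/
lemma integrable_translation_prod {k ε δ B : ℝ} (hk : -1 / 2 ≤ k) (hε : 0 < ε)
    (h0 : 0 ≤ B) {g P Θ : ℝ → ℂ} (hgm : Measurable g) (hPm : Measurable P)
    (hg : MemLp g 2 (muK k)) (hP : MemLp P 2 (muK k))
    (hΘ : MemLp Θ 2 (muK k)) (hB : ∀ᵐ l ∂muK k, ‖P l‖ ≤ B) (y : ℝ) :
    Integrable (fun p : ℝ × ℝ => ((p.1 ^ (2 * k + 2) : ℝ) : ℂ) *
      (dunklF k (fun l => g l * conj (P (p.1 * l))) p.2 *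
        dunklTranslation k y (dilate k p.1 Θ) p.2)) ((scaleMeasure k ε δ).prod (muK k)) := by
  have := isFiniteMeasure_scaleMeasure (δ := δ) hk hε
  have hm : ∀ᵐ α ∂scaleMeasure k ε δ, 0 < α := by
    filter_upwards [ae_scaleMeasure k ε δ] with α hα using hε.trans hα.1
  refine integrable_prod_of_bound (D := δ ^ (2 * k + 2) *
    sliceBound k ε B g (dunklU hk (hΘ.toLp Θ))) ?_ ?_ ?_
  · have h1 : Measurable fun p : ℝ × ℝ => ((p.1 ^ (2 * k + 2) : ℝ) : ℂ) := by fun_prop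
    exact h1.aestronglyMeasurable.mul
      ((stronglyMeasurable_dunklF_slice hk hgm hPm).aestronglyMeasurable.mul
        (aestronglyMeasurable_dunklTranslation_dilate hk hm hΘ y))
  · filter_upwards [ae_scaleMeasure k ε δ] with α hα
    exact (slice_translation hk hε hα.1 h0 hg hP hΘ hB y).1.const_mul _
  · filter_upwards [ae_scaleMeasure k ε δ] with α hα
    have hα0 := hε.trans hα.1
    simp only [norm_mul (((α ^ (2 * k + 2) : ℝ) : ℂ)), Complex.norm_real,
      Real.norm_of_nonneg (Real.rpow_nonneg hα0.le (2 * k + 2))]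
    rw [integral_const_mul]
    refine mul_le_mul ?_ (slice_translation hk hε hα.1 h0 hg hP hΘ hB y).2.1
      (integral_nonneg fun _ => norm_nonneg _) (by have := hα0.trans hα.2; positivity)
    exact Real.rpow_le_rpow hα0.le hα.2.le (by linarith)

lemma integrable_multiplier_prod {k ε δ B : ℝ} (hk : -1 / 2 ≤ k) (hε : 0 < ε)
    (h0 : 0 ≤ B) {g P Q : ℝ → ℂ} (hgm : Measurable g) (hPm : Measurable P) (hQm : Measurable Q)
    (hg : MemLp g 2 (muK k)) (hP : MemLp P 2 (muK k))
    (hQ : MemLp Q 2 (muK k)) (hB : ∀ᵐ l ∂muK k, ‖P l‖ ≤ B) (y : ℝ) :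
    Integrable (fun p : ℝ × ℝ => g p.2 * conj (P (p.1 * p.2)) * Q (p.1 * p.2) *
      conj (dunklChar k p.2 y) / (p.1 : ℂ)) ((volume.restrict (Ioo ε δ)).prod (muK k)) := by
  have hc := measurable_dunklChar_left hk y
  refine integrable_prod_of_bound (D := sliceBound k ε B g Q / ε) ?_ ?_ ?_
  · have h1 : Measurable fun p : ℝ × ℝ => conj (P (p.1 * p.2)) :=
      Complex.continuous_conj.measurable.comp (hPm.comp (by fun_prop))
    have h2 : Measurable fun p : ℝ × ℝ => conj (dunklChar k p.2 y) :=
      Complex.continuous_conj.measurable.comp (hc.comp measurable_snd)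
    have : Measurable fun p : ℝ × ℝ => g p.2 * conj (P (p.1 * p.2)) * Q (p.1 * p.2) *
      conj (dunklChar k p.2 y) / (p.1 : ℂ) := by fun_prop
    exact this.aestronglyMeasurable
  · filter_upwards [ae_restrict_mem measurableSet_Ioo] with α hα
    have hα0 := hε.trans hα.1
    have h1 := integrable_mul_of_memLp (memLp_slice hα0 hg hP hB)
      (memLp_char_mul hk (memLp_comp_mul_muK hα0.ne' hQ) y)
    refine (h1.div_const (α : ℂ)).congr (ae_of_all _ fun l => ?_)
    simp only []
    ring
  · filter_upwards [ae_restrict_mem measurableSet_Ioo] with α hα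
    have hα0 := hε.trans hα.1
    have h1 : Integrable (fun l => ‖g l * conj (P (α * l)) * Q (α * l)‖ / ε) (muK k) :=
      (integrable_mul_of_memLp (memLp_slice hα0 hg hP hB)
        (memLp_comp_mul_muK hα0.ne' hQ)).norm.div_const ε
    refine (integral_mono_of_nonneg (ae_of_all _ fun _ => norm_nonneg _) h1
      (ae_of_all _ fun l => ?_)).trans ?_
    · simp only []
      rw [norm_div, norm_mul _ (conj _), RCLike.norm_conj, Complex.norm_real,
        Real.norm_of_nonneg hα0.le]
      refine div_le_div₀ (norm_nonneg _) (mul_le_of_le_one_right (norm_nonneg _)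
        (norm_dunklChar_le hk l y)) hε hα.1.le
    · rw [integral_div]
      gcongr
      exact integral_norm_slice_le hk hε hα.1 h0 hg hP hQ hB

lemma dunklChar_zero_right {k : ℝ} (hk : -1 / 2 ≤ k) (l : ℝ) : dunklChar k l 0 = 1 := by
  rw [dunklChar, Complex.ofReal_zero, mul_zero]
  exact dunklExp_zero hk

lemma integral_slice_char (k ε δ : ℝ) (g P Q : ℝ → ℂ) (y l : ℝ) :
    ∫ α in Ioo ε δ, g l * conj (P (α * l)) * Q (α * l) * conj (dunklChar k l y) / (α : ℂ) =
      g l * dilationMultiplier (fun x => conj (P x) * Q x) ε δ l * conj (dunklChar k l y) := by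
  rw [dilationMultiplier, mul_right_comm, ← integral_const_mul]
  congr 1; ext α; ring

lemma integrable_mul_dilationMultiplier {k ε δ B : ℝ} (hk : -1 / 2 ≤ k) (hε : 0 < ε)
    (h0 : 0 ≤ B) {g P Q : ℝ → ℂ} (hgm : Measurable g) (hPm : Measurable P) (hQm : Measurable Q)
    (hg : MemLp g 2 (muK k)) (hP : MemLp P 2 (muK k))
    (hQ : MemLp Q 2 (muK k)) (hB : ∀ᵐ l ∂muK k, ‖P l‖ ≤ B) :
    Integrable (fun l => g l * dilationMultiplier (fun x => conj (P x) * Q x) ε δ l)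
      (muK k) := by
  -- At y = 0 the character is identically 1 and only the multiplier remains.
  have h := (integrable_multiplier_prod (δ := δ) hk hε h0 hgm hPm hQm hg hP hQ hB
    0).integral_prod_right
  refine h.congr (ae_of_all _ fun l => ?_)
  simp only []
  rw [integral_slice_char, dunklChar_zero_right hk, map_one, mul_one]

/-- The truncated reconstruction is an inverse Dunkl transform. -/
lemma integral_translation_prod {k ε δ B : ℝ} (hk : -1 / 2 ≤ k) (hε : 0 < ε)
    (h0 : 0 ≤ B) {g P Θ : ℝ → ℂ} (hgm : Measurable g) (hPm : Measurable P)
    (hg : MemLp g 2 (muK k)) (hP : MemLp P 2 (muK k))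
    (hΘ : MemLp Θ 2 (muK k)) (hB : ∀ᵐ l ∂muK k, ‖P l‖ ≤ B) (y : ℝ) :
    ∫ p, ((p.1 ^ (2 * k + 2) : ℝ) : ℂ) *
      (dunklF k (fun l => g l * conj (P (p.1 * l))) p.2 *
        dunklTranslation k y (dilate k p.1 Θ) p.2) ∂((scaleMeasure k ε δ).prod (muK k)) =
      dunklFinv k (fun l => g l *
        dilationMultiplier (fun x => conj (P x) * dunklU hk (hΘ.toLp Θ) x) ε δ l) y := by
  have := isFiniteMeasure_scaleMeasure (δ := δ) hk hε
  have hQm : Measurable (dunklU hk (hΘ.toLp Θ)) := (Lp.stronglyMeasurable _).measurable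
  rw [integral_prod _ (integrable_translation_prod hk hε h0 hgm hPm hg hP hΘ hB y)]
  simp only [integral_const_mul]
  -- The weight α^(2k+2) against the density α^(-(2k+3)) leaves dα/α.
  rw [integral_scaleMeasure hε]
  have e : ∀ α ∈ Ioo ε δ, (∫ β, dunklF k (fun l => g l * conj (P (α * l))) β *
        dunklTranslation k y (dilate k α Θ) β ∂muK k) / (α : ℂ) =
      ∫ l, g l * conj (P (α * l)) * dunklU hk (hΘ.toLp Θ) (α * l) *
        conj (dunklChar k l y) / (α : ℂ) ∂muK k := by
    intro α hα
    rw [(slice_translation hk hε hα.1 h0 hg hP hΘ hB y).2.2, dunklFinv, integral_div]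
  rw [setIntegral_congr_fun measurableSet_Ioo e, integral_integral_swap
    (integrable_multiplier_prod hk hε h0 hgm hPm hQm hg hP (Lp.memLp _) hB y), dunklFinv]
  simp only [integral_slice_char]

/-! ### The reconstruction formula -/

lemma integrableOn_calderonIntegrand {k ε δ B : ℝ} (hk : -1 / 2 ≤ k)
    (M : Matrix.SpecialLinearGroup (Fin 2) ℝ) (hε : 0 < ε) (h0 : 0 ≤ B) {ψ φ f : ℝ → ℂ}
    (hψ : MemLp ψ 2 (muK k)) (hφ : MemLp φ 2 (muK k)) (hf : MemLp f 2 (muK k))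
    (hB : ∀ᵐ l ∂muK k, ‖dunklU hk ((memLp_chirp_mul hψ (M 0 0 / M 0 1)).toLp _) l‖ ≤ B) (y : ℝ) :
    IntegrableOn (calderonIntegrand k M ψ φ f y) (Ioo ε δ ×ˢ univ) (nuK k) ∧
    ∫ p in Ioo ε δ ×ˢ (univ : Set ℝ), calderonIntegrand k M ψ φ f y p ∂nuK k =
      1 / ibPow k (M 0 1) * chirp (-(M 0 0 / M 0 1)) y * dunklFinv k (fun l =>
        dunklU hk ((memLp_chirp_mul hf (M 0 0 / M 0 1)).toLp _) l * dilationMultiplier (fun x =>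
          conj (dunklU hk ((memLp_chirp_mul hψ (M 0 0 / M 0 1)).toLp _) x) *
            dunklU hk ((memLp_chirp_mul hφ (M 0 0 / M 0 1)).toLp _) x) ε δ l) y := by
  have := isFiniteMeasure_scaleMeasure (δ := δ) hk hε
  rw [IntegrableOn, nuK_restrict hε]
  have e : ∀ᵐ p ∂(scaleMeasure k ε δ).prod (muK k), calderonIntegrand k M ψ φ f y p =
      1 / ibPow k (M 0 1) * chirp (-(M 0 0 / M 0 1)) y * (((p.1 ^ (2 * k + 2) : ℝ) : ℂ) *
      (dunklF k (fun l =>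
        dunklU hk ((memLp_chirp_mul hf (M 0 0 / M 0 1)).toLp _) l *
        conj (dunklU hk ((memLp_chirp_mul hψ (M 0 0 / M 0 1)).toLp _) (p.1 * l))) p.2 *
      dunklTranslation k y (dilate k p.1 fun z => chirp (M 0 0 / M 0 1) z * φ z) p.2)) := by
    filter_upwards [Measure.quasiMeasurePreserving_fst.ae (ae_scaleMeasure k ε δ)] with p hp
    exact calderonIntegrand_eq hk M (hε.trans hp.1) φ hψ hf y p.2
  have hm : ∀ F : DunklL2 k, Measurable F := fun F => (Lp.stronglyMeasurable F).measurable
  refine ⟨(Integrable.const_mul (integrable_translation_prod hk hε h0 (hm _) (hm _) (Lp.memLp _)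
    (Lp.memLp _) (memLp_chirp_mul hφ _) hB y) _).congr (e.mono fun p hp => hp.symm), ?_⟩
  rw [integral_congr_ae e, integral_const_mul, integral_translation_prod hk hε h0 (hm _) (hm _)
    (Lp.memLp _) (Lp.memLp _) (memLp_chirp_mul hφ _) hB y]

/-- Removing the unimodular chirp and applying U turns the error into a multiplier acting on the
transform of the chirped f. Membership in L² follows from boundedness of the multiplier. -/
lemma calderonTruncation_sub {k ε B : ℝ} (hk : -1 / 2 ≤ k)
    {M : Matrix.SpecialLinearGroup (Fin 2) ℝ} (hb : M 0 1 ≠ 0) (h0 : 0 ≤ B) {ψ φ f : ℝ → ℂ}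
    {C : ℂ} (h : IsTwoWavelet k M ψ φ C) (hf : MemLp f 2 (muK k))
    (hB : ∀ᵐ l ∂muK k, ‖dunklU hk ((memLp_chirp_mul h.1 (M 0 0 / M 0 1)).toLp _) l‖ ≤ B)
    (hε : 0 < ε) (δ : ℝ) :
    MemLp (calderonTruncation k M ψ φ C f ε δ) 2 (muK k) ∧
    eLpNorm (fun y => calderonTruncation k M ψ φ C f ε δ y - f y) 2 (muK k) =
      eLpNorm (fun l => (1 / (ibPow k (-(M 0 1)) * conj C) * (1 / ibPow k (M 0 1)) *
        dilationMultiplier (fun x =>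
          conj (dunklU hk ((memLp_chirp_mul h.1 (M 0 0 / M 0 1)).toLp _) x) *
            dunklU hk ((memLp_chirp_mul h.2.1 (M 0 0 / M 0 1)).toLp _) x) ε δ l - 1) *
        dunklU hk ((memLp_chirp_mul hf (M 0 0 / M 0 1)).toLp _) l) 2 (muK k) := by
  have hadm := h.ae_dunklU hk hb rfl rfl
  have hm : ∀ F : DunklL2 k, Measurable F := fun F => (Lp.stronglyMeasurable F).measurable
  set c := 1 / (ibPow k (-(M 0 1)) * conj C) * (1 / ibPow k (M 0 1)) with hc
  set s := M 0 0 / M 0 1 with hs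
  set G := (memLp_chirp_mul hf s).toLp _ with hG
  set P := dunklU hk ((memLp_chirp_mul h.1 s).toLp _) with hP
  set Q := dunklU hk ((memLp_chirp_mul h.2.1 s).toLp _) with hQ
  set K := dilationMultiplier (fun x => conj (P x) * Q x) ε δ with hK
  obtain ⟨D, hD⟩ := exists_dilationMultiplier_bound (h := fun x => conj (P x) * Q x)
    (hadm.mono fun l hl => hl.1)
  have hKm : AEStronglyMeasurable K (muK k) :=
    (stronglyMeasurable_dilationMultiplier
      ((Complex.continuous_conj.measurable.comp (hm P)).mul (hm Q)) ε δ).aestronglyMeasurable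
  have hgK : MemLp (fun l => dunklU hk G l * K l) 2 (muK k) :=
    memLp_bdd_mul (Lp.memLp _) hKm ((ae_muK_iff hk).2 (hD.mono fun l hl => hl ε δ hε))
  have hgK1 : Integrable (fun l => dunklU hk G l * K l) (muK k) :=
    integrable_mul_dilationMultiplier hk hε h0 (hm _) (hm P) (hm Q) (Lp.memLp _) (Lp.memLp _)
      (Lp.memLp _) hB
  have e : calderonTruncation k M ψ φ C f ε δ =ᵐ[muK k]
      fun y => c * (chirp (-s) y * (dunklU hk).symm (hgK.toLp _) y) := by
    filter_upwards [dunklU_symm_toLp hk hgK1 hgK] with y hy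
    rw [hy, calderonTruncation,
      (integrableOn_calderonIntegrand hk M hε h0 h.1 h.2.1 hf hB y).2, hc]
    ring
  refine ⟨(memLp_congr_ae e).2 ((memLp_chirp_mul (Lp.memLp _) _).const_mul c), ?_⟩
  have e2 : eLpNorm (fun y => calderonTruncation k M ψ φ C f ε δ y - f y) 2 (muK k) =
      eLpNorm (c • (dunklU hk).symm (hgK.toLp _) - G) 2 (muK k) := by
    refine eLpNorm_congr_norm_ae ?_
    filter_upwards [e, Lp.coeFn_sub (c • (dunklU hk).symm (hgK.toLp _)) G,
      Lp.coeFn_smul c ((dunklU hk).symm (hgK.toLp _)), (memLp_chirp_mul hf s).coeFn_toLp]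
      with y h1 h2 h3 h4
    rw [h1, h2, Pi.sub_apply, h3, Pi.smul_apply, (show G y = _ from h4), smul_eq_mul,
      ← one_mul ‖_ - chirp s y * f y‖, ← norm_chirp (-s) y, ← norm_mul]
    congr 1
    linear_combination f y * chirp_neg_mul_chirp s y
  rw [e2, ← eLpNorm_dunklU hk]
  refine eLpNorm_congr_ae ?_
  rw [map_sub, map_smul, LinearIsometryEquiv.apply_symm_apply]
  filter_upwards [Lp.coeFn_sub (c • hgK.toLp _) (dunklU hk G), Lp.coeFn_smul c (hgK.toLp _),
    hgK.coeFn_toLp] with l h1 h2 h3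
  rw [h1, Pi.sub_apply, h2, Pi.smul_apply, h3, smul_eq_mul]
  ring

/-- The constant c inverts the two-wavelet limit of the multiplier, so cK - 1 tends to 0 almost
everywhere while staying bounded by ‖c‖D + 1. Dominated convergence applies. -/
lemma tendsto_calderonTruncation {k B : ℝ} (hk : -1 / 2 ≤ k)
    {M : Matrix.SpecialLinearGroup (Fin 2) ℝ} (hb : M 0 1 ≠ 0) (h0 : 0 ≤ B) {ψ φ f : ℝ → ℂ}
    {C : ℂ} (h : IsTwoWavelet k M ψ φ C) (hC : C ≠ 0) (hf : MemLp f 2 (muK k))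
    (hB : ∀ᵐ l ∂muK k, ‖dunklU hk ((memLp_chirp_mul h.1 (M 0 0 / M 0 1)).toLp _) l‖ ≤ B) :
    Tendsto (fun p : ℝ × ℝ =>
      eLpNorm (fun y => calderonTruncation k M ψ φ C f p.1 p.2 y - f y) 2 (muK k))
      (𝓝[>] 0 ×ˢ atTop) (𝓝 0) := by
  have hadm := h.ae_dunklU hk hb rfl rfl
  have hm : ∀ F : DunklL2 k, Measurable F := fun F => (Lp.stronglyMeasurable F).measurable
  have hpos : ∀ᶠ p : ℝ × ℝ in 𝓝[>] (0 : ℝ) ×ˢ (atTop : Filter ℝ), 0 < p.1 :=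
    tendsto_fst.eventually self_mem_nhdsWithin
  refine Tendsto.congr' (hpos.mono fun p hp =>
    (calderonTruncation_sub hk hb h0 h hf hB hp p.2).2.symm) ?_
  obtain ⟨D, hD⟩ := exists_dilationMultiplier_bound
    (h := fun x => conj (dunklU hk ((memLp_chirp_mul h.1 (M 0 0 / M 0 1)).toLp _) x) *
      dunklU hk ((memLp_chirp_mul h.2.1 (M 0 0 / M 0 1)).toLp _) x) (hadm.mono fun l hl => hl.1)
  set c := 1 / (ibPow k (-(M 0 1)) * conj C) * (1 / ibPow k (M 0 1)) with hc
  refine tendsto_eLpNorm_mul_zero (Lp.memLp _) _ (‖c‖ * D + 1) (Eventually.of_forall fun p => ?_)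
    (hpos.mono fun p hp => ?_) ?_
  · exact ((stronglyMeasurable_dilationMultiplier ((Complex.continuous_conj.measurable.comp
      (hm _)).mul (hm _)) p.1 p.2).aestronglyMeasurable.const_mul c).sub aestronglyMeasurable_const
  · filter_upwards [(ae_muK_iff hk).2 hD] with l hl
    refine (norm_sub_le _ _).trans ?_
    rw [norm_mul, norm_one]
    gcongr
    exact hl p.1 p.2 hp
  · filter_upwards [(ae_muK_iff hk).2 hadm] with l hl
    have h1 := ((tendsto_dilationMultiplier
      (h := fun x => conj (dunklU hk ((memLp_chirp_mul h.1 (M 0 0 / M 0 1)).toLp _) x) *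
        dunklU hk ((memLp_chirp_mul h.2.1 (M 0 0 / M 0 1)).toLp _) x)
      hl.1).const_mul c).sub_const 1
    rw [hl.2] at h1
    have h2 : c * (conj C * (ibPow k (M 0 1) * ibPow k (-(M 0 1)))) - 1 = 0 := by
      have i1 := ibPow_ne_zero k hb
      have i2 := ibPow_ne_zero k (neg_ne_zero.2 hb)
      have i3 : conj C ≠ 0 := (map_ne_zero _).2 hC
      rw [hc]
      generalize ibPow k (-(M 0 1)) = u at i2
      generalize ibPow k (M 0 1) = v at i1
      generalize conj C = w at i3
      field_simp
      ring
    rwa [h2] at h1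

end LCDunkl

end

theorem theoremT (k : ℝ) (hk : -1 / 2 ≤ k) (M : Matrix.SpecialLinearGroup (Fin 2) ℝ)
    (hb : M 0 1 ≠ 0) (ψ φ : ℝ → ℂ) (C : ℂ) (hψφ : LCDunkl.IsTwoWavelet k M ψ φ C) (hC : C ≠ 0)
    (hψ : MeasureTheory.MemLp (LCDunkl.lcdt k M ψ) ⊤ (LCDunkl.muK k))
    (hφ : MeasureTheory.MemLp (LCDunkl.lcdt k M φ) ⊤ (LCDunkl.muK k))
    (f : ℝ → ℂ) (hf : MeasureTheory.MemLp f 2 (LCDunkl.muK k)) :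
    (∀ ε δ : ℝ, 0 < ε → ε < δ →
      (∀ y : ℝ, MeasureTheory.IntegrableOn (LCDunkl.calderonIntegrand k M ψ φ f y)
        (Set.Ioo ε δ ×ˢ (Set.univ : Set ℝ)) (LCDunkl.nuK k)) ∧
      MeasureTheory.MemLp (LCDunkl.calderonTruncation k M ψ φ C f ε δ) 2 (LCDunkl.muK k)) ∧
    Filter.Tendsto
      (fun p : ℝ × ℝ => MeasureTheory.eLpNorm
        (fun y => LCDunkl.calderonTruncation k M ψ φ C f p.1 p.2 y - f y) 2 (LCDunkl.muK k))
      (nhdsWithin (0 : ℝ) (Set.Ioi 0) ×ˢ Filter.atTop) (nhds 0) := by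
  obtain ⟨B, h0, hB⟩ := LCDunkl.exists_bound_of_lcdt hk hb hψφ.1 hψ
  exact ⟨fun ε δ hε _ => ⟨fun y => (LCDunkl.integrableOn_calderonIntegrand hk M hε h0 hψφ.1
      hψφ.2.1 hf hB y).1, (LCDunkl.calderonTruncation_sub hk hb h0 hψφ hf hB hε δ).1⟩,
    LCDunkl.tendsto_calderonTruncation hk hb h0 hψφ hC hf hB⟩
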